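/- Let $X,Y$ be smooth manifolds of dimension $3$. Definitions. Let $f$ be a smooth map between manifolds of dimension $N$ (in coordinates, $\mathbb R^N\to\mathbb R^N$), and let $\Sigma_1(f)=\{\det df=0\}$. It drops rank simply at $p$ if $\operatorname{rank} df_p=N-1$ and $d(\det df)_p\ne0$; it then has a fold at $p$ if $\ker df_p\not\subset T_p\Sigma_1(f)$, and a (Whitney) cusp at $p$ if $\ker df_p\subset T_p\Sigma_1(f)$ and, for a smooth nonvanishing vector field $v$ near $p$ with $v\in\ker df$ along $\Sigma_1(f)$, the function $d(\det df)(v)$, which vanishes at $p$, has nonzero derivative at $p$ in the direction $v_p$. The set of cusp points is $\Sigma_{1,1}(f)$. A canonical relation $C\subset(T^*X\setminus0)\times(T^*Y\setminus0)$ is a conic $6$-dimensional submanifold on which $\omega_{T^*X}-\omega_{T^*Y}=0$; $\pi_L,\pi_R$ are its projections to $T^*X$, $T^*Y$. It is a flat two-sided cusp if (i) at every point where they are not local diffeomorphisms, $\pi_L$ and $\pi_R$ have a fold or a cusp; (ii) $\Sigma_{1,1}(\pi_L)=\Sigma_{1,1}(\pi_R)=:\Sigma_{1,1}$; (iii) $\pi_L(\Sigma_{1,1})$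 and $\pi_R(\Sigma_{1,1})$ are coisotropic and nonradial: at each point of $\Sigma_{1,1}$ the image tangent space contains its symplectic orthogonal, and this orthogonal does not contain the radial vector $\sum\xi_j\partial_{\xi_j}$. Theorem. Let $C$ be a flat two-sided cusp and $c^0\in\Sigma_{1,1}$. Then there are homogeneous canonical transformations $\chi_L$ from a conic neighbourhood of $\pi_L(c^0)$, and $\chi_R$ from a conic neighbourhood of $\pi_R(c^0)$, onto open conic subsets of $T^*\mathbb R^3\setminus0$, mapping $c^0$ to $(0,e_3^*;0,e_3^*)$, such that near this point the conjugated relation $\chi_L\circ C\circ\chi_R^{-1}$ is parametrized by the nondegenerate phase function $$\phi(x,y,\theta_2,\theta_3)=\bigl(S_2-y_2+(x_1-y_1)^2S_4\bigr)\theta_2+(x_3-y_3)\theta_3+(x_1-y_1)^4S_3 ,$$ that is, it equals $\{(x,\phi_x;y,-\phi_y):\phi_\theta=0\}$. Here $S_2,S_3,S_4$ are smooth functions of $(x,y_1,\theta_2,\theta_3)$ on an open conic neighbourhood of $(0,0,0,1)$, homogeneous in $\theta=(\theta_2,\theta_3)$ of degrees $0,1,0$. In the coordinates $(x,y_1,\theta_2,\theta_3)$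 on the relation near the base point, $\Sigma_1(\pi_L)=\Sigma_1(\pi_R)=\{\theta_2=f(x,y_1,\theta_3)\}$ with $f$ smooth, homogeneous of degree $1$ in $\theta_3$ and vanishing for $y_1=x_1$, and $\Sigma_{1,1}=\{\theta_2=f,\ y_1=x_1\}=\{\theta_2=0,\ y_1=x_1\}$. Moreover $$\partial_{x_2}S_2\ne0,\qquad S_3\ne0,\qquad S_4\ne0\qquad\text{on }\Sigma_{1,1},$$ where $S_2$ can be taken such that $S_2(x,y_1,0,\theta_3)$ depends on $(x_2,x_3)$ only. -/

import Mathlib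

open Set Filter Topology Manifold
open scoped ContDiff

noncomputable section

namespace FlatCusp

/-- The three dimensional model space. -/
abbrev V3 : Type := EuclideanSpace ℝ (Fin 3)

/-- The cotangent space `T*ℝ³`; a point is `(x, ξ)`, with `ξ` given by its components. -/
abbrev Phase : Type := V3 × V3

/-- The `i`-th standard basis vector of `ℝ³` (indices `0, 1, 2`). -/
def basisVec (i : Fin 3) : V3 := EuclideanSpace.single i (1 : ℝ)

/-! ### Singularities of maps between spaces of equal dimension -/

section Singularities

variable {E : Type*} [NormedAddCommGroup E] [NormedSpace ℝ E]

/-- The Jacobian determinant `det df`. -/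
def jac (f : E → E) (q : E) : ℝ := (fderiv ℝ f q).det

/-- `f` drops rank simply at `p`: the rank of `df_p` is `N - 1` and `d(det df)_p ≠ 0`. -/
def DropsRankSimply (f : E → E) (p : E) : Prop :=
  Module.finrank ℝ (LinearMap.range (fderiv ℝ f p).toLinearMap) + 1 = Module.finrank ℝ E ∧
    fderiv ℝ (jac f) p ≠ 0

/-- Fold: `ker df_p` is not contained in `T_p Σ₁ = ker d(det df)_p`. -/
def IsFold (f : E → E) (p : E) : Prop :=
  DropsRankSimply f p ∧ ∃ v : E, fderiv ℝ f p v = 0 ∧ fderiv ℝ (jac f) p v ≠ 0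

/-- Whitney cusp: `ker df_p ⊆ T_p Σ₁`, and if `v` is a smooth nonvanishing vector field which
spans `ker df` along `Σ₁`, then `d(det df)(v)`, which vanishes at `p`, has a simple zero there
in the direction of `v`. This does not depend on the choice of `v`. In adapted coordinates
`f = (x₁, …, x_{N-1}, h)` it says `∂_N h = ∂_N² h = 0`, `d(∂_N h) ≠ 0`, `∂_N³ h ≠ 0`. -/
def IsCusp (f : E → E) (p : E) : Prop :=
  DropsRankSimply f p ∧ (∀ v : E, fderiv ℝ f p v = 0 → fderiv ℝ (jac f) p v = 0) ∧
    ∃ (N : Set E) (v : E → E), IsOpen N ∧ p ∈ N ∧ ContDiffOn ℝ ∞ v N ∧ v p ≠ 0 ∧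
      (∀ q ∈ N, jac f q = 0 → fderiv ℝ f q (v q) = 0) ∧
      fderiv ℝ (fun q => fderiv ℝ (jac f) q (v q)) p (v p) ≠ 0

end Singularities

/-! ### The symplectic structure of `T*ℝ³` -/

/-- The symplectic form `dξ ∧ dx` of `T*ℝ³`, evaluated on two tangent vectors. -/
def symp (a b : Phase) : ℝ := ∑ i, (a.2 i * b.1 i - a.1 i * b.2 i)

/-- Dilation in the fibre: `(x, ξ) ↦ (x, tξ)`. -/
def dil (t : ℝ) (a : Phase) : Phase := (a.1, t • a.2)

/-- Simultaneous dilation in both fibres. -/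
def dil₂ (t : ℝ) (c : Phase × Phase) : Phase × Phase := (dil t c.1, dil t c.2)

/-- `χ` is a homogeneous canonical transformation between open conic subsets of `T*ℝ³ \ 0`. -/
structure IsHomogCanonical (χ : OpenPartialHomeomorph Phase Phase) : Prop where
  smooth : ContDiffOn ℝ ∞ χ χ.source
  smooth_symm : ContDiffOn ℝ ∞ χ.symm χ.target
  source_ne_zero : ∀ a ∈ χ.source, a.2 ≠ 0
  target_ne_zero : ∀ a ∈ χ.target, a.2 ≠ 0
  source_conic : ∀ a ∈ χ.source, ∀ t : ℝ, 0 < t → dil t a ∈ χ.source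
  homogeneous : ∀ a ∈ χ.source, ∀ t : ℝ, 0 < t → χ (dil t a) = dil t (χ a)
  symplectic : ∀ a ∈ χ.source, ∀ u v : Phase,
    symp (fderiv ℝ χ a u) (fderiv ℝ χ a v) = symp u v

/-! ### Canonical relations in `(T*ℝ³ \ 0) × (T*ℝ³ \ 0)` -/

/-- `γ : O → C` is a smooth parametrization of `C` near `c = γ 0` by an open set `O` of a six
dimensional space: it is onto a relatively open subset of `C` and its inverse is the restriction
of a smooth map of the ambient space. A set which has such a parametrization at each of its points
is the same as an embedded six dimensional submanifold. -/
structure IsLocalParam (C : Set (Phase × Phase)) (c : Phase × Phase)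
    (γ : Phase → Phase × Phase) (O : Set Phase) : Prop where
  isOpen : IsOpen O
  zero_mem : (0 : Phase) ∈ O
  map_zero : γ 0 = c
  smooth : ContDiffOn ℝ ∞ γ O
  embedding : ∃ (U : Set (Phase × Phase)) (κ : Phase × Phase → Phase),
    IsOpen U ∧ γ '' O = C ∩ U ∧ ContDiffOn ℝ ∞ κ U ∧ ∀ q ∈ O, κ (γ q) = q

/-- A canonical relation: a conic six dimensional submanifold of `(T*ℝ³ \ 0) × (T*ℝ³ \ 0)` on
which the difference of the two symplectic forms vanishes. -/
structure IsCanonicalRelation (C : Set (Phase × Phase)) : Prop where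
  ne_zero : ∀ c ∈ C, c.1.2 ≠ 0 ∧ c.2.2 ≠ 0
  conic : ∀ c ∈ C, ∀ t : ℝ, 0 < t → dil₂ t c ∈ C
  lagrangian : ∀ c ∈ C, ∃ γ O, IsLocalParam C c γ O ∧ ∀ q ∈ O, ∀ u v : Phase,
    symp (fderiv ℝ γ q u).1 (fderiv ℝ γ q v).1 = symp (fderiv ℝ γ q u).2 (fderiv ℝ γ q v).2

/-- `Σ₁(π)`: the points of the submanifold `C` at which `dπ|_{TC}` is not invertible. Here and
below `π` is one of the projections `Prod.fst` (that is `π_L`) and `Prod.snd` (that is `π_R`). -/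
def singSet (π : Phase × Phase → Phase) (C : Set (Phase × Phase)) : Set (Phase × Phase) :=
  {c | ∃ γ O, IsLocalParam C c γ O ∧ jac (π ∘ γ) 0 = 0}

/-- The points of the submanifold `C` at which `π|_C` has a fold. -/
def foldSet (π : Phase × Phase → Phase) (C : Set (Phase × Phase)) : Set (Phase × Phase) :=
  {c | ∃ γ O, IsLocalParam C c γ O ∧ IsFold (π ∘ γ) 0}

/-- `Σ₁,₁(π)`: the points of the submanifold `C` at which `π|_C` has a cusp. -/
def cuspSet (π : Phase × Phase → Phase) (C : Set (Phase × Phase)) : Set (Phase × Phase) :=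
  {c | ∃ γ O, IsLocalParam C c γ O ∧ IsCusp (π ∘ γ) 0}

/-- `π|_C` has at most cusp singularities. -/
def AtMostCusp (π : Phase × Phase → Phase) (C : Set (Phase × Phase)) : Prop :=
  ∀ c ∈ singSet π C, c ∈ foldSet π C ∨ c ∈ cuspSet π C

/-- The velocities at `c` of smooth curves in `A`: the tangent space when `A` is a submanifold. -/
def tangentVecs (A : Set (Phase × Phase)) (c : Phase × Phase) : Set (Phase × Phase) :=
  {w | ∃ γ : ℝ → Phase × Phase, ContDiffAt ℝ ∞ γ 0 ∧ γ 0 = c ∧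
    (∀ᶠ t in 𝓝 (0 : ℝ), γ t ∈ A) ∧ deriv γ 0 = w}

/-- A tangent space `T ⊆ T_a(T*ℝ³)` is coisotropic: its symplectic orthogonal lies in it. -/
def IsCoisotropic (T : Set Phase) : Prop :=
  ∀ u : Phase, (∀ w ∈ T, symp u w = 0) → u ∈ T

/-- A tangent space `T` at `a = (x, ξ)` is nonradial: the radial vector `∑ ξ_j ∂_{ξ_j}` does not
lie in the symplectic orthogonal of `T`, the tangent space of the Hamiltonian foliation. -/
def IsNonradial (a : Phase) (T : Set Phase) : Prop :=
  ¬ ∀ w ∈ T, symp ((0 : V3), a.2) w = 0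

/-- Flat two-sided cusp in `(T*ℝ³ \ 0) × (T*ℝ³ \ 0)`. In the last two fields
`Prod.fst '' T_c Σ₁,₁` is the tangent space of `π_L(Σ₁,₁)`, and similarly on the right. -/
structure IsFlatTwoSidedCuspLocal (C : Set (Phase × Phase)) : Prop where
  canonical : IsCanonicalRelation C
  atMostCusp_left : AtMostCusp Prod.fst C
  atMostCusp_right : AtMostCusp Prod.snd C
  cuspSet_eq : cuspSet Prod.fst C = cuspSet Prod.snd C
  flat_left : ∀ c ∈ cuspSet Prod.fst C,
    IsCoisotropic (Prod.fst '' tangentVecs (cuspSet Prod.fst C) c) ∧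
      IsNonradial c.1 (Prod.fst '' tangentVecs (cuspSet Prod.fst C) c)
  flat_right : ∀ c ∈ cuspSet Prod.snd C,
    IsCoisotropic (Prod.snd '' tangentVecs (cuspSet Prod.snd C) c) ∧
      IsNonradial c.2 (Prod.snd '' tangentVecs (cuspSet Prod.snd C) c)

/-! ### Manifolds -/

/-- The set of covectors of a three dimensional manifold. -/
abbrev Cotangent (X : Type*) [TopologicalSpace X] [ChartedSpace V3 X] : Type _ :=
  Σ x : X, (TangentSpace (𝓡 3) x →L[ℝ] ℝ)

/-- The coordinates `(x, ξ)` of `T*X` induced by a chart `e` of `X`: the `i`-th component of a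
covector is its value on the coordinate vector field `∂/∂x_i` of the chart. -/
def cotangentCoord {X : Type*} [TopologicalSpace X] [ChartedSpace V3 X]
    (e : OpenPartialHomeomorph X V3) (a : Cotangent X) : Phase :=
  (e a.1, WithLp.toLp 2 fun i => a.2 (mfderiv (𝓡 3) (𝓡 3) e.symm (e a.1) (basisVec i)))

section Manifolds

variable {X Y : Type*} [TopologicalSpace X] [ChartedSpace V3 X]
  [TopologicalSpace Y] [ChartedSpace V3 Y]

/-- Coordinates of a pair of covectors. -/
def pairCoord (e : OpenPartialHomeomorph X V3) (e' : OpenPartialHomeomorph Y V3)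
    (c : Cotangent X × Cotangent Y) : Phase × Phase :=
  (cotangentCoord e c.1, cotangentCoord e' c.2)

/-- The part of a relation `C ⊆ T*X × T*Y` over the domains of two charts, in coordinates. -/
def inCharts (e : OpenPartialHomeomorph X V3) (e' : OpenPartialHomeomorph Y V3)
    (C : Set (Cotangent X × Cotangent Y)) : Set (Phase × Phase) :=
  pairCoord e e' '' {c ∈ C | c.1.1 ∈ e.source ∧ c.2.1 ∈ e'.source}

/-- Flat two-sided cusp in `(T*X \ 0) × (T*Y \ 0)`. All the conditions are local and invariant
under the canonical transformations of `T*X` and `T*Y` induced by changes of charts. -/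
def IsFlatTwoSidedCusp (C : Set (Cotangent X × Cotangent Y)) : Prop :=
  ∀ e ∈ atlas V3 X, ∀ e' ∈ atlas V3 Y, IsFlatTwoSidedCuspLocal (inCharts e e' C)

/-- `c` is a point of `Σ₁,₁` (the cusp set of `π_L`). -/
def IsCuspPoint (C : Set (Cotangent X × Cotangent Y)) (c : Cotangent X × Cotangent Y) : Prop :=
  c ∈ C ∧ ∀ e ∈ atlas V3 X, ∀ e' ∈ atlas V3 Y, c.1.1 ∈ e.source → c.2.1 ∈ e'.source →
    pairCoord e e' c ∈ cuspSet Prod.fst (inCharts e e' C)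

end Manifolds

/-- The relation `χL ∘ C ∘ χR⁻¹`. -/
def conjugate (χL χR : OpenPartialHomeomorph Phase Phase) (C : Set (Phase × Phase)) :
    Set (Phase × Phase) :=
  (fun c => (χL c.1, χR c.2)) '' {c ∈ C | c.1 ∈ χL.source ∧ c.2 ∈ χR.source}

/-! ### Phase functions `φ(x, y, θ)` with `θ = (θ₂, θ₃)` -/

/-- The arguments `(x, y, θ)` of a phase function. -/
abbrev PhaseArg : Type := V3 × V3 × (ℝ × ℝ)

/-- The critical set `{(x, y, θ) ∈ Γ : φ_θ = 0}`. -/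
def critSet (φ : PhaseArg → ℝ) (Γ : Set PhaseArg) : Set PhaseArg :=
  {z ∈ Γ | fderiv ℝ φ z (0, 0, (1, 0)) = 0 ∧ fderiv ℝ φ z (0, 0, (0, 1)) = 0}

/-- `(x, y, θ) ↦ (x, φ_x; y, -φ_y)`. -/
def phaseMap (φ : PhaseArg → ℝ) (z : PhaseArg) : Phase × Phase :=
  ((z.1, WithLp.toLp 2 fun i => fderiv ℝ φ z (basisVec i, 0, 0)),
    (z.2.1, WithLp.toLp 2 fun i => - fderiv ℝ φ z (0, basisVec i, 0)))

/-- `φ` is a nondegenerate phase function on the open conic set `Γ`: it is smooth, homogeneous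
of degree one in `θ ≠ 0`, and the differentials of `∂φ/∂θ₂`, `∂φ/∂θ₃` are linearly independent on
the critical set. -/
structure IsPhaseFunction (φ : PhaseArg → ℝ) (Γ : Set PhaseArg) : Prop where
  isOpen : IsOpen Γ
  ne_zero : ∀ z ∈ Γ, z.2.2 ≠ 0
  conic : ∀ z ∈ Γ, ∀ t : ℝ, 0 < t → (z.1, z.2.1, t • z.2.2) ∈ Γ
  smooth : ContDiffOn ℝ ∞ φ Γ
  homogeneous : ∀ z ∈ Γ, ∀ t : ℝ, 0 < t → φ (z.1, z.2.1, t • z.2.2) = t * φ z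
  nondegenerate : ∀ z ∈ critSet φ Γ, LinearIndependent ℝ
    ![fderiv ℝ (fun w => fderiv ℝ φ w (0, 0, (1, 0))) z,
      fderiv ℝ (fun w => fderiv ℝ φ w (0, 0, (0, 1))) z]

/-- `φ`, on `Γ`, parametrizes `C` near `c`: in some open conic neighbourhood of `c`, the relation
`C` is `{(x, φ_x; y, -φ_y) : φ_θ = 0}`. -/
def ParametrizesNear (φ : PhaseArg → ℝ) (Γ : Set PhaseArg) (C : Set (Phase × Phase))
    (c : Phase × Phase) : Prop :=
  IsPhaseFunction φ Γ ∧ ∃ U : Set (Phase × Phase), IsOpen U ∧ c ∈ U ∧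
    (∀ b ∈ U, ∀ t : ℝ, 0 < t → dil₂ t b ∈ U) ∧ C ∩ U = phaseMap φ '' critSet φ Γ

/-- The arguments `(x, y₁, θ)` of the coefficients of the normal form. -/
abbrev CoeffArg : Type := V3 × ℝ × (ℝ × ℝ)

/-- `(x, y, θ) ↦ (x, y₁, θ)`. -/
def coeffArg (z : PhaseArg) : CoeffArg := (z.1, z.2.1 0, z.2.2)

/-- `S` is smooth and homogeneous of degree `m` in `θ` on `W`. -/
def IsSmoothHomog (m : ℕ) (S : CoeffArg → ℝ) (W : Set CoeffArg) : Prop :=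
  ContDiffOn ℝ ∞ S W ∧
    ∀ w ∈ W, ∀ t : ℝ, 0 < t → S (w.1, w.2.1, t • w.2.2) = t ^ m * S w

/-- `φ = (S₂ - y₂ + (x₁ - y₁)² S₄) θ₂ + (x₃ - y₃) θ₃ + (x₁ - y₁)⁴ S₃`, where `S₂, S₃, S₄` are
functions of `(x, y₁, θ₂, θ₃)`. -/
def normalPhase (S₂ S₃ S₄ : CoeffArg → ℝ) (z : PhaseArg) : ℝ :=
  (S₂ (coeffArg z) - z.2.1 1 + (z.1 0 - z.2.1 0) ^ 2 * S₄ (coeffArg z)) * z.2.2.1 +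
    (z.1 2 - z.2.1 2) * z.2.2.2 + (z.1 0 - z.2.1 0) ^ 4 * S₃ (coeffArg z)

end FlatCusp

end

/-!
The theorem is a statement about germs, proved in two steps.

*Straightening the cusp set.* In a parametrization of `C` the cusp set `Σ₁,₁` is cut out by two
independent functions, and both projections are immersions of it (`FlatRel.exists_cuspData`). Its
two images are four dimensional, coisotropic and nonradial. A linear change of coordinates followed
by a shear makes each of them transversal to the fibres of the cotangent bundle, up to the radial
vector (`IsFlatSpace.exists_shear`), and then `Σ₁,₁` is the cone over a graph
`x ↦ ((x, β(x)), (Y(x), ζ(x)))`, where `Y` is a local diffeomorphism which pulls back the one-form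
with coefficients `ζ` to the one with coefficients `β`, because the canonical one-forms agree on
`C`. The image under `dπ_R` of the kernel of `dπ_L` lies in the characteristic direction of the
right image; it projects to a nonvanishing vector field `Z` in the kernel of the one-form on the
right base (`CuspData.exists_cuspSection`). Coisotropy is integrability of this one-form, so a
variant of Frobenius' theorem (`exists_adapted_coordinates`) gives coordinates in which it is a
multiple of `dy₃` and `Z` is `∂/∂y₁`. Lifting these coordinates on the right, and their composition
with `Y` on the left, turns `Σ₁,₁` into the diagonal `{(x, s dx₃; x, s dx₃)}`, with the kernel of
`dπ_L` along `∂/∂y₁` (`FlatRel.exists_straight`).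

*The generating function.* Then `(x, y₁, η₂, η₃)` are coordinates of `C`, and `C` is generated by
the homogeneous function `θ₃ g(x, y₁, θ₂ / θ₃)` where `g` is `τ y₂ + y₃` on the slice `η₃ = 1`
(`StraightRel.exists_generating`). That the diagonal is the cusp set determines the derivatives of
`g` along it up to third order in `y₁` (`eventually_diagVanishing`): for `τ = 0`, `y₁ = x₁` one has
`g = x₃` and `g_τ = x₂`, while the first three `y₁`-derivatives of `g` and the first one of `g_τ`
vanish. Simple rank drop and the cusp condition say that the next derivatives `∂²_{y₁} g_τ` and
`∂⁴_{y₁} g` do not vanish (`IsCusp.genJac_ne_zero`). Taylor's formula with smooth remainders gives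
`g = x₃ + τ (x₂ + τ a + (x₁ - y₁)² S₄) + (x₁ - y₁)⁴ s₃`, which is the normal form
(`exists_normal_form`) with `S₂ = x₂ + τ a`. The singular set of `π_L` is the zero set of a
determinant in the derivatives of `g`, whose `τ`-derivative does not vanish, hence a graph over
`(x, y₁)` (`exists_singular_graph`); it is also that of `π_R`, because the two symplectic forms
agree on `C` (`IsCanonicalRelation.mem_singSet_snd_iff`).

Smooth means `C^∞` in a fixed neighbourhood, see `SmoothNear`. The smooth dependence of flows and
of integrals on parameters is obtained from the smoothness of superposition operators on spaces of
continuous functions (`contDiff_comp_continuousMap`).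
-/

noncomputable section

namespace FlatCusp

/-! ### Composition operators on spaces of continuous functions -/

section Superposition

universe u

variable {K : Type*} [TopologicalSpace K] [CompactSpace K]
  {E : Type u} [NormedAddCommGroup E] [NormedSpace ℝ E]

/-- Pointwise application of a continuous family of linear maps, as a bounded bilinear map. -/
def pointwiseApply (K : Type*) [TopologicalSpace K] [CompactSpace K]
    (E : Type*) [NormedAddCommGroup E] [NormedSpace ℝ E]
    (G : Type*) [NormedAddCommGroup G] [NormedSpace ℝ G] :
    C(K, E →L[ℝ] G) →L[ℝ] C(K, E) →L[ℝ] C(K, G) :=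
  LinearMap.mkContinuous₂
    (LinearMap.mk₂ ℝ (fun (A : C(K, E →L[ℝ] G)) (v : C(K, E)) =>
        (⟨fun s => A s (v s), A.continuous.clm_apply v.continuous⟩ : C(K, G)))
      (by intros; ext; simp) (by intros; ext; simp) (by intros; ext; simp) (by intros; ext; simp))
    1 (by
      intro A v
      rw [ContinuousMap.norm_le _ (by positivity)]
      intro s
      refine ((A s).le_opNorm (v s)).trans ?_
      rw [one_mul]
      gcongr
      · exact A.norm_coe_le_norm s
      · exact v.norm_coe_le_norm s)

/-- The superposition operator `w ↦ F ∘ w` on `C(K, E)` is differentiable, since `F'` is uniformly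
continuous near the compact range of `u`. -/
theorem hasFDerivAt_comp_continuousMap {G : Type*} [NormedAddCommGroup G] [NormedSpace ℝ G]
    (F : C(E, G)) (F' : C(E, E →L[ℝ] G)) (hF : ∀ x, HasFDerivAt F (F' x) x) (u : C(K, E)) :
    HasFDerivAt (fun w : C(K, E) => F.comp w) (pointwiseApply K E G (F'.comp u)) u := by
  rw [hasFDerivAt_iff_isLittleO_nhds_zero, Asymptotics.isLittleO_iff]
  intro ε hε
  have hcpt : IsCompact (range u) := isCompact_range u.continuous
  have h := hcpt.uniformContinuousAt_of_continuousAt F' (fun a _ => F'.continuous.continuousAt)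
    (Metric.dist_mem_uniformity hε)
  obtain ⟨δ, hδ, hd⟩ := Metric.mem_uniformity_dist.1 h
  filter_upwards [Metric.ball_mem_nhds (0 : C(K, E)) hδ] with v hv
  rw [ContinuousMap.norm_le _ (by positivity)]
  intro s
  have hvs : ‖v s‖ < δ := (v.norm_coe_le_norm s).trans_lt (by simpa using hv)
  have key := (convex_ball (u s) δ).norm_image_sub_le_of_norm_hasFDerivWithin_le' (f := F)
    (f' := F') (φ := F' (u s)) (C := ε) (x := u s) (y := u s + v s)
    (fun x _ => (hF x).hasFDerivWithinAt)
    (fun x hx => by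
      have := @hd (u s) x (by rw [dist_comm]; exact hx) (mem_range_self s)
      rw [← dist_eq_norm, dist_comm]
      exact this.le)
    (Metric.mem_ball_self hδ) (by simpa using hvs)
  simp only [add_sub_cancel_left] at key
  refine key.trans ?_
  gcongr
  exact v.norm_coe_le_norm s

/-- By induction on the order: the derivative of a superposition operator is the superposition
operator of `F'`, composed with a bounded linear map. -/
theorem contDiff_comp_continuousMap {G : Type u} [NormedAddCommGroup G] [NormedSpace ℝ G]
    (F : C(E, G)) (hF : ContDiff ℝ ∞ F) :
    ContDiff ℝ ∞ (fun w : C(K, E) => F.comp w) := by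
  rw [contDiff_infty]
  intro n
  induction n generalizing G with
  | zero =>
    rw [Nat.cast_zero, contDiff_zero]
    exact ContinuousMap.continuous_postcomp F
  | succ n ih =>
    have hF' : ContDiff ℝ ∞ (fderiv ℝ F) := hF.fderiv_right (by simp)
    let F' : C(E, E →L[ℝ] G) := ⟨fderiv ℝ F, hF'.continuous⟩
    have hd : ∀ u : C(K, E), HasFDerivAt (fun w : C(K, E) => F.comp w)
        (pointwiseApply K E G (F'.comp u)) u :=
      hasFDerivAt_comp_continuousMap F F'
        (fun x => (hF.differentiable (by simp) x).hasFDerivAt)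
    rw [Nat.cast_succ, contDiff_succ_iff_fderiv]
    refine ⟨fun u => (hd u).differentiableAt, by simp, ?_⟩
    have : fderiv ℝ (fun w : C(K, E) => F.comp w) =
        fun u => pointwiseApply K E G (F'.comp u) := funext fun u => (hd u).fderiv
    rw [this]
    exact (pointwiseApply K E G).contDiff.comp (ih F' hF')

end Superposition

/-! ### Integrals depending smoothly on a parameter, and division by a coordinate -/

section Division

variable {P : Type} [NormedAddCommGroup P] [NormedSpace ℝ P]

/-- The primitive `s ↦ ∫₀ˢ u`, as a bounded operator on `C([0,1], G)`. -/
def primitive (G : Type*) [NormedAddCommGroup G] [NormedSpace ℝ G] :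
    C(unitInterval, G) →L[ℝ] C(unitInterval, G) :=
  LinearMap.mkContinuous
    { toFun := fun u => ⟨fun s => ∫ σ in (0 : ℝ)..s, IccExtend zero_le_one u σ, by
        have : Continuous (IccExtend (zero_le_one (α := ℝ)) u) := u.continuous.Icc_extend'
        exact (intervalIntegral.continuous_primitive
          (fun a b => this.intervalIntegrable a b) 0).comp continuous_subtype_val⟩
      map_add' := fun u v => by
        ext s
        have hu : Continuous (IccExtend (zero_le_one (α := ℝ)) u) := u.continuous.Icc_extend'
        have hv : Continuous (IccExtend (zero_le_one (α := ℝ)) v) := v.continuous.Icc_extend'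
        simp only [ContinuousMap.coe_mk, ContinuousMap.add_apply]
        rw [← intervalIntegral.integral_add (hu.intervalIntegrable _ _)
          (hv.intervalIntegrable _ _)]
        rfl
      map_smul' := fun c u => by
        ext s
        simp only [ContinuousMap.coe_mk, ContinuousMap.smul_apply, RingHom.id_apply]
        rw [← intervalIntegral.integral_smul]
        rfl }
    1 (fun u => by
      rw [ContinuousMap.norm_le _ (by positivity)]
      intro s
      have h : ∀ σ ∈ uIoc (0 : ℝ) s, ‖IccExtend (zero_le_one (α := ℝ)) u σ‖ ≤ ‖u‖ :=
        fun σ _ => u.norm_coe_le_norm _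
      refine (intervalIntegral.norm_integral_le_of_norm_le_const h).trans ?_
      rw [sub_zero, abs_of_nonneg s.2.1, one_mul]
      exact mul_le_of_le_one_right (norm_nonneg _) s.2.2)

theorem primitive_apply {G : Type*} [NormedAddCommGroup G] [NormedSpace ℝ G]
    (u : C(unitInterval, G)) (s : unitInterval) :
    primitive G u s = ∫ σ in (0 : ℝ)..s, IccExtend zero_le_one u σ := rfl

theorem contDiff_integral_param {G : Type} [NormedAddCommGroup G] [NormedSpace ℝ G]
    {F : P × ℝ → G} (hF : ContDiff ℝ ∞ F) :
    ContDiff ℝ ∞ (fun p => ∫ s in (0 : ℝ)..1, F (p, s)) := by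
  let cst : P →L[ℝ] C(unitInterval, P × ℝ) :=
    LinearMap.mkContinuous
      { toFun := fun p => ContinuousMap.const _ (p, (0 : ℝ))
        map_add' := fun p q => by ext <;> simp
        map_smul' := fun c p => by ext <;> simp } 1 (fun p => by
          rw [ContinuousMap.norm_le _ (by positivity)]
          intro s
          simp)
  let ι : C(unitInterval, P × ℝ) := ⟨fun s => (0, (s : ℝ)), by fun_prop⟩
  have h1 : ContDiff ℝ ∞ (fun p : P => cst p + ι) := cst.contDiff.add contDiff_const
  have h2 := (contDiff_comp_continuousMap (K := unitInterval) ⟨F, hF.continuous⟩ hF).comp h1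
  have h3 := ((ContinuousMap.evalCLM ℝ (1 : unitInterval)).comp (primitive G)).contDiff
    (n := ∞) |>.comp h2
  convert h3 using 2 with p
  change _ = primitive G _ 1
  rw [primitive_apply]
  refine intervalIntegral.integral_congr fun s hs => ?_
  rw [uIcc_of_le (by simp)] at hs
  have hs' : s ∈ Icc (0 : ℝ) 1 := by simpa using hs
  rw [IccExtend_of_mem _ _ hs']
  simp [cst, ι]

/-- Hadamard's lemma: a smooth function which vanishes for `t = 0` is `t` times a smooth one. -/
theorem exists_eq_mul_of_vanishing {f : P × ℝ → ℝ} (hf : ContDiff ℝ ∞ f)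
    (h0 : ∀ p, f (p, 0) = 0) :
    ∃ h : P × ℝ → ℝ, ContDiff ℝ ∞ h ∧ ∀ p t, f (p, t) = t * h (p, t) := by
  have hd : ContDiff ℝ ∞ (fun q : (P × ℝ) × ℝ =>
      fderiv ℝ f (q.1.1, q.2 * q.1.2) (0, 1)) := by
    have h1 : ContDiff ℝ ∞ (fderiv ℝ f) := hf.fderiv_right (by simp)
    have h2 : ContDiff ℝ ∞ (fun q : (P × ℝ) × ℝ => (q.1.1, q.2 * q.1.2)) := by fun_prop
    exact (h1.comp h2).clm_apply contDiff_const
  refine ⟨_, contDiff_integral_param hd, fun p t => ?_⟩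
  have hderiv : ∀ s ∈ uIcc (0 : ℝ) 1,
      HasDerivAt (fun s => f (p, s * t)) (t * fderiv ℝ f (p, s * t) (0, 1)) s := by
    intro s _
    have h1 := (hf.differentiable (by simp) (p, s * t)).hasFDerivAt
    have h2 : HasDerivAt (fun s : ℝ => (p, s * t)) ((0 : P), t) s :=
      (hasDerivAt_const s p).prodMk (by simpa using (hasDerivAt_id s).mul_const t)
    have h3 := h1.comp_hasDerivAt s h2
    have h4 : ((0 : P), t) = t • ((0 : P), (1 : ℝ)) := by simp
    rw [h4, map_smul, smul_eq_mul] at h3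
    exact h3
  have hcont : Continuous fun s : ℝ => t * fderiv ℝ f (p, s * t) (0, 1) := by
    have : Continuous fun s : ℝ => (((p, t), s) : (P × ℝ) × ℝ) := by fun_prop
    exact continuous_const.mul (hd.continuous.comp this)
  have := intervalIntegral.integral_eq_sub_of_hasDerivAt hderiv (hcont.intervalIntegrable _ _)
  rw [intervalIntegral.integral_const_mul] at this
  simp only [one_mul, zero_mul, h0, sub_zero] at this
  exact this.symm

end Division

/-! ### Smooth germs, local diffeomorphisms and flows -/

section Germs

variable {E F G : Type*} [NormedAddCommGroup E] [NormedSpace ℝ E]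
  [NormedAddCommGroup F] [NormedSpace ℝ F] [NormedAddCommGroup G] [NormedSpace ℝ G]

/-- `f` is smooth in a neighbourhood of `a`. (This is stronger than `ContDiffAt ℝ ∞ f a`, which
only provides for each finite order of differentiability a neighbourhood of its own.) -/
def SmoothNear (f : E → F) (a : E) : Prop := ∀ᶠ x in 𝓝 a, ContDiffAt ℝ ∞ f x

theorem SmoothNear.contDiffAt {f : E → F} {a : E} (h : SmoothNear f a) : ContDiffAt ℝ ∞ f a :=
  h.self_of_nhds

theorem SmoothNear.differentiableAt {f : E → F} {a : E} (h : SmoothNear f a) :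
    DifferentiableAt ℝ f a := h.contDiffAt.differentiableAt (by simp)

theorem SmoothNear.continuousAt {f : E → F} {a : E} (h : SmoothNear f a) : ContinuousAt f a :=
  h.contDiffAt.continuousAt

theorem SmoothNear.eventually {f : E → F} {a : E} (h : SmoothNear f a) :
    ∀ᶠ x in 𝓝 a, SmoothNear f x := eventually_eventually_nhds.2 h

theorem SmoothNear.comp {g : F → G} {f : E → F} {a : E} (hg : SmoothNear g (f a))
    (hf : SmoothNear f a) : SmoothNear (fun x => g (f x)) a := by
  filter_upwards [hf, hf.continuousAt.eventually hg] with x hx hgx using hgx.comp x hx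

theorem SmoothNear.fderiv {f : E → F} {a : E} (h : SmoothNear f a) :
    SmoothNear (fderiv ℝ f) a := by
  filter_upwards [h] with x hx using hx.fderiv_right (by simp)

theorem ContDiff.smoothNear {f : E → F} (h : ContDiff ℝ ∞ f) (a : E) : SmoothNear f a :=
  Eventually.of_forall fun _ => h.contDiffAt

theorem ContDiffOn.smoothNear {f : E → F} {s : Set E} (h : ContDiffOn ℝ ∞ f s) (hs : IsOpen s)
    {a : E} (ha : a ∈ s) : SmoothNear f a := by
  filter_upwards [hs.mem_nhds ha] with x hx using h.contDiffAt (hs.mem_nhds hx)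

/-- A smooth germ has a representative which is smooth on the whole space. -/
theorem SmoothNear.exists_contDiff [FiniteDimensional ℝ E] {f : E → F} {a : E}
    (h : SmoothNear f a) : ∃ g : E → F, ContDiff ℝ ∞ g ∧ g =ᶠ[𝓝 a] f := by
  obtain ⟨r, hr, hball⟩ := Metric.eventually_nhds_iff_ball.1 h
  let φ : ContDiffBump a := ⟨r / 4, r / 2, by positivity, by linarith⟩
  refine ⟨fun x => φ x • f x, contDiff_iff_contDiffAt.2 fun x => ?_, ?_⟩
  · by_cases hx : x ∈ Metric.ball a r
    · exact φ.contDiff.contDiffAt.smul (hball x hx)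
    · have hx' : x ∉ tsupport φ := by
        rw [φ.tsupport_eq]
        intro hx'
        exact hx (Metric.closedBall_subset_ball (by change r / 2 < r; linarith) hx')
      have : (fun x => φ x • f x) =ᶠ[𝓝 x] fun _ => 0 := by
        filter_upwards [(isClosed_tsupport φ).isOpen_compl.mem_nhds hx'] with y hy
        simp [image_eq_zero_of_notMem_tsupport hy]
      exact contDiffAt_const.congr_of_eventuallyEq this
  · filter_upwards [φ.eventuallyEq_one] with x hx
    simp [hx]

/-- The inverse function theorem for smooth germs. -/
theorem SmoothNear.exists_openPartialHomeomorph [CompleteSpace E] {f : E → F} {a : E}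
    (h : SmoothNear f a) (f' : E ≃L[ℝ] F) (hf' : HasFDerivAt f (f' : E →L[ℝ] F) a) :
    ∃ e : OpenPartialHomeomorph E F, a ∈ e.source ∧ (∀ x, e x = f x) ∧
      ContDiffOn ℝ ∞ e e.source ∧ ContDiffOn ℝ ∞ e.symm e.target := by
  have hn : (∞ : WithTop ℕ∞) ≠ 0 := by simp
  set e₀ := h.contDiffAt.toOpenPartialHomeomorph f hf' hn
  have h1 : ∀ᶠ x in 𝓝 a, ∃ A : E ≃L[ℝ] F, (A : E →L[ℝ] F) = _root_.fderiv ℝ f x := by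
    have := h.fderiv.continuousAt
    rw [ContinuousAt, hf'.fderiv] at this
    exact this (ContinuousLinearEquiv.nhds f')
  obtain ⟨s, hs, hso, has⟩ := eventually_nhds_iff.1 (h.and h1)
  have hcoe : ∀ x, (e₀.restrOpen s hso) x = f x := fun x => rfl
  refine ⟨e₀.restrOpen s hso, ⟨h.contDiffAt.mem_toOpenPartialHomeomorph_source hf' hn, has⟩,
    hcoe, ?_, ?_⟩
  · intro x hx
    exact ((hs x hx.2).1).contDiffWithinAt
  · intro y hy
    have hx := (e₀.restrOpen s hso).map_target hy
    obtain ⟨hx1, A, hA⟩ := hs _ hx.2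
    refine ((e₀.restrOpen s hso).contDiffAt_symm (f₀' := A) hy ?_ ?_).contDiffWithinAt
    · change HasFDerivAt f _ _
      rw [hA]
      exact (hx1.differentiableAt (by simp)).hasFDerivAt
    · exact hx1

/-- The inverse function theorem in equal finite dimensions, where injectivity of the derivative is
enough. -/
theorem SmoothNear.exists_openPartialHomeomorph_of_injective [FiniteDimensional ℝ E]
    [FiniteDimensional ℝ F]
    (hdim : Module.finrank ℝ E = Module.finrank ℝ F) {f : E → F} {a : E}
    (h : SmoothNear f a) (hinj : ∀ v, _root_.fderiv ℝ f a v = 0 → v = 0) :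
    ∃ e : OpenPartialHomeomorph E F, a ∈ e.source ∧ (∀ x, e x = f x) ∧
      ContDiffOn ℝ ∞ e e.source ∧ ContDiffOn ℝ ∞ e.symm e.target := by
  have : CompleteSpace E := FiniteDimensional.complete ℝ E
  have hi : Function.Injective (_root_.fderiv ℝ f a).toLinearMap :=
    (injective_iff_map_eq_zero _).2 hinj
  let A := (LinearEquiv.ofInjectiveOfFinrankEq _ hi hdim).toContinuousLinearEquiv
  refine h.exists_openPartialHomeomorph A ?_
  have : (A : E →L[ℝ] F) = _root_.fderiv ℝ f a := by ext v; rfl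
  rw [this]
  exact h.differentiableAt.hasFDerivAt

end Germs

section Flow

variable {E : Type} [NormedAddCommGroup E] [NormedSpace ℝ E] [FiniteDimensional ℝ E]

/-- Smooth solutions of the integral equation `u(s) = x + t ∫₀ˢ Z(u)` on `[0,1]`, from the implicit
function theorem at `t = 0`, where the linearized equation is trivial. -/
theorem exists_smooth_integral_solution {Z : E → E} (hZ : ContDiff ℝ ∞ Z) (x₀ : E) :
    ∃ u : ℝ × E → C(unitInterval, E), SmoothNear u (0, x₀) ∧
      (∀ᶠ m in 𝓝 ((0 : ℝ), x₀), ∀ s : unitInterval,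
        u m s = m.2 + m.1 • ∫ σ in (0 : ℝ)..s, Z (IccExtend zero_le_one (u m) σ)) ∧
      ∀ᶠ q in 𝓝 (((0 : ℝ), x₀), (ContinuousMap.const unitInterval x₀)),
        (∀ s : unitInterval, q.2 s = q.1.2 + q.1.1 •
          ∫ σ in (0 : ℝ)..s, Z (IccExtend zero_le_one q.2 σ)) → q.2 = u q.1 := by
  have : CompleteSpace E := FiniteDimensional.complete ℝ E
  let cst : E →L[ℝ] C(unitInterval, E) :=
    LinearMap.mkContinuous
      { toFun := fun p => ContinuousMap.const _ p
        map_add' := fun p q => by ext; simp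
        map_smul' := fun c p => by ext; simp } 1 (fun p => by
          rw [ContinuousMap.norm_le _ (by positivity)]
          intro s
          simp)
  let ZC : C(E, E) := ⟨Z, hZ.continuous⟩
  let V : C(unitInterval, E) → C(unitInterval, E) := fun u => primitive E (ZC.comp u)
  have hV : ContDiff ℝ ∞ V := (primitive E).contDiff.comp (contDiff_comp_continuousMap ZC hZ)
  let Q : (ℝ × E) × C(unitInterval, E) → (ℝ × E) × C(unitInterval, E) :=
    fun q => (q.1, q.2 - cst q.1.2 - q.1.1 • V q.2)
  have hQ : ContDiff ℝ ∞ Q := by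
    have := hV.comp (contDiff_snd (E := ℝ × E))
    have h2 : ContDiff ℝ ∞ (fun q : (ℝ × E) × C(unitInterval, E) => cst q.1.2) :=
      cst.contDiff.comp (contDiff_snd.comp contDiff_fst)
    exact contDiff_fst.prodMk ((contDiff_snd.sub h2).sub
      ((contDiff_fst.comp contDiff_fst).smul this))
  let q₀ : (ℝ × E) × C(unitInterval, E) := ((0, x₀), cst x₀)
  let L : ℝ × E →L[ℝ] C(unitInterval, E) :=
    - cst.comp (ContinuousLinearMap.snd ℝ ℝ E) -
      (ContinuousLinearMap.fst ℝ ℝ E).smulRight (V (cst x₀))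
  let Q' := (ContinuousLinearEquiv.refl ℝ (ℝ × E)).skewProd
    (ContinuousLinearEquiv.refl ℝ C(unitInterval, E)) L
  have hQ' : HasFDerivAt Q (Q' : _ →L[ℝ] _) q₀ := by
    have h1 : HasFDerivAt (fun q : (ℝ × E) × C(unitInterval, E) => q.1)
      (ContinuousLinearMap.fst ℝ _ _) q₀ := hasFDerivAt_fst
    have h2 : HasFDerivAt (fun q : (ℝ × E) × C(unitInterval, E) => q.2)
      (ContinuousLinearMap.snd ℝ _ _) q₀ := hasFDerivAt_snd
    have h3 := ((cst.comp (ContinuousLinearMap.snd ℝ ℝ E)).hasFDerivAt (x := q₀.1)).comp q₀ h1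
    have h4 := ((ContinuousLinearMap.fst ℝ ℝ E).hasFDerivAt (x := q₀.1)).comp q₀ h1
    have h5 := ((hV.differentiable (by simp)) q₀.2).hasFDerivAt.comp q₀ h2
    refine (h1.prodMk ((h2.sub h3).sub (h4.smul h5))).congr_fderiv ?_
    ext : 1
    · refine ContinuousLinearMap.ext fun q => Prod.ext ?_ ?_
      · simp [Q']
      · simp [Q', L, q₀]
    · refine ContinuousLinearMap.ext fun q => Prod.ext ?_ ?_
      · simp [Q']
      · simp [Q', L, q₀]
  obtain ⟨e, he, hcoe, -, hsymm⟩ := (ContDiff.smoothNear hQ q₀).exists_openPartialHomeomorph Q' hQ'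
  have hq : e q₀ = ((0, x₀), 0) := by
    rw [hcoe]
    simp [Q, q₀]
  have htgt : (((0 : ℝ), x₀), (0 : C(unitInterval, E))) ∈ e.target := hq ▸ e.map_source he
  let j : ℝ × E → (ℝ × E) × C(unitInterval, E) := fun m => (m, 0)
  have hj : SmoothNear j (0, x₀) := ContDiff.smoothNear (contDiff_id.prodMk contDiff_const) _
  have hs := ContDiffOn.smoothNear hsymm e.open_target htgt
  refine ⟨fun m => (e.symm (j m)).2, ?_, ?_, ?_⟩
  · exact (ContDiff.smoothNear contDiff_snd _).comp (SmoothNear.comp (g := e.symm) hs hj)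
  · filter_upwards [hj.continuousAt.eventually (e.open_target.mem_nhds htgt)] with m hm s
    have h1 := e.right_inv hm
    rw [hcoe] at h1
    have h2 : (e.symm (j m)).1 = m := congrArg Prod.fst h1
    have h3 : (e.symm (j m)).2 - cst (e.symm (j m)).1.2 -
      (e.symm (j m)).1.1 • V (e.symm (j m)).2 = 0 := congrArg Prod.snd h1
    rw [h2, sub_sub, sub_eq_zero] at h3
    have h4 := congrArg (fun w : C(unitInterval, E) => w s) h3
    simpa [cst, V, primitive_apply, IccExtend, ZC] using h4
  · filter_upwards [e.open_source.mem_nhds he] with q hq hsol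
    have h1 : e q = j q.1 := by
      rw [hcoe]
      refine Prod.ext rfl ?_
      change q.2 - cst q.1.2 - q.1.1 • V q.2 = 0
      rw [sub_sub, sub_eq_zero]
      ext s
      simpa [cst, V, primitive_apply, IccExtend, ZC] using hsol s
    rw [← h1, e.left_inv hq]

/-- A smooth vector field has a smooth local flow. The time `t` flow is the value at `1` of the
solution of the equation rescaled to `[0,1]`; by uniqueness of that solution, its value at
`l ∈ [0,1]` is the time `l t` flow. -/
theorem SmoothNear.exists_flow {Z : E → E} {x₀ : E} (hZ : SmoothNear Z x₀) :
    ∃ Φ : ℝ × E → E, SmoothNear Φ (0, x₀) ∧ ∀ᶠ m in 𝓝 ((0 : ℝ), x₀),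
      Φ (0, m.2) = m.2 ∧ HasDerivAt (fun t => Φ (t, m.2)) (Z (Φ m)) m.1 := by
  obtain ⟨Z', hZ', hZZ'⟩ := hZ.exists_contDiff
  obtain ⟨u, hu, hsol, huniq⟩ := exists_smooth_integral_solution hZ' x₀
  have hΦ : SmoothNear (fun m => u m 1) (0, x₀) :=
    (ContDiff.smoothNear (ContinuousMap.evalCLM ℝ (1 : unitInterval)).contDiff _).comp hu
  have hu0 : u (0, x₀) = ContinuousMap.const unitInterval x₀ := by
    ext s
    simpa using hsol.self_of_nhds s
  -- for `m` near `(0, x₀)` the value `u m l` is the solution at time `l * m.1`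
  have hscale : ∀ᶠ m in 𝓝 ((0 : ℝ), x₀), ∀ l : unitInterval, u (l * m.1, m.2) 1 = u m l := by
    obtain ⟨r, hr, hball⟩ := Metric.eventually_nhds_iff_ball.1 huniq
    have h1 : ∀ᶠ m in 𝓝 ((0 : ℝ), x₀), u m ∈ Metric.ball (ContinuousMap.const unitInterval x₀) r :=
      hu.continuousAt (by rw [hu0]; exact Metric.ball_mem_nhds _ hr)
    filter_upwards [h1, Metric.ball_mem_nhds _ hr, hsol] with m hm1 hm2 hm3 l
    let w : C(unitInterval, E) := ⟨fun s => u m (l * s), by fun_prop⟩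
    have hw : w = u (l * m.1, m.2) := by
      refine hball ((l * m.1, m.2), w) ?_ ?_
      · rw [Metric.mem_ball, Prod.dist_eq, Prod.dist_eq, max_lt_iff, max_lt_iff]
        rw [Metric.mem_ball, Prod.dist_eq, max_lt_iff] at hm2
        refine ⟨⟨?_, hm2.2⟩, ?_⟩
        · refine lt_of_le_of_lt ?_ hm2.1
          simp only [dist_zero_right, norm_mul, Real.norm_eq_abs]
          rw [abs_of_nonneg l.2.1]
          exact mul_le_of_le_one_left (abs_nonneg _) l.2.2
        · refine lt_of_le_of_lt ?_ hm1
          rw [ContinuousMap.dist_le dist_nonneg]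
          intro s
          exact ContinuousMap.dist_apply_le_dist (f := u m)
            (g := ContinuousMap.const unitInterval x₀) (l * s)
      · intro s
        change u m (l * s) = _
        rw [hm3 (l * s)]
        change _ = m.2 + ((l : ℝ) * m.1) • _
        rw [mul_comm (l : ℝ) m.1, mul_smul]
        congr 2
        have := intervalIntegral.smul_integral_comp_mul_left
          (f := fun σ => Z' (IccExtend zero_le_one (u m) σ)) (a := 0) (b := s) (l : ℝ)
        rw [mul_zero] at this
        rw [show ((l * s : unitInterval) : ℝ) = (l : ℝ) * s from rfl, ← this]
        congr 1
        refine intervalIntegral.integral_congr fun σ hσ => ?_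
        rw [uIcc_of_le s.2.1] at hσ
        have hσ' : σ ∈ Icc (0 : ℝ) 1 := ⟨hσ.1, hσ.2.trans s.2.2⟩
        have hσl : (l : ℝ) * σ ∈ Icc (0 : ℝ) 1 :=
          ⟨mul_nonneg l.2.1 hσ'.1, mul_le_one₀ l.2.2 hσ'.1 hσ'.2⟩
        change Z' (IccExtend zero_le_one (u m) (l * σ)) = Z' (IccExtend zero_le_one w σ)
        rw [IccExtend_of_mem _ _ hσ', IccExtend_of_mem _ _ hσl]
        rfl
    rw [← hw]
    change u m (l * 1) = _
    rw [mul_one]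
  have hne : ∀ᶠ m in 𝓝 ((0 : ℝ), x₀), m.1 ≠ 0 →
      HasDerivAt (fun t => u (t, m.2) 1) (Z' (u m 1)) m.1 := by
    have htwo : Tendsto (fun m : ℝ × E => (2 * m.1, m.2)) (𝓝 (0, x₀)) (𝓝 (0, x₀)) := by
      have : Continuous (fun m : ℝ × E => (2 * m.1, m.2)) := by fun_prop
      simpa using this.tendsto (0, x₀)
    filter_upwards [htwo.eventually hscale, htwo.eventually hsol] with m h1 h2 hm
    have hcont : Continuous fun σ => Z' (IccExtend zero_le_one (u (2 * m.1, m.2)) σ) :=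
      hZ'.continuous.comp (u (2 * m.1, m.2)).continuous.Icc_extend'
    have hder : HasDerivAt (fun l : ℝ => m.2 + (2 * m.1) • ∫ σ in (0 : ℝ)..l,
        Z' (IccExtend zero_le_one (u (2 * m.1, m.2)) σ))
        ((2 * m.1) • Z' (IccExtend zero_le_one (u (2 * m.1, m.2)) (m.1 / (2 * m.1))))
        (m.1 / (2 * m.1)) :=
      ((intervalIntegral.integral_hasDerivAt_right (hcont.intervalIntegrable _ _)
        (hcont.stronglyMeasurableAtFilter _ _) hcont.continuousAt).const_smul _).const_add _
    have hdiv : HasDerivAt (fun t : ℝ => t / (2 * m.1)) (1 / (2 * m.1)) m.1 :=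
      (hasDerivAt_id m.1).div_const _
    have hcomp := HasDerivAt.scomp (𝕜 := ℝ) m.1 hder hdiv
    have hhalf : m.1 / (2 * m.1) = 1 / 2 := by field_simp
    have hval : IccExtend zero_le_one (u (2 * m.1, m.2)) (m.1 / (2 * m.1)) = u m 1 := by
      have hmem : (1 / 2 : ℝ) ∈ Icc (0 : ℝ) 1 := by constructor <;> norm_num
      rw [hhalf, IccExtend_of_mem _ _ hmem, ← h1 ⟨1 / 2, hmem⟩]
      simp
    rw [hval, smul_smul, one_div_mul_cancel (by simpa using hm), one_smul] at hcomp
    refine hcomp.congr_of_eventuallyEq ?_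
    have hI : ∀ᶠ t in 𝓝 m.1, t / (2 * m.1) ∈ Icc (0 : ℝ) 1 := by
      have : ContinuousAt (fun t : ℝ => t / (2 * m.1)) m.1 := hdiv.continuousAt
      exact this.eventually (Icc_mem_nhds (by simp only [hhalf]; norm_num)
        (by simp only [hhalf]; norm_num))
    filter_upwards [hI] with t ht
    have h3 := h1 ⟨_, ht⟩
    have h4 := h2 ⟨_, ht⟩
    rw [h4] at h3
    simp only [Function.comp]
    rw [← h3, div_mul_cancel₀ _ (by simpa using hm)]
  refine ⟨fun m => u m 1, hΦ, ?_⟩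
  have hzero : ∀ᶠ m in 𝓝 ((0 : ℝ), x₀), u (0, m.2) 1 = m.2 := by
    have h0 : Tendsto (fun m : ℝ × E => ((0 : ℝ), m.2)) (𝓝 (0, x₀)) (𝓝 (0, x₀)) := by
      have : Continuous (fun m : ℝ × E => ((0 : ℝ), m.2)) := by fun_prop
      simpa using this.tendsto (0, x₀)
    filter_upwards [h0.eventually hsol] with m hm
    simpa using hm 1
  have hZΦ : ∀ᶠ m in 𝓝 ((0 : ℝ), x₀), Z' (u m 1) = Z (u m 1) := by
    have : Tendsto (fun m => u m 1) (𝓝 ((0 : ℝ), x₀)) (𝓝 x₀) := by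
      have := hΦ.continuousAt.tendsto
      rwa [hu0] at this
    exact this.eventually hZZ'
  filter_upwards [hzero, hZΦ, hΦ.eventually, hne.eventually_nhds] with m h0 hm hs hd
  refine ⟨h0, ?_⟩
  rw [← hm]
  by_cases hm1 : m.1 ≠ 0
  · exact hd.self_of_nhds hm1
  push Not at hm1
  -- at `t = 0` the equation holds by continuity of both sides
  have hline : Continuous fun t : ℝ => (t, m.2) := by fun_prop
  have hm' : m = (m.1, m.2) := rfl
  have hdΦ : ∀ᶠ t in 𝓝 m.1, HasDerivAt (fun t => u (t, m.2) 1)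
      (_root_.fderiv ℝ (fun m => u m 1) (t, m.2) (1, 0)) t := by
    have h2 := (hline.tendsto m.1).eventually hs
    filter_upwards [h2] with t ht
    have h3 := (ht.differentiableAt (by simp)).hasFDerivAt.comp_hasDerivAt t
      ((hasDerivAt_id t).prodMk (hasDerivAt_const t m.2))
    exact h3
  have hc1 : ContinuousAt (fun t => _root_.fderiv ℝ (fun m => u m 1) (t, m.2) (1, 0)) m.1 := by
    have h3 : ContinuousAt (_root_.fderiv ℝ (fun m => u m 1)) (m.1, m.2) :=
      SmoothNear.continuousAt (SmoothNear.fderiv hs)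
    exact ((h3.comp (f := fun t : ℝ => (t, m.2)) hline.continuousAt)).clm_apply
      continuousAt_const
  have hc2 : ContinuousAt (fun t => Z' (u (t, m.2) 1)) m.1 := by
    have h3 : ContinuousAt (fun m => u m 1) (m.1, m.2) := SmoothNear.continuousAt hs
    exact hZ'.continuous.continuousAt.comp
      (h3.comp (f := fun t : ℝ => (t, m.2)) hline.continuousAt)
  have heq : ∀ᶠ t in 𝓝[≠] m.1, _root_.fderiv ℝ (fun m => u m 1) (t, m.2) (1, 0) =
      Z' (u (t, m.2) 1) := by
    have h4 := (hline.tendsto m.1).eventually hd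
    filter_upwards [self_mem_nhdsWithin, nhdsWithin_le_nhds h4, nhdsWithin_le_nhds hdΦ]
      with t ht1 ht2 ht3
    exact ht3.unique (ht2 (by simpa [hm1] using ht1))
  have hlim : _root_.fderiv ℝ (fun m => u m 1) (m.1, m.2) (1, 0) = Z' (u (m.1, m.2) 1) :=
    tendsto_nhds_unique_of_eventuallyEq (hc1.mono_left nhdsWithin_le_nhds)
      (hc2.mono_left nhdsWithin_le_nhds) heq
  have := hdΦ.self_of_nhds
  rwa [hlim] at this

end Flow

/-! ### One-forms and adapted coordinates of an integrable one-form on `ℝ³` -/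

section OneForms

variable {E : Type*} [NormedAddCommGroup E] [NormedSpace ℝ E]

theorem fderiv_inner_fderiv {f g : E → V3} {t : E} (hf : ContDiffAt ℝ ∞ f t)
    (hg : ContDiffAt ℝ ∞ g t) (v w : E) :
    fderiv ℝ (fun s => inner ℝ (f s) (fderiv ℝ g s v)) t w =
      inner ℝ (fderiv ℝ f t w) (fderiv ℝ g t v) +
        inner ℝ (f t) (fderiv ℝ (fderiv ℝ g) t w v) := by
  have h1 : HasFDerivAt f (fderiv ℝ f t) t := (hf.differentiableAt (by simp)).hasFDerivAt
  have h2 : HasFDerivAt (fderiv ℝ g) (fderiv ℝ (fderiv ℝ g) t) t :=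
    ((hg.fderiv_right (m := ∞) (by simp)).differentiableAt (by simp)).hasFDerivAt
  have h3 : HasFDerivAt (fun s => fderiv ℝ g s v) _ t := h2.clm_apply (hasFDerivAt_const v t)
  rw [(h1.inner ℝ h3).fderiv]
  simp [fderivInnerCLM_apply, add_comm]

/-- The exterior derivative of the one-form `∑ f_i dg_i`. -/
theorem fderiv_inner_fderiv_sub {f g : E → V3} {t : E} (hf : ContDiffAt ℝ ∞ f t)
    (hg : ContDiffAt ℝ ∞ g t) (v w : E) :
    fderiv ℝ (fun s => inner ℝ (f s) (fderiv ℝ g s v)) t w -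
      fderiv ℝ (fun s => inner ℝ (f s) (fderiv ℝ g s w)) t v =
    inner ℝ (fderiv ℝ f t w) (fderiv ℝ g t v) - inner ℝ (fderiv ℝ f t v) (fderiv ℝ g t w) := by
  have hsymm : fderiv ℝ (fderiv ℝ g) t w v = fderiv ℝ (fderiv ℝ g) t v w :=
    (hg.isSymmSndFDerivAt (by simpa using (WithTop.coe_le_coe.2 le_top : ((2 : ℕ∞) : WithTop ℕ∞) ≤ ∞))) w v
  rw [fderiv_inner_fderiv hf hg, fderiv_inner_fderiv hf hg, hsymm]
  ring

/-- A function whose derivative in the direction `e` vanishes is constant along segments parallel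
to `e` which end at the zero of a linear form `l`. -/
theorem eventually_eq_of_fderiv_eq_zero {f : E → ℝ} (hf : SmoothNear f 0) {e : E} (l : E →L[ℝ] ℝ)
    (h : ∀ᶠ t in 𝓝 (0 : E), fderiv ℝ f t e = 0) :
    ∀ᶠ t in 𝓝 (0 : E), f t = f (t - l t • e) := by
  obtain ⟨r, hr, hball⟩ := Metric.eventually_nhds_iff_ball.1 (hf.and h)
  have hproj : ∀ᶠ t in 𝓝 (0 : E), t - l t • e ∈ Metric.ball (0 : E) r := by
    have : Continuous fun t : E => t - l t • e := by fun_prop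
    exact this.continuousAt.eventually (Metric.isOpen_ball.mem_nhds (by simpa using hr))
  filter_upwards [hproj, Metric.ball_mem_nhds (0 : E) hr] with t ht1 ht2
  have hseg : ∀ s ∈ Icc (0 : ℝ) 1, t - s • l t • e ∈ Metric.ball (0 : E) r := by
    intro s hs
    have := (convex_ball (0 : E) r) ht2 ht1 (a := 1 - s) (b := s) (by linarith [hs.2]) hs.1
      (by ring)
    convert this using 1
    module
  have hd : ∀ s ∈ Icc (0 : ℝ) 1, HasDerivAt (fun s : ℝ => f (t - s • l t • e)) 0 s := by
    intro s hs
    obtain ⟨h1, h2⟩ := hball _ (hseg s hs)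
    have h3 : HasDerivAt (fun s : ℝ => t - s • l t • e) (-(l t • e)) s := by
      simpa using ((hasDerivAt_id s).smul_const (l t • e)).const_sub t
    have h4 := (h1.differentiableAt (by simp)).hasFDerivAt.comp_hasDerivAt s h3
    rw [map_neg, map_smul, h2, smul_zero, neg_zero] at h4
    exact h4
  have := constant_of_has_deriv_right_zero
    (fun s hs => (hd s hs).continuousAt.continuousWithinAt)
    (fun s hs => (hd s (Ico_subset_Icc_self hs)).hasDerivWithinAt) 1 (by simp)
  simpa using this.symm

end OneForms

theorem hasDerivAt_line {E F : Type*} [NormedAddCommGroup E] [NormedSpace ℝ E]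
    [NormedAddCommGroup F] [NormedSpace ℝ F] {f : E → F} {t : E} (h : DifferentiableAt ℝ f t)
    (v : E) : HasDerivAt (fun s : ℝ => f (t + s • v)) (fderiv ℝ f t v) 0 := by
  have h5 : HasDerivAt (fun s : ℝ => t + s • v) v 0 := by
    simpa using ((hasDerivAt_id (0 : ℝ)).smul_const v).const_add t
  have h7 : HasFDerivAt f (fderiv ℝ f t) (t + (0 : ℝ) • v) := by simpa using h.hasFDerivAt
  exact h7.comp_hasDerivAt 0 h5

theorem basisVec_apply (i j : Fin 3) : basisVec i j = if j = i then (1 : ℝ) else 0 := by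
  simp [basisVec]

theorem inner_basisVec (v : V3) (i : Fin 3) : inner ℝ (basisVec i) v = v i := by
  simp [basisVec, EuclideanSpace.inner_single_left]

theorem inner_basisVec_right (v : V3) (i : Fin 3) : inner ℝ v (basisVec i) = v i := by
  simp [basisVec, EuclideanSpace.inner_single_right]

theorem eq_sum_basisVec (v : V3) : v = v 0 • basisVec 0 + v 1 • basisVec 1 + v 2 • basisVec 2 := by
  ext i
  fin_cases i <;> simp [basisVec_apply]

/-- Coordinates adapted to an integrable one-form `β` and to a nonvanishing vector field `Z` in its
kernel: `β` becomes a multiple of `du₃` and `Z` becomes `∂/∂u₁`. Along the flow of `Z` the form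
`β` is only rescaled, so that straightening `Z` leaves a form in the two variables `u₂, u₃`, up to
a factor; a second flow straightens the kernel of the latter. -/
theorem exists_adapted_coordinates {β Z : V3 → V3} (hβ : SmoothNear β 0) (hZ : SmoothNear Z 0)
    (hβ0 : β 0 = basisVec 2) (hZ0 : Z 0 ≠ 0) (hβZ : ∀ᶠ y in 𝓝 (0 : V3), inner ℝ (β y) (Z y) = 0)
    (hint : ∀ᶠ y in 𝓝 (0 : V3), ∀ p : V3, inner ℝ (β y) p = 0 → ∃ r : ℝ, ∀ u : V3,
      inner ℝ (fderiv ℝ β y u) p - inner ℝ (fderiv ℝ β y p) u = r * inner ℝ (β y) u) :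
    ∃ Ψ : OpenPartialHomeomorph V3 V3, 0 ∈ Ψ.source ∧ Ψ 0 = 0 ∧
      ContDiffOn ℝ ∞ Ψ Ψ.source ∧ ContDiffOn ℝ ∞ Ψ.symm Ψ.target ∧
      (∀ v, inner ℝ (β 0) (fderiv ℝ Ψ 0 v) = v 2) ∧
      ∀ᶠ u in 𝓝 (0 : V3), fderiv ℝ Ψ u (basisVec 0) = Z (Ψ u) ∧
        ∃ ρ : ℝ, ∀ v, inner ℝ (β (Ψ u)) (fderiv ℝ Ψ u v) = ρ * v 2 := by
  obtain ⟨Φ, hΦ, hflow⟩ := hZ.exists_flow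
  -- straighten `Z`: flow out of the plane spanned by `w` and `e₃`, where `w`, like `Z 0`, is in the
  -- kernel of `β 0 = e₃`
  set z := Z 0 with hz
  have hz2 : z 2 = 0 := by
    have := hβZ.self_of_nhds
    rwa [hβ0, inner_basisVec] at this
  set w : V3 := -z 1 • basisVec 0 + z 0 • basisVec 1 with hw
  let j₁ : V3 → ℝ × V3 := fun t => (t 0, t 1 • w + t 2 • basisVec 2)
  have hj₁ : ContDiff ℝ ∞ j₁ := by fun_prop
  have hj₁0 : j₁ 0 = (0, 0) := by simp [j₁]
  have hΦ' : SmoothNear Φ (j₁ 0) := by rw [hj₁0]; exact hΦ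
  have hΨ₁ : SmoothNear (fun t => Φ (j₁ t)) 0 := hΦ'.comp (ContDiff.smoothNear hj₁ _)
  set Ψ₁ : V3 → V3 := fun t => Φ (j₁ t) with hΨ₁def
  have hflow₁ : ∀ᶠ t in 𝓝 (0 : V3), Φ (0, (j₁ t).2) = (j₁ t).2 ∧
      fderiv ℝ Ψ₁ t (basisVec 0) = Z (Ψ₁ t) := by
    have h1 : Tendsto j₁ (𝓝 0) (𝓝 (0, 0)) := hj₁0 ▸ hj₁.continuous.tendsto 0
    filter_upwards [h1.eventually hflow, h1.eventually hΦ, hΨ₁] with t h2 h3 h4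
    refine ⟨h2.1, ?_⟩
    have h6 := hasDerivAt_line (h4.differentiableAt (by simp)) (basisVec 0)
    have h7 : HasDerivAt (fun s : ℝ => Φ (t 0 + s, (j₁ t).2)) (Z (Φ (j₁ t))) 0 := by
      exact HasDerivAt.comp_const_add (t 0) 0 (by simpa [j₁] using h2.2)
    refine h6.unique (h7.congr_of_eventuallyEq (Eventually.of_forall fun s => ?_))
    simp [Ψ₁, j₁, basisVec_apply]
  have hΨ₁0 : Ψ₁ 0 = 0 := by
    have := hflow₁.self_of_nhds.1
    simpa [Ψ₁, j₁] using this
  have hD₁ : ∀ v, fderiv ℝ Ψ₁ 0 v = v 0 • z + v 1 • w + v 2 • basisVec 2 := by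
    have h0 := hflow₁.self_of_nhds.2
    rw [hΨ₁0, ← hz] at h0
    have h1 : ∀ v : V3, v 0 = 0 → fderiv ℝ Ψ₁ 0 v = v 1 • w + v 2 • basisVec 2 := by
      intro v hv
      have h3 := hasDerivAt_line hΨ₁.differentiableAt v
      simp only [zero_add] at h3
      have h4 : HasDerivAt (fun s : ℝ => s • (v 1 • w + v 2 • basisVec 2))
          (v 1 • w + v 2 • basisVec 2) 0 := by
        simpa using (hasDerivAt_id (0 : ℝ)).smul_const (v 1 • w + v 2 • basisVec 2)
      refine h3.unique (h4.congr_of_eventuallyEq ?_)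
      have h5 : Tendsto (fun s : ℝ => s • v) (𝓝 0) (𝓝 0) := by
        have : Continuous fun s : ℝ => s • v := by fun_prop
        simpa using this.tendsto 0
      filter_upwards [h5.eventually hflow₁] with s hs
      have := hs.1
      simp only [j₁] at this
      simp only [Ψ₁, j₁]
      rw [show (s • v) 0 = 0 by simp [hv], this]
      simp [smul_smul]
    intro v
    have h2 : v = v 0 • basisVec 0 + (v - v 0 • basisVec 0) := by abel
    conv_lhs => rw [h2]
    rw [map_add, map_smul, h0, h1 _ (by simp [basisVec_apply])]
    simp [basisVec_apply, add_assoc]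
  -- the components `b j` of the pulled back form; by integrability `∂₀ b j = r b j`, so the ratio
  -- of the last two does not depend on the first variable
  let b : Fin 3 → V3 → ℝ := fun j t => inner ℝ (β (Ψ₁ t)) (fderiv ℝ Ψ₁ t (basisVec j))
  have hβ₁ : SmoothNear (fun t => β (Ψ₁ t)) 0 := SmoothNear.comp (by rwa [hΨ₁0]) hΨ₁
  have hb : ∀ j, SmoothNear (b j) 0 := by
    intro j
    filter_upwards [hβ₁, hΨ₁.fderiv] with t h1 h2
    exact h1.inner ℝ (h2.clm_apply contDiffAt_const)
  have hΨ₁t : Tendsto Ψ₁ (𝓝 0) (𝓝 0) := by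
    have := hΨ₁.continuousAt.tendsto
    rwa [hΨ₁0] at this
  have hb0 : ∀ᶠ t in 𝓝 (0 : V3), b 0 t = 0 := by
    filter_upwards [hflow₁, hΨ₁t.eventually hβZ] with t h1 h2
    simp only [b, h1.2, h2]
  have hbD : ∀ᶠ t in 𝓝 (0 : V3), ∃ r : ℝ, ∀ j, fderiv ℝ (b j) t (basisVec 0) = r * b j t := by
    filter_upwards [hb0.eventually_nhds, hΨ₁t.eventually hint, hflow₁, hβ₁, hΨ₁,
      hΨ₁t.eventually hβZ, hΨ₁t.eventually hβ] with t h1 h2 h3 h4 h5 h6 h7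
    obtain ⟨r, hr⟩ := h2 (Z (Ψ₁ t)) h6
    refine ⟨-r, fun j => ?_⟩
    have h8 := fderiv_inner_fderiv_sub h4 h5 (basisVec j) (basisVec 0)
    have h9 : fderiv ℝ (fun s => inner ℝ (β (Ψ₁ s)) (fderiv ℝ Ψ₁ s (basisVec 0))) t = 0 := by
      have : (b 0) =ᶠ[𝓝 t] fun _ => 0 := h1
      rw [show (fun s => inner ℝ (β (Ψ₁ s)) (fderiv ℝ Ψ₁ s (basisVec 0))) = b 0 from rfl,
        this.fderiv_eq]
      simp
    have h10 : ∀ v, fderiv ℝ (fun s => β (Ψ₁ s)) t v = fderiv ℝ β (Ψ₁ t) (fderiv ℝ Ψ₁ t v) := by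
      intro v
      have := ((h7.differentiableAt (by simp)).hasFDerivAt.comp t
        (h5.differentiableAt (by simp)).hasFDerivAt).fderiv
      change fderiv ℝ (β ∘ Ψ₁) t v = _
      rw [this]; rfl
    rw [h9, h10, h10, h3.2] at h8
    have h11 := hr (fderiv ℝ Ψ₁ t (basisVec j))
    change fderiv ℝ (b j) t (basisVec 0) - _ = _ at h8
    simp only [b, zero_apply, sub_zero] at h8 ⊢
    rw [h8]
    linarith
  have hb1at : b 1 0 = 0 := by
    simp [b, hD₁, hΨ₁0, hβ0, hw, basisVec_apply, inner_basisVec]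
  have hb2at : b 2 0 = 1 := by
    simp only [b, hD₁, hΨ₁0, hβ0, inner_basisVec]
    simp [basisVec_apply]
  let q : V3 → ℝ := fun t => b 1 t / b 2 t
  have hb2ne : ∀ᶠ t in 𝓝 (0 : V3), b 2 t ≠ 0 :=
    (hb 2).continuousAt.eventually_ne (by rw [hb2at]; exact one_ne_zero)
  have hq : SmoothNear q 0 := by
    filter_upwards [hb 1, hb 2, hb2ne] with t h1 h2 h3 using h1.div h2 h3
  have hqD : ∀ᶠ t in 𝓝 (0 : V3), fderiv ℝ q t (basisVec 0) = 0 := by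
    filter_upwards [hb 1, hb 2, hb2ne, hbD] with t h1 h2 h3 h4
    obtain ⟨r, hr⟩ := h4
    have hd1 := hasDerivAt_line (h1.differentiableAt (by simp)) (basisVec 0)
    have hd2 := hasDerivAt_line (h2.differentiableAt (by simp)) (basisVec 0)
    have h5 := hd1.fun_div hd2 (by simpa using h3)
    have h6 := hasDerivAt_line (f := q) ((h1.div h2 h3).differentiableAt (by simp)) (basisVec 0)
    rw [h6.unique h5, hr, hr, zero_smul, add_zero]
    ring
  have hqc := eventually_eq_of_fderiv_eq_zero hq (EuclideanSpace.proj 0) hqD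
  -- second flow box, in the plane of the last two variables
  let B : ℝ × ℝ → ℝ × ℝ := fun m => (1, -q (m.1 • basisVec 1 + m.2 • basisVec 2))
  have hB : SmoothNear B (0, 0) := by
    have h1 : SmoothNear (fun m : ℝ × ℝ => m.1 • basisVec 1 + m.2 • basisVec 2) (0, 0) :=
      ContDiff.smoothNear (by fun_prop) _
    have h2 : SmoothNear (fun m : ℝ × ℝ => q (m.1 • basisVec 1 + m.2 • basisVec 2)) (0, 0) :=
      SmoothNear.comp (by simpa using hq) h1
    filter_upwards [h2] with m hm using contDiffAt_const.prodMk hm.neg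
  obtain ⟨Φ₂, hΦ₂, hflow₂⟩ := hB.exists_flow
  let j₂ : V3 → ℝ × (ℝ × ℝ) := fun t => (t 1, (0, t 2))
  have hj₂ : ContDiff ℝ ∞ j₂ := by fun_prop
  have hj₂0 : j₂ 0 = (0, (0, 0)) := by simp [j₂]
  have hP : SmoothNear (fun t => Φ₂ (j₂ t)) 0 :=
    SmoothNear.comp (by rw [hj₂0]; exact hΦ₂) (ContDiff.smoothNear hj₂ _)
  let Ψ₂ : V3 → V3 := fun t =>
    t 0 • basisVec 0 + ((Φ₂ (j₂ t)).1 • basisVec 1 + (Φ₂ (j₂ t)).2 • basisVec 2)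
  have hΨ₂ : SmoothNear Ψ₂ 0 := by
    filter_upwards [hP] with t ht
    have h1 := ht.fst
    have h2 := ht.snd
    fun_prop
  have hΦ₂0 : Φ₂ (j₂ 0) = (0, 0) := by
    have := hflow₂.self_of_nhds.1
    rw [hj₂0]; exact this
  have hΨ₂0 : Ψ₂ 0 = 0 := by simp [Ψ₂, hΦ₂0]
  have hΨ₂t : Tendsto Ψ₂ (𝓝 0) (𝓝 0) := by
    have := hΨ₂.continuousAt.tendsto
    rwa [hΨ₂0] at this
  have hj₂t : Tendsto j₂ (𝓝 0) (𝓝 (0, (0, 0))) := hj₂0 ▸ hj₂.continuous.tendsto 0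
  have hΨ₂D : ∀ᶠ t in 𝓝 (0 : V3), fderiv ℝ Ψ₂ t (basisVec 0) = basisVec 0 ∧
      fderiv ℝ Ψ₂ t (basisVec 1) = basisVec 1 - q (Ψ₂ t) • basisVec 2 := by
    filter_upwards [hΨ₂, hj₂t.eventually hflow₂, hΨ₂t.eventually hqc] with t h1 h2 h3
    refine ⟨(hasDerivAt_line (h1.differentiableAt (by simp)) (basisVec 0)).unique ?_,
      (hasDerivAt_line (h1.differentiableAt (by simp)) (basisVec 1)).unique ?_⟩
    · have : HasDerivAt (fun s : ℝ => Ψ₂ t + s • basisVec 0) (basisVec 0) 0 := by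
        simpa using ((hasDerivAt_id (0 : ℝ)).smul_const (basisVec 0)).const_add (Ψ₂ t)
      refine this.congr_of_eventuallyEq (Eventually.of_forall fun s => ?_)
      simp only [Ψ₂, j₂]
      simp [basisVec_apply]
      module
    · have h4 : HasDerivAt (fun s : ℝ => Φ₂ (t 1 + s, (0, t 2))) (B (Φ₂ (j₂ t))) 0 := by
        exact HasDerivAt.comp_const_add (t 1) 0 (by simpa [j₂] using h2.2)
      have h41 : HasDerivAt (fun s : ℝ => (Φ₂ (t 1 + s, (0, t 2))).1) (B (Φ₂ (j₂ t))).1 0 :=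
        (ContinuousLinearMap.fst ℝ ℝ ℝ).hasFDerivAt.comp_hasDerivAt 0 h4
      have h42 : HasDerivAt (fun s : ℝ => (Φ₂ (t 1 + s, (0, t 2))).2) (B (Φ₂ (j₂ t))).2 0 :=
        (ContinuousLinearMap.snd ℝ ℝ ℝ).hasFDerivAt.comp_hasDerivAt 0 h4
      have h6 := (((hasDerivAt_const (0 : ℝ) (t 0 • basisVec 0)).add
        ((h41.smul_const (basisVec 1)).add (h42.smul_const (basisVec 2)))))
      have h7 : q (Ψ₂ t) = q ((Φ₂ (j₂ t)).1 • basisVec 1 + (Φ₂ (j₂ t)).2 • basisVec 2) := by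
        rw [h3]
        congr 1
        simp [Ψ₂, basisVec_apply]
      convert! h6 using 1
      · funext s
        simp [Ψ₂, j₂, basisVec_apply]
      · simp [B, h7, sub_eq_add_neg]
  have hΨ₂D0 : ∀ v, fderiv ℝ Ψ₂ 0 v = v := by
    have hq0 : q 0 = 0 := by simp [q, hb1at]
    have h0 := hΨ₂D.self_of_nhds
    rw [hΨ₂0, hq0, zero_smul, sub_zero] at h0
    have h2 : fderiv ℝ Ψ₂ 0 (basisVec 2) = basisVec 2 := by
      refine (hasDerivAt_line hΨ₂.differentiableAt (basisVec 2)).unique ?_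
      have : HasDerivAt (fun s : ℝ => s • basisVec 2) (basisVec 2) 0 := by
        simpa using ((hasDerivAt_id (0 : ℝ)).smul_const (basisVec 2))
      refine this.congr_of_eventuallyEq ?_
      have hl : Tendsto (fun s : ℝ => ((0 : ℝ), ((0 : ℝ), s))) (𝓝 0) (𝓝 (0, (0, 0))) := by
        have : Continuous fun s : ℝ => ((0 : ℝ), ((0 : ℝ), s)) := by fun_prop
        simpa using this.tendsto 0
      filter_upwards [hl.eventually hflow₂] with s hs
      have := hs.1
      simp [Ψ₂, j₂, basisVec_apply, this]
    intro v
    conv_lhs => rw [eq_sum_basisVec v]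
    rw [map_add, map_add, map_smul, map_smul, map_smul, h0.1, h0.2, h2, ← eq_sum_basisVec]
  have hΨ₁' : SmoothNear Ψ₁ (Ψ₂ 0) := by rwa [hΨ₂0]
  have hΨ : SmoothNear (fun t => Ψ₁ (Ψ₂ t)) 0 := hΨ₁'.comp hΨ₂
  have hchain : ∀ᶠ t in 𝓝 (0 : V3), ∀ v,
      fderiv ℝ (fun t => Ψ₁ (Ψ₂ t)) t v = fderiv ℝ Ψ₁ (Ψ₂ t) (fderiv ℝ Ψ₂ t v) := by
    filter_upwards [hΨ₂, hΨ₂t.eventually hΨ₁] with t h1 h2 v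
    have := ((h2.differentiableAt (by simp)).hasFDerivAt.comp t
      (h1.differentiableAt (by simp)).hasFDerivAt).fderiv
    change fderiv ℝ (Ψ₁ ∘ Ψ₂) t v = _
    rw [this]; rfl
  have hΨD0 : ∀ v, fderiv ℝ (fun t => Ψ₁ (Ψ₂ t)) 0 v = v 0 • z + v 1 • w + v 2 • basisVec 2 := by
    intro v
    rw [hchain.self_of_nhds, hΨ₂0, hΨ₂D0, hD₁]
  obtain ⟨e, he0, hcoe, hsm, hsm'⟩ :=
    hΨ.exists_openPartialHomeomorph_of_injective rfl (fun v hv => by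
      rw [hΨD0] at hv
      have e0 := congrArg (fun u : V3 => u 0) hv
      have e1 := congrArg (fun u : V3 => u 1) hv
      have e2 := congrArg (fun u : V3 => u 2) hv
      simp [hw, basisVec_apply, hz2] at e0 e1 e2
      have hzz : z 0 * z 0 + z 1 * z 1 ≠ 0 := by
        intro h
        apply hZ0
        have a0 : z 0 = 0 := by nlinarith
        have a1 : z 1 = 0 := by nlinarith
        ext i
        fin_cases i <;> simp [a0, a1, hz2]
      have v0 : v 0 = 0 := by
        apply (mul_eq_zero.1 (?_ : v 0 * (z 0 * z 0 + z 1 * z 1) = 0)).resolve_right hzz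
        linear_combination z 0 * e0 + z 1 * e1
      have v1 : v 1 = 0 := by
        apply (mul_eq_zero.1 (?_ : v 1 * (z 0 * z 0 + z 1 * z 1) = 0)).resolve_right hzz
        linear_combination z 0 * e1 - z 1 * e0
      ext i
      fin_cases i <;> simp [v0, v1, e2])
  have hfun : (e : V3 → V3) = fun t => Ψ₁ (Ψ₂ t) := funext hcoe
  refine ⟨e, he0, by rw [hcoe, hΨ₂0, hΨ₁0], hsm, hsm', fun v => ?_, ?_⟩
  · rw [hfun, hΨD0, hβ0, inner_basisVec]
    simp [hw, basisVec_apply, hz2]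
  · filter_upwards [hchain, hΨ₂D, hΨ₂t.eventually hflow₁, hΨ₂t.eventually hb0,
      hΨ₂t.eventually hb2ne] with t h1 h2 h3 h4 h5
    rw [hfun]
    refine ⟨by rw [h1, h2.1, h3.2], inner ℝ (β (Ψ₁ (Ψ₂ t)))
      (fderiv ℝ Ψ₁ (Ψ₂ t) (fderiv ℝ Ψ₂ t (basisVec 2))), fun v => ?_⟩
    have k0 : inner ℝ (β (Ψ₁ (Ψ₂ t))) (fderiv ℝ Ψ₁ (Ψ₂ t) (fderiv ℝ Ψ₂ t (basisVec 0))) = 0 := by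
      rw [h2.1]; exact h4
    have k1 : inner ℝ (β (Ψ₁ (Ψ₂ t))) (fderiv ℝ Ψ₁ (Ψ₂ t) (fderiv ℝ Ψ₂ t (basisVec 1))) = 0 := by
      rw [h2.2, map_sub, map_smul, inner_sub_right, inner_smul_right]
      change b 1 (Ψ₂ t) - b 1 (Ψ₂ t) / b 2 (Ψ₂ t) * b 2 (Ψ₂ t) = 0
      rw [div_mul_cancel₀ _ h5, sub_self]
    rw [h1]
    conv_lhs => rw [eq_sum_basisVec v]
    simp only [map_add, map_smul, inner_add_right, inner_smul_right, k0, k1]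
    ring

/-! ### Invariance of cusps under changes of coordinates -/

section Invariance

variable {E : Type*} [NormedAddCommGroup E] [NormedSpace ℝ E]

theorem jac_comp {f g : E → E} {p : E} (hf : DifferentiableAt ℝ f p)
    (hg : DifferentiableAt ℝ g (f p)) : jac (g ∘ f) p = jac g (f p) * jac f p := by
  rw [jac, fderiv_comp p hg hf]
  exact LinearMap.det_comp _ _

theorem jac_congr {f g : E → E} {p : E} (h : f =ᶠ[𝓝 p] g) : jac f p = jac g p := by
  rw [jac, jac, h.fderiv_eq]

theorem IsCusp.congr {f g : E → E} {p : E} (h : IsCusp f p) (hg : g =ᶠ[𝓝 p] f) : IsCusp g p := by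
  have hj : jac g =ᶠ[𝓝 p] jac f := by
    filter_upwards [hg.eventually_nhds] with q hq using jac_congr hq
  have hjd : fderiv ℝ (jac g) p = fderiv ℝ (jac f) p := hj.fderiv_eq
  obtain ⟨⟨h1, h2⟩, h3, N, v, hN, hp, hv, hvp, hker, hd⟩ := h
  have hall := (hg.eventually_nhds.and hj.eventually_nhds)
  obtain ⟨s, hs, hso, hps⟩ := eventually_nhds_iff.1 hall
  refine ⟨⟨by rw [hg.fderiv_eq]; exact h1, by rw [hjd]; exact h2⟩, fun w hw => ?_,
    N ∩ s, v, hN.inter hso, ⟨hp, hps⟩, hv.mono inter_subset_left, hvp, fun q hq hq0 => ?_, ?_⟩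
  · rw [hjd]
    exact h3 w (by rwa [hg.fderiv_eq] at hw)
  · obtain ⟨h5, h6⟩ := hs q hq.2
    have h5' : g =ᶠ[𝓝 q] f := h5
    have h6' : jac g =ᶠ[𝓝 q] jac f := h6
    rw [h5'.fderiv_eq]
    exact hker q hq.1 (by rw [← h6'.eq_of_nhds]; exact hq0)
  · have : (fun q => fderiv ℝ (jac g) q (v q)) =ᶠ[𝓝 p] fun q => fderiv ℝ (jac f) q (v q) := by
      filter_upwards [hj.eventually_nhds] with q hq
      have hq' : jac g =ᶠ[𝓝 q] jac f := hq
      rw [hq'.fderiv_eq]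
    rw [this.fderiv_eq]
    exact hd

/-- The Jacobian of `g ∘ f ∘ ψ` is that of `f`, pulled back by `ψ`, times a nonvanishing smooth
factor when `g` and `ψ` are local diffeomorphisms. -/
theorem jac_comp_comp {f g ψ : E → E} {p : E} (hψ : SmoothNear ψ p) (hf : SmoothNear f (ψ p))
    (hg : SmoothNear g (f (ψ p))) :
    jac (g ∘ f ∘ ψ) =ᶠ[𝓝 p] fun q => jac g (f (ψ q)) * jac ψ q * jac f (ψ q) := by
  filter_upwards [hψ, hψ.continuousAt.eventually hf, (hf.comp hψ).continuousAt.eventually hg]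
    with q h1 h2 h3
  have d1 := h1.differentiableAt (by simp)
  have d2 := h2.differentiableAt (by simp)
  have d3 := h3.differentiableAt (by simp)
  rw [jac_comp (d2.comp q d1) d3, jac_comp d1 d2]
  simp only [Function.comp]
  ring

variable [FiniteDimensional ℝ E]

theorem contDiff_det : ContDiff ℝ ∞ (fun A : E →L[ℝ] E => A.det) := by
  let b := Module.finBasis ℝ E
  have h : (fun A : E →L[ℝ] E => A.det) = fun A =>
      Matrix.det (Matrix.of fun i j => b.equivFunL (A (b j)) i) := by
    funext A
    rw [ContinuousLinearMap.det, ← LinearMap.det_toMatrix b]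
    congr 1
    ext i j
    simp [LinearMap.toMatrix_apply]
  rw [h]
  simp only [Matrix.det_apply]
  refine ContDiff.sum fun σ _ => ?_
  refine ContDiff.const_smul _ (contDiff_prod fun i _ => ?_)
  simp only [Matrix.of_apply]
  have h1 : ContDiff ℝ ∞ fun A : E →L[ℝ] E => b.equivFunL (A (b i)) :=
    b.equivFunL.contDiff.comp (contDiff_id.clm_apply contDiff_const)
  exact (contDiff_apply ℝ ℝ (σ i)).comp h1

theorem SmoothNear.jac {f : E → E} {p : E} (h : SmoothNear f p) : SmoothNear (jac f) p := by
  filter_upwards [h.fderiv] with q hq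
  exact contDiff_det.contDiffAt.comp q hq

theorem det_ne_zero_iff_injective (A : E →L[ℝ] E) : A.det ≠ 0 ↔ ∀ v, A v = 0 → v = 0 := by
  constructor
  · intro h v hv
    refine (A.toContinuousLinearEquivOfDetNeZero h).map_eq_zero_iff.1 ?_
    rw [A.toContinuousLinearEquivOfDetNeZero_apply h v, hv]
  · intro h h0
    obtain ⟨v, hv, hv0⟩ := LinearMap.bot_lt_ker_of_det_eq_zero h0 |>.ne' |>
      (Submodule.ne_bot_iff _).1
    exact hv0 (h v hv)

theorem jac_eq_zero_of_rank {f : E → E} {p : E} (h : DropsRankSimply f p) : jac f p = 0 := by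
  by_contra h0
  have hi := (det_ne_zero_iff_injective _).1 h0
  have := LinearMap.finrank_range_of_inj (f := (fderiv ℝ f p).toLinearMap)
    ((injective_iff_map_eq_zero _).2 hi)
  have h1 := h.1
  omega

/-- Cusps are invariant under changes of coordinates in the source and the target: if `v` is a
kernel field of `f`, then the pull back of `v` by `ψ` is one of `g ∘ f ∘ ψ`. -/
theorem isCusp_comp_comp {f g ψ : E → E} {p : E} (hψ : SmoothNear ψ p) (hf : SmoothNear f (ψ p))
    (hg : SmoothNear g (f (ψ p))) (hψ0 : jac ψ p ≠ 0) (hg0 : jac g (f (ψ p)) ≠ 0)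
    (h : IsCusp f (ψ p)) : IsCusp (g ∘ f ∘ ψ) p := by
  have : CompleteSpace E := FiniteDimensional.complete ℝ E
  obtain ⟨hrank, hker, N, v, hN, hpN, hv, hvp, hvker, hvd⟩ := h
  have hJ0 := jac_eq_zero_of_rank hrank
  set F := g ∘ f ∘ ψ with hF
  set a : E → ℝ := fun q => jac g (f (ψ q)) * jac ψ q with ha
  have hJ : jac F =ᶠ[𝓝 p] fun q => a q * jac f (ψ q) := jac_comp_comp hψ hf hg
  have haS : SmoothNear a p := by
    have h1 : SmoothNear (fun q => jac g (f (ψ q))) p := SmoothNear.comp hg.jac (hf.comp hψ)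
    filter_upwards [h1, hψ.jac] with q h2 h3 using h2.mul h3
  have ha0 : a p ≠ 0 := mul_ne_zero hg0 hψ0
  have hjS : SmoothNear (fun q => jac f (ψ q)) p := SmoothNear.comp hf.jac hψ
  -- first derivatives
  have hFD : ∀ᶠ q in 𝓝 p, ∀ w, fderiv ℝ F q w =
      fderiv ℝ g (f (ψ q)) (fderiv ℝ f (ψ q) (fderiv ℝ ψ q w)) := by
    filter_upwards [hψ, hψ.continuousAt.eventually hf, (hf.comp hψ).continuousAt.eventually hg]
      with q h1 h2 h3 w
    have d1 := (h1.differentiableAt (by simp)).hasFDerivAt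
    have d2 := (h2.differentiableAt (by simp)).hasFDerivAt
    have d3 := (h3.differentiableAt (by simp)).hasFDerivAt
    rw [(d3.comp q (d2.comp q d1)).fderiv]
    rfl
  have hJD : ∀ᶠ q in 𝓝 p, ∀ w, fderiv ℝ (jac F) q w =
      jac f (ψ q) * fderiv ℝ a q w + a q * fderiv ℝ (jac f) (ψ q) (fderiv ℝ ψ q w) := by
    filter_upwards [hψ, hψ.continuousAt.eventually hf.jac, haS, hJ.eventually_nhds]
      with q h1 h2 h3 h4 w
    have d1 := (h1.differentiableAt (by simp)).hasFDerivAt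
    have d2 := (h2.differentiableAt (by simp)).hasFDerivAt
    have d3 := (h3.differentiableAt (by simp)).hasFDerivAt
    have h4' : jac F =ᶠ[𝓝 q] fun q => a q * jac f (ψ q) := h4
    rw [h4'.fderiv_eq]
    have := (d3.mul (d2.comp q d1)).fderiv
    change fderiv ℝ (fun q => a q * jac f (ψ q)) q = _ at this
    rw [this]
    simp [add_comm]
  set Aψ := (fderiv ℝ ψ p).toContinuousLinearEquivOfDetNeZero hψ0 with hAψ
  set Ag := (fderiv ℝ g (f (ψ p))).toContinuousLinearEquivOfDetNeZero hg0 with hAg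
  have hAψ' : ∀ w, fderiv ℝ ψ p w = Aψ w := fun w =>
    (ContinuousLinearMap.toContinuousLinearEquivOfDetNeZero_apply _ _ _).symm
  have hAg' : ∀ w, fderiv ℝ g (f (ψ p)) w = Ag w := fun w =>
    (ContinuousLinearMap.toContinuousLinearEquivOfDetNeZero_apply _ _ _).symm
  have hrankF : DropsRankSimply F p := by
    constructor
    · rw [← hrank.1]
      congr 1
      have : (fderiv ℝ F p).toLinearMap =
          Ag.toLinearEquiv.toLinearMap ∘ₗ (fderiv ℝ f (ψ p)).toLinearMap ∘ₗ
            Aψ.toLinearEquiv.toLinearMap := by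
        ext w
        simp [hFD.self_of_nhds w, hAψ', hAg']
      rw [this, LinearMap.range_comp, LinearMap.range_comp_of_range_eq_top _ (LinearEquiv.range _)]
      exact LinearEquiv.finrank_map_eq Ag.toLinearEquiv _
    · intro h0
      apply hrank.2
      ext w
      have h1 := hJD.self_of_nhds (Aψ.symm w)
      rw [h0, hJ0, hAψ'] at h1
      simpa [ha0] using h1
  refine ⟨hrankF, fun w hw => ?_, ?_⟩
  · rw [hFD.self_of_nhds, hAg', Ag.map_eq_zero_iff] at hw
    rw [hJD.self_of_nhds, hJ0, hker _ hw]
    simp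
  -- the pulled back kernel field
  let vF : E → E := fun q => (fderiv ℝ ψ q).inverse (v (ψ q))
  have hinv : ∀ᶠ q in 𝓝 p, (fderiv ℝ ψ q).IsInvertible := by
    filter_upwards [hψ.jac.continuousAt.eventually_ne hψ0] with q hq
    exact ⟨(fderiv ℝ ψ q).toContinuousLinearEquivOfDetNeZero hq,
      ContinuousLinearMap.coe_toContinuousLinearEquivOfDetNeZero _ _⟩
  have hvS : SmoothNear v (ψ p) := ContDiffOn.smoothNear hv hN hpN
  have hvFS : SmoothNear vF p := by
    filter_upwards [hinv, hψ.fderiv, SmoothNear.comp hvS hψ] with q h1 h2 h3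
    obtain ⟨A, hA⟩ := h1
    have h4 : ContDiffAt ℝ ∞ ContinuousLinearMap.inverse (fderiv ℝ ψ q) :=
      hA ▸ contDiffAt_map_inverse A
    exact (h4.comp q h2).clm_apply h3
  have hψv : ∀ᶠ q in 𝓝 p, fderiv ℝ ψ q (vF q) = v (ψ q) := by
    filter_upwards [hinv] with q hq
    obtain ⟨A, hA⟩ := hq
    simp [vF, ← hA]
  obtain ⟨s, hs, hso, hps⟩ := eventually_nhds_iff.1
    (hvFS.and (hψv.and (hFD.and (hJ.and ((haS.continuousAt.eventually_ne ha0).and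
      (hψ.continuousAt.eventually (hN.mem_nhds hpN)))))))
  refine ⟨s, vF, hso, hps, fun q hq => (hs q hq).1.contDiffWithinAt, ?_, ?_, ?_⟩
  · intro h0
    have := hψv.self_of_nhds
    rw [h0, map_zero] at this
    exact hvp this.symm
  · intro q hq hq0
    obtain ⟨-, h2, h3, h4, h5, h6⟩ := hs q hq
    rw [h4] at hq0
    rw [h3, h2, hvker _ h6 ((mul_eq_zero.1 hq0).resolve_left h5), map_zero]
  · have hvψ : fderiv ℝ (jac f) (ψ p) (v (ψ p)) = 0 := hker _ (hvker _ hpN hJ0)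
    have hrew : (fun q => fderiv ℝ (jac F) q (vF q)) =ᶠ[𝓝 p] fun q =>
        jac f (ψ q) * fderiv ℝ a q (vF q) + a q * fderiv ℝ (jac f) (ψ q) (v (ψ q)) := by
      filter_upwards [hJD, hψv] with q h1 h2
      rw [h1, h2]
    have d1 := hjS.differentiableAt.hasFDerivAt
    have d2 : HasFDerivAt (fun q => fderiv ℝ a q (vF q)) _ p :=
      haS.fderiv.differentiableAt.hasFDerivAt.clm_apply hvFS.differentiableAt.hasFDerivAt
    have d3 : HasFDerivAt (fun q => fderiv ℝ (jac f) q (v q)) _ (ψ p) :=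
      (hf.jac.fderiv.differentiableAt.clm_apply hvS.differentiableAt).hasFDerivAt
    have d4 := d3.comp p hψ.differentiableAt.hasFDerivAt
    have d5 := (d1.mul d2).add (haS.differentiableAt.hasFDerivAt.mul d4)
    have d6 : HasFDerivAt (fun q => jac f (ψ q)) _ p :=
      hf.jac.differentiableAt.hasFDerivAt.comp p hψ.differentiableAt.hasFDerivAt
    have hd1 : fderiv ℝ (fun q => jac f (ψ q)) p (vF p) = 0 := by
      rw [d6.fderiv]
      simp [hψv.self_of_nhds, hvψ]
    rw [hrew.fderiv_eq]
    have := d5.fderiv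
    rw [show ((fun q => jac f (ψ q)) * (fun q => fderiv ℝ a q (vF q)) +
      a * ((fun q => fderiv ℝ (jac f) q (v q)) ∘ ψ)) = fun q =>
        jac f (ψ q) * fderiv ℝ a q (vF q) + a q * fderiv ℝ (jac f) (ψ q) (v (ψ q)) from rfl]
      at this
    rw [this]
    simp [hd1, hJ0, hψv.self_of_nhds, hvψ, ha0, hvd]

theorem isCusp_comp_left {f g : E → E} {p : E} (hf : SmoothNear f p) (hg : SmoothNear g (f p))
    (hg0 : jac g (f p) ≠ 0) (h : IsCusp f p) : IsCusp (g ∘ f) p :=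
  isCusp_comp_comp (ψ := id) (ContDiff.smoothNear contDiff_id p) hf hg
    (by simp [jac, ContinuousLinearMap.det]) hg0 h

theorem isCusp_comp_right {f ψ : E → E} {p : E} (hψ : SmoothNear ψ p) (hf : SmoothNear f (ψ p))
    (hψ0 : jac ψ p ≠ 0) (h : IsCusp f (ψ p)) : IsCusp (f ∘ ψ) p :=
  isCusp_comp_comp (g := id) hψ hf (ContDiff.smoothNear contDiff_id _) hψ0
    (by simp [jac, ContinuousLinearMap.det]) h

end Invariance

/-! ### Parametrizations of a relation and its singular sets -/

section Params

variable {C : Set (Phase × Phase)} {c : Phase × Phase} {γ γ' : Phase → Phase × Phase}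
  {O O' : Set Phase} {π : Phase × Phase → Phase}

theorem IsLocalParam.mem (h : IsLocalParam C c γ O) {q : Phase} (hq : q ∈ O) : γ q ∈ C := by
  obtain ⟨U, κ, -, hU, -⟩ := h.embedding
  exact (hU ▸ mem_image_of_mem γ hq : γ q ∈ C ∩ U).1

theorem IsLocalParam.base_mem (h : IsLocalParam C c γ O) : c ∈ C := h.map_zero ▸ h.mem h.zero_mem

theorem IsLocalParam.smoothNear (h : IsLocalParam C c γ O) {q : Phase} (hq : q ∈ O) :
    SmoothNear γ q := ContDiffOn.smoothNear h.smooth h.isOpen hq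

theorem IsLocalParam.translate (h : IsLocalParam C c γ O) {q₀ : Phase} (hq : q₀ ∈ O) :
    IsLocalParam C (γ q₀) (fun q => γ (q + q₀)) ((fun q => q + q₀) ⁻¹' O) := by
  obtain ⟨U, κ, hUo, hU, hκ, hκγ⟩ := h.embedding
  refine ⟨h.isOpen.preimage (by fun_prop), by simpa using hq, by simp, ?_,
    U, fun d => κ d - q₀, hUo, ?_, hκ.sub contDiffOn_const, fun q hq => ?_⟩
  · exact h.smooth.comp (by fun_prop) (fun q hq => hq)
  · rw [← hU]
    ext d
    constructor
    · rintro ⟨q, hq, rfl⟩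
      exact ⟨_, hq, rfl⟩
    · rintro ⟨q, hq, rfl⟩
      exact ⟨q - q₀, by simpa using hq, by simp⟩
  · simp [hκγ _ hq]

/-- The inverse of a parametrization, extended to a neighbourhood in the ambient space, takes points of
`C` to the parameter domain. -/
theorem IsLocalParam.exists_lift (h : IsLocalParam C c γ O) :
    ∃ (U : Set (Phase × Phase)) (κ : Phase × Phase → Phase), IsOpen U ∧ ContDiffOn ℝ ∞ κ U ∧
      (∀ q ∈ O, κ (γ q) = q ∧ γ q ∈ U) ∧ ∀ d ∈ C ∩ U, κ d ∈ O ∧ γ (κ d) = d := by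
  obtain ⟨U, κ, hUo, hU, hκ, hκγ⟩ := h.embedding
  refine ⟨U, κ, hUo, hκ, fun q hq => ⟨hκγ q hq, ?_⟩, fun d hd => ?_⟩
  · exact (hU ▸ mem_image_of_mem γ hq : γ q ∈ C ∩ U).2
  · rw [← hU] at hd
    obtain ⟨q, hq, rfl⟩ := hd
    rw [hκγ q hq]
    exact ⟨hq, rfl⟩

theorem IsLocalParam.injective_fderiv (h : IsLocalParam C c γ O) {q : Phase} (hq : q ∈ O)
    {v : Phase} (hv : fderiv ℝ γ q v = 0) : v = 0 := by
  obtain ⟨U, κ, hUo, hκ, hκγ, -⟩ := h.exists_lift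
  have h1 : (fun q => κ (γ q)) =ᶠ[𝓝 q] id := by
    filter_upwards [h.isOpen.mem_nhds hq] with q' hq' using (hκγ q' hq').1
  have h2 := ((hκ.contDiffAt (hUo.mem_nhds (hκγ q hq).2)).differentiableAt (by simp)).hasFDerivAt
  have h3 := (h2.comp q (h.smoothNear hq).differentiableAt.hasFDerivAt).fderiv
  have h4 := h1.fderiv_eq (𝕜 := ℝ)
  rw [fderiv_id] at h4
  change fderiv ℝ (κ ∘ γ) q = _ at h4
  rw [h3] at h4
  have h5 := congrArg (fun A : Phase →L[ℝ] Phase => A v) h4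
  simpa [hv] using h5.symm

/-- Two parametrizations at the same point differ by a change of parameters. -/
theorem IsLocalParam.exists_reparam (h : IsLocalParam C c γ O) (h' : IsLocalParam C c γ' O') :
    ∃ ψ : Phase → Phase, SmoothNear ψ 0 ∧ ψ 0 = 0 ∧ jac ψ 0 ≠ 0 ∧ γ' =ᶠ[𝓝 0] γ ∘ ψ := by
  obtain ⟨U, κ, hUo, hκ, hκγ, hγκ⟩ := h.exists_lift
  have hc : γ' 0 ∈ U := by
    rw [h'.map_zero, ← h.map_zero]
    exact (hκγ 0 h.zero_mem).2
  have hS : SmoothNear (fun q => κ (γ' q)) 0 :=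
    SmoothNear.comp (ContDiffOn.smoothNear hκ hUo hc) (h'.smoothNear h'.zero_mem)
  have heq : γ' =ᶠ[𝓝 0] γ ∘ fun q => κ (γ' q) := by
    filter_upwards [h'.isOpen.mem_nhds h'.zero_mem,
      (h'.smoothNear h'.zero_mem).continuousAt.eventually (hUo.mem_nhds hc)] with q hq hqU
    exact (hγκ _ ⟨h'.mem hq, hqU⟩).2.symm
  have h0 : κ (γ' 0) = 0 := by
    rw [h'.map_zero, ← h.map_zero]
    exact (hκγ 0 h.zero_mem).1
  refine ⟨fun q => κ (γ' q), hS, h0, (det_ne_zero_iff_injective _).2 fun v hv => ?_, heq⟩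
  refine h'.injective_fderiv h'.zero_mem ?_
  rw [heq.fderiv_eq]
  have h2 : HasFDerivAt γ (fderiv ℝ γ (κ (γ' 0))) (κ (γ' 0)) :=
    (h.smoothNear (by rw [h0]; exact h.zero_mem)).differentiableAt.hasFDerivAt
  rw [(h2.comp (0 : Phase) hS.differentiableAt.hasFDerivAt).fderiv]
  simp [hv]

/-- Whether `π|_C` has a cusp can be tested in any parametrization. -/
theorem mem_cuspSet_iff (hπ : ContDiff ℝ ∞ π) (h : IsLocalParam C c γ O) {q : Phase}
    (hq : q ∈ O) : γ q ∈ cuspSet π C ↔ IsCusp (π ∘ γ) q := by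
  have ht := h.translate hq
  have hS : SmoothNear (π ∘ γ) q := (ContDiff.smoothNear hπ _).comp (h.smoothNear hq)
  have htr : ∀ a p : Phase, jac (fun q : Phase => q + a) p ≠ 0 := fun a p =>
    (det_ne_zero_iff_injective _).2 fun v hv => by simpa using hv
  constructor
  · rintro ⟨γ', O', hγ', hcusp⟩
    obtain ⟨ψ, hψ, hψ0, hjψ, heq⟩ := hγ'.exists_reparam ht
    have hS' : SmoothNear (π ∘ γ') 0 :=
      (ContDiff.smoothNear hπ _).comp (hγ'.smoothNear hγ'.zero_mem)
    have h1 : IsCusp ((π ∘ γ') ∘ ψ) 0 :=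
      isCusp_comp_right hψ (by rwa [hψ0]) hjψ (by rwa [hψ0])
    have h2 : IsCusp (fun r => π (γ (r + q))) 0 :=
      h1.congr (by filter_upwards [heq] with r hr; simp only [hr, Function.comp])
    have h3 := isCusp_comp_right (f := fun r => π (γ (r + q))) (ψ := fun r => r + (-q)) (p := q)
      (ContDiff.smoothNear (by fun_prop) _)
      (SmoothNear.comp (g := π ∘ γ) (by simpa using hS)
        (ContDiff.smoothNear (by fun_prop) _)) (htr _ _) (by simpa using h2)
    exact h3.congr (Eventually.of_forall fun r => by simp)
  · intro hcusp
    refine ⟨_, _, ht, ?_⟩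
    exact isCusp_comp_right (f := π ∘ γ) (ψ := fun r => r + q) (p := 0)
      (ContDiff.smoothNear (by fun_prop) _) (by simpa using hS) (htr _ _) (by simpa using hcusp)

theorem mem_singSet_iff (hπ : ContDiff ℝ ∞ π) (h : IsLocalParam C c γ O) {q : Phase}
    (hq : q ∈ O) : γ q ∈ singSet π C ↔ jac (π ∘ γ) q = 0 := by
  have ht := h.translate hq
  have htr : jac (π ∘ fun r => γ (r + q)) 0 = jac (π ∘ γ) q := by
    have := fderiv_comp_add_right (𝕜 := ℝ) (f := π ∘ γ) (x := 0) q
    rw [zero_add] at this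
    rw [jac, jac, ← this]
    rfl
  constructor
  · rintro ⟨γ', O', hγ', h0⟩
    obtain ⟨ψ, hψ, hψ0, hjψ, heq⟩ := hγ'.exists_reparam ht
    have hS' : SmoothNear (π ∘ γ') 0 :=
      (ContDiff.smoothNear hπ _).comp (hγ'.smoothNear hγ'.zero_mem)
    rw [← htr, jac_congr (g := (π ∘ γ') ∘ ψ)
      (by filter_upwards [heq] with r hr; simp only [hr, Function.comp]),
      jac_comp hψ.differentiableAt (by rw [hψ0]; exact hS'.differentiableAt), hψ0, h0, zero_mul]
  · intro h0
    exact ⟨_, _, ht, htr.trans h0⟩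

theorem cuspSet_subset : cuspSet π C ⊆ C := fun _ ⟨_, _, h, _⟩ => h.base_mem

/-- A vector tangent to a subset of `C` is the velocity of a curve in the parameter domain. -/
theorem IsLocalParam.exists_curve (h : IsLocalParam C c γ O) {q : Phase} (hq : q ∈ O)
    {A : Set (Phase × Phase)} (hA : A ⊆ C) {w : Phase × Phase} (hw : w ∈ tangentVecs A (γ q)) :
    ∃ s : ℝ → Phase, ContDiffAt ℝ ∞ s 0 ∧ s 0 = q ∧ (∀ᶠ t in 𝓝 (0 : ℝ), γ (s t) ∈ A) ∧
      fderiv ℝ γ q (deriv s 0) = w := by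
  obtain ⟨U, κ, hUo, hκ, hκγ, hγκ⟩ := h.exists_lift
  obtain ⟨δ, hδ, hδ0, hδA, rfl⟩ := hw
  have hU : δ 0 ∈ U := hδ0 ▸ (hκγ q hq).2
  have hs : ContDiffAt ℝ ∞ (fun t => κ (δ t)) 0 :=
    (hκ.contDiffAt (hUo.mem_nhds hU)).comp 0 hδ
  have hs0 : κ (δ 0) = q := by rw [hδ0]; exact (hκγ q hq).1
  have heq : ∀ᶠ t in 𝓝 (0 : ℝ), γ (κ (δ t)) = δ t := by
    filter_upwards [hδA, hδ.continuousAt.eventually (hUo.mem_nhds hU)] with t h1 h2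
    exact (hγκ _ ⟨hA h1, h2⟩).2
  refine ⟨fun t => κ (δ t), hs, hs0, ?_, ?_⟩
  · filter_upwards [hδA, heq] with t h1 h2
    rw [h2]; exact h1
  · have h1 : HasFDerivAt γ (fderiv ℝ γ q) (κ (δ 0)) := by
      rw [hs0]; exact (h.smoothNear hq).differentiableAt.hasFDerivAt
    have h2 := h1.comp_hasDerivAt (0 : ℝ) (hs.differentiableAt (by simp)).hasDerivAt
    have h3 : (fun t => γ (κ (δ t))) =ᶠ[𝓝 0] δ := heq
    rw [← h3.deriv_eq]
    exact h2.deriv.symm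

end Params

section Conic

variable {C : Set (Phase × Phase)} {c : Phase × Phase} {γ : Phase → Phase × Phase}
  {O : Set Phase}

theorem symp_eq (a b : Phase) : symp a b = inner ℝ a.2 b.1 - inner ℝ a.1 b.2 := by
  simp [symp, PiLp.inner_apply, Finset.sum_sub_distrib, mul_comm]

theorem IsCanonicalRelation.symp_eq (hC : IsCanonicalRelation C) (h : IsLocalParam C c γ O)
    {q : Phase} (hq : q ∈ O) (u v : Phase) :
    symp (fderiv ℝ γ q u).1 (fderiv ℝ γ q v).1 = symp (fderiv ℝ γ q u).2 (fderiv ℝ γ q v).2 := by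
  obtain ⟨γ', O', hγ', hlag⟩ := hC.lagrangian (γ q) (h.mem hq)
  obtain ⟨ψ, hψ, hψ0, -, heq⟩ := hγ'.exists_reparam (h.translate hq)
  have h1 := fderiv_comp_add_right (𝕜 := ℝ) (f := γ) (x := 0) q
  rw [zero_add] at h1
  have h2 : HasFDerivAt γ' (fderiv ℝ γ' (ψ 0)) (ψ 0) := by
    rw [hψ0]; exact (hγ'.smoothNear hγ'.zero_mem).differentiableAt.hasFDerivAt
  rw [← h1, heq.fderiv_eq, (h2.comp (0 : Phase) hψ.differentiableAt.hasFDerivAt).fderiv, hψ0]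
  exact hlag 0 hγ'.zero_mem _ _

/-- The radial vector field of the product. -/
def radial (c : Phase × Phase) : Phase × Phase := ((0, c.1.2), (0, c.2.2))

theorem radial_mem_tangentVecs {A : Set (Phase × Phase)}
    (hA : ∀ c ∈ A, ∀ t : ℝ, 0 < t → dil₂ t c ∈ A) {c : Phase × Phase} (hc : c ∈ A) :
    radial c ∈ tangentVecs A c := by
  refine ⟨fun t => dil₂ (1 + t) c, ?_, by simp [dil₂, dil], ?_, ?_⟩
  · simp only [dil₂, dil]
    fun_prop
  · filter_upwards [lt_mem_nhds (show (-1 : ℝ) < 0 by norm_num)] with t ht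
    exact hA c hc _ (by linarith)
  · have h1 : ∀ v : V3, HasDerivAt (fun t : ℝ => (1 + t) • v) v 0 := fun v => by
      simpa using ((hasDerivAt_id (0 : ℝ)).const_add 1).smul_const v
    exact (((hasDerivAt_const (0 : ℝ) c.1.1).prodMk (h1 c.1.2)).prodMk
      ((hasDerivAt_const (0 : ℝ) c.2.1).prodMk (h1 c.2.2))).deriv

/-- The difference of the canonical one-forms vanishes on a conic canonical relation. -/
theorem IsCanonicalRelation.inner_eq (hC : IsCanonicalRelation C) (h : IsLocalParam C c γ O)
    {q : Phase} (hq : q ∈ O) (u : Phase) :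
    inner ℝ (γ q).1.2 (fderiv ℝ γ q u).1.1 = inner ℝ (γ q).2.2 (fderiv ℝ γ q u).2.1 := by
  obtain ⟨s, -, -, -, hs⟩ := h.exists_curve hq subset_rfl
    (radial_mem_tangentVecs hC.conic (h.mem hq))
  have := hC.symp_eq h hq (deriv s 0) u
  rw [hs] at this
  simpa [FlatCusp.symp_eq, radial] using this

end Conic

/-! ### Transport by pairs of diffeomorphisms -/

section Transport

/-- A smooth diffeomorphism between open subsets. -/
structure IsSmoothHomeo {E : Type*} [NormedAddCommGroup E] [NormedSpace ℝ E]
    (χ : OpenPartialHomeomorph E E) : Prop where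
  smooth : ContDiffOn ℝ ∞ χ χ.source
  smooth_symm : ContDiffOn ℝ ∞ χ.symm χ.target

theorem IsHomogCanonical.isSmoothHomeo {χ : OpenPartialHomeomorph Phase Phase}
    (h : IsHomogCanonical χ) : IsSmoothHomeo χ := ⟨h.smooth, h.smooth_symm⟩

section General

variable {E : Type*} [NormedAddCommGroup E] [NormedSpace ℝ E] {χ : OpenPartialHomeomorph E E}

theorem IsSmoothHomeo.symm (h : IsSmoothHomeo χ) : IsSmoothHomeo χ.symm :=
  ⟨h.smooth_symm, h.smooth⟩

theorem IsSmoothHomeo.trans {χ' : OpenPartialHomeomorph E E} (h : IsSmoothHomeo χ)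
    (h' : IsSmoothHomeo χ') : IsSmoothHomeo (χ.trans χ') := by
  constructor
  · exact h'.smooth.comp (h.smooth.mono inter_subset_left) (fun x hx => hx.2)
  · exact h.smooth_symm.comp (h'.smooth_symm.mono inter_subset_left) (fun x hx => hx.2)

theorem IsSmoothHomeo.smoothNear (h : IsSmoothHomeo χ) {a : E} (ha : a ∈ χ.source) :
    SmoothNear χ a := ContDiffOn.smoothNear h.smooth χ.open_source ha

theorem IsSmoothHomeo.fderiv_symm_fderiv (h : IsSmoothHomeo χ) {a : E} (ha : a ∈ χ.source)
    (v : E) : fderiv ℝ χ.symm (χ a) (fderiv ℝ χ a v) = v := by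
  have h1 : (χ.symm ∘ χ) =ᶠ[𝓝 a] id := by
    filter_upwards [χ.open_source.mem_nhds ha] with b hb using χ.left_inv hb
  have h2 := h1.fderiv_eq (𝕜 := ℝ)
  rw [fderiv_id, fderiv_comp a (h.symm.smoothNear (χ.map_source ha)).differentiableAt
    (h.smoothNear ha).differentiableAt] at h2
  exact congrArg (fun A : E →L[ℝ] E => A v) h2

theorem IsSmoothHomeo.fderiv_fderiv_symm (h : IsSmoothHomeo χ) {a : E} (ha : a ∈ χ.source)
    (v : E) : fderiv ℝ χ a (fderiv ℝ χ.symm (χ a) v) = v := by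
  have := h.symm.fderiv_symm_fderiv (χ.map_source ha) v
  simpa [χ.left_inv ha] using this

theorem IsSmoothHomeo.jac_ne_zero [FiniteDimensional ℝ E] (h : IsSmoothHomeo χ) {a : E}
    (ha : a ∈ χ.source) : jac χ a ≠ 0 :=
  (det_ne_zero_iff_injective _).2 fun v hv => by
    rw [← h.fderiv_symm_fderiv ha v, hv, map_zero]

end General

variable {C : Set (Phase × Phase)} {c : Phase × Phase} {γ : Phase → Phase × Phase}
  {O : Set Phase} {π : Phase × Phase → Phase} {χL χR : OpenPartialHomeomorph Phase Phase}

theorem IsLocalParam.conjugate (hL : IsSmoothHomeo χL) (hR : IsSmoothHomeo χR)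
    (h : IsLocalParam C c γ O) (hcL : c.1 ∈ χL.source) (hcR : c.2 ∈ χR.source) :
    IsLocalParam (conjugate χL χR C) (χL c.1, χR c.2) (fun q => (χL (γ q).1, χR (γ q).2))
      {q ∈ O | (γ q).1 ∈ χL.source ∧ (γ q).2 ∈ χR.source} := by
  obtain ⟨U, κ, hUo, hU, hκ, hκγ⟩ := h.embedding
  have hsub : {q ∈ O | (γ q).1 ∈ χL.source ∧ (γ q).2 ∈ χR.source} ⊆ O := fun q hq => hq.1
  refine ⟨?_, ⟨h.zero_mem, ?_⟩, by simp [h.map_zero], ?_, (χL.prod χR).symm.source ∩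
    (χL.prod χR).symm ⁻¹' U, fun d => κ (χL.symm d.1, χR.symm d.2), ?_, ?_, ?_, ?_⟩
  · exact h.smooth.continuousOn.isOpen_inter_preimage h.isOpen
      (χL.open_source.prod χR.open_source)
  · rw [h.map_zero]; exact ⟨hcL, hcR⟩
  · exact (hL.smooth.comp (h.smooth.fst.mono hsub) fun q hq => hq.2.1).prodMk
      (hR.smooth.comp (h.smooth.snd.mono hsub) fun q hq => hq.2.2)
  · exact (χL.prod χR).symm.isOpen_inter_preimage hUo
  · ext d
    constructor
    · rintro ⟨q, ⟨hq, hqL, hqR⟩, rfl⟩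
      have hq' : γ q ∈ C ∩ U := hU ▸ mem_image_of_mem γ hq
      refine ⟨⟨γ q, ⟨hq'.1, hqL, hqR⟩, rfl⟩, ⟨χL.map_source hqL, χR.map_source hqR⟩, ?_⟩
      change (χL.symm (χL (γ q).1), χR.symm (χR (γ q).2)) ∈ U
      rw [χL.left_inv hqL, χR.left_inv hqR]
      exact hq'.2
    · rintro ⟨⟨c', ⟨hc', hcL', hcR'⟩, rfl⟩, -, hdU⟩
      change (χL.symm (χL c'.1), χR.symm (χR c'.2)) ∈ U at hdU
      rw [χL.left_inv hcL', χR.left_inv hcR'] at hdU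
      have : c' ∈ γ '' O := hU ▸ ⟨hc', hdU⟩
      obtain ⟨q, hq, rfl⟩ := this
      exact ⟨q, ⟨hq, hcL', hcR'⟩, rfl⟩
  · refine hκ.comp ?_ (fun d hd => hd.2)
    refine ContDiffOn.prodMk ?_ ?_
    · exact hL.smooth_symm.comp contDiffOn_fst (fun d hd => hd.1.1)
    · exact hR.smooth_symm.comp contDiffOn_snd (fun d hd => hd.1.2)
  · rintro q ⟨hq, hqL, hqR⟩
    simp only [χL.left_inv hqL, χR.left_inv hqR, Prod.mk.eta, hκγ q hq]

/-- Cusps are preserved by `χL × χR`, in either projection `π`, on which the pair acts by `g`. -/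
theorem mem_cuspSet_conjugate (hL : IsSmoothHomeo χL) (hR : IsSmoothHomeo χR)
    (hπ : ContDiff ℝ ∞ π) {g : OpenPartialHomeomorph Phase Phase} (hg : IsSmoothHomeo g)
    (hgπ : ∀ d : Phase × Phase, π (χL d.1, χR d.2) = g (π d))
    (hgs : ∀ d : Phase × Phase, d.1 ∈ χL.source → d.2 ∈ χR.source → π d ∈ g.source)
    (h : IsLocalParam C c γ O) (hcL : c.1 ∈ χL.source) (hcR : c.2 ∈ χR.source) :
    (χL c.1, χR c.2) ∈ cuspSet π (FlatCusp.conjugate χL χR C) ↔ c ∈ cuspSet π C := by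
  have h' := h.conjugate hL hR hcL hcR
  have hS : SmoothNear (π ∘ γ) 0 := (ContDiff.smoothNear hπ _).comp (h.smoothNear h.zero_mem)
  have hsrc : π c ∈ g.source := hgs c hcL hcR
  have hf0 : (π ∘ γ) 0 = π c := by simp [h.map_zero]
  have e1 := mem_cuspSet_iff hπ h h.zero_mem
  have e2 := mem_cuspSet_iff hπ h' h'.zero_mem
  rw [h.map_zero] at e1 e2
  rw [e1, e2]
  have hfun : (π ∘ fun q => (χL (γ q).1, χR (γ q).2)) = g ∘ (π ∘ γ) := by
    funext q
    exact hgπ (γ q)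
  rw [hfun]
  constructor
  · intro hcusp
    have hg' : SmoothNear g.symm ((g ∘ (π ∘ γ)) 0) := by
      change SmoothNear g.symm (g ((π ∘ γ) 0))
      rw [hf0]
      exact hg.symm.smoothNear (g.map_source hsrc)
    have := isCusp_comp_left (g := g.symm)
      (SmoothNear.comp (by rw [hf0]; exact hg.smoothNear hsrc) hS) hg'
      (by
        rw [hf0]; exact hg.symm.jac_ne_zero (g.map_source hsrc)) hcusp
    refine this.congr ?_
    have hev : ∀ᶠ q in 𝓝 (0 : Phase), (π ∘ γ) q ∈ g.source :=
      hS.continuousAt.eventually (g.open_source.mem_nhds (by rw [hf0]; exact hsrc))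
    filter_upwards [hev] with q hq
    simp only [Function.comp] at hq ⊢
    rw [g.left_inv hq]
  · exact isCusp_comp_left hS (by rw [hf0]; exact hg.smoothNear hsrc)
      (by rw [hf0]; exact hg.jac_ne_zero hsrc)

theorem mem_cuspSet_conjugate_left (hL : IsSmoothHomeo χL) (hR : IsSmoothHomeo χR)
    (h : IsLocalParam C c γ O) (hcL : c.1 ∈ χL.source) (hcR : c.2 ∈ χR.source) :
    (χL c.1, χR c.2) ∈ cuspSet Prod.fst (conjugate χL χR C) ↔ c ∈ cuspSet Prod.fst C :=
  mem_cuspSet_conjugate hL hR contDiff_fst hL (fun _ => rfl) (fun _ h _ => h) h hcL hcR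

theorem mem_cuspSet_conjugate_right (hL : IsSmoothHomeo χL) (hR : IsSmoothHomeo χR)
    (h : IsLocalParam C c γ O) (hcL : c.1 ∈ χL.source) (hcR : c.2 ∈ χR.source) :
    (χL c.1, χR c.2) ∈ cuspSet Prod.snd (conjugate χL χR C) ↔ c ∈ cuspSet Prod.snd C :=
  mem_cuspSet_conjugate hL hR contDiff_snd hR (fun _ => rfl) (fun _ _ h => h) h hcL hcR

theorem mem_singSet_conjugate (hL : IsSmoothHomeo χL) (hR : IsSmoothHomeo χR)
    (hπ : ContDiff ℝ ∞ π) {g : OpenPartialHomeomorph Phase Phase} (hg : IsSmoothHomeo g)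
    (hgπ : ∀ d : Phase × Phase, π (χL d.1, χR d.2) = g (π d))
    (hgs : ∀ d : Phase × Phase, d.1 ∈ χL.source → d.2 ∈ χR.source → π d ∈ g.source)
    (h : IsLocalParam C c γ O) (hcL : c.1 ∈ χL.source) (hcR : c.2 ∈ χR.source) :
    (χL c.1, χR c.2) ∈ singSet π (FlatCusp.conjugate χL χR C) ↔ c ∈ singSet π C := by
  have h' := h.conjugate hL hR hcL hcR
  have hS : SmoothNear (π ∘ γ) 0 := (ContDiff.smoothNear hπ _).comp (h.smoothNear h.zero_mem)
  have hsrc : π c ∈ g.source := hgs c hcL hcR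
  have hf0 : (π ∘ γ) 0 = π c := by simp [h.map_zero]
  have e1 := mem_singSet_iff hπ h h.zero_mem
  have e2 := mem_singSet_iff hπ h' h'.zero_mem
  rw [h.map_zero] at e1 e2
  rw [e1, e2]
  have hfun : (π ∘ fun q => (χL (γ q).1, χR (γ q).2)) = g ∘ (π ∘ γ) := by
    funext q
    exact hgπ (γ q)
  rw [hfun, jac_comp hS.differentiableAt (by rw [hf0]; exact (hg.smoothNear hsrc).differentiableAt),
    hf0, mul_eq_zero, or_iff_right (hg.jac_ne_zero hsrc)]

/-- Dilation by `t > 0` as a homeomorphism. -/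
def dilHomeo (t : ℝ) (ht : 0 < t) : OpenPartialHomeomorph Phase Phase :=
  Homeomorph.toOpenPartialHomeomorph
    { toFun := dil t
      invFun := dil t⁻¹
      left_inv := fun a => by simp [dil, smul_smul, ht.ne']
      right_inv := fun a => by simp [dil, smul_smul, ht.ne']
      continuous_toFun := by unfold dil; fun_prop
      continuous_invFun := by unfold dil; fun_prop }

@[simp] theorem dilHomeo_apply (t : ℝ) (ht : 0 < t) (a : Phase) :
    dilHomeo t ht a = dil t a := rfl

theorem isSmoothHomeo_dil (t : ℝ) (ht : 0 < t) : IsSmoothHomeo (dilHomeo t ht) := by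
  constructor
  · change ContDiffOn ℝ ∞ (dil t) _
    unfold dil; fun_prop
  · change ContDiffOn ℝ ∞ (dil t⁻¹) _
    unfold dil; fun_prop

theorem conjugate_dil (hC : ∀ c ∈ C, ∀ t : ℝ, 0 < t → dil₂ t c ∈ C) (t : ℝ) (ht : 0 < t) :
    conjugate (dilHomeo t ht) (dilHomeo t ht) C = C := by
  ext d
  constructor
  · rintro ⟨c, ⟨hc, -⟩, rfl⟩
    exact hC c hc t ht
  · intro hd
    refine ⟨dil₂ t⁻¹ d, ⟨hC d hd _ (inv_pos.2 ht), trivial, trivial⟩, ?_⟩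
    simp [dil₂, dil, smul_smul, ht.ne']

/-- The cusp set is conic. -/
theorem dil_mem_cuspSet_iff (hC : IsCanonicalRelation C) (hc : c ∈ C) {t : ℝ} (ht : 0 < t) :
    dil₂ t c ∈ cuspSet Prod.fst C ↔ c ∈ cuspSet Prod.fst C := by
  obtain ⟨γ, O, h, -⟩ := hC.lagrangian c hc
  have := mem_cuspSet_conjugate_left (isSmoothHomeo_dil t ht) (isSmoothHomeo_dil t ht) h
    trivial trivial
  rwa [conjugate_dil hC.conic] at this

/-- The singular sets are conic. -/
theorem dil_mem_singSet_iff (hC : IsCanonicalRelation C) (hc : c ∈ C) {t : ℝ} (ht : 0 < t)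
    (hπ : π = Prod.fst ∨ π = Prod.snd) :
    dil₂ t c ∈ singSet π C ↔ c ∈ singSet π C := by
  obtain ⟨γ, O, h, -⟩ := hC.lagrangian c hc
  have hs := isSmoothHomeo_dil t ht
  rcases hπ with rfl | rfl
  · have := mem_singSet_conjugate hs hs contDiff_fst hs (fun _ => rfl) (fun _ h _ => h) h
      trivial trivial
    rwa [conjugate_dil hC.conic] at this
  · have := mem_singSet_conjugate hs hs contDiff_snd hs (fun _ => rfl) (fun _ _ h => h) h
      trivial trivial
    rwa [conjugate_dil hC.conic] at this

end Transport

/-! ### Homogeneous canonical transformations -/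

section Canonical

/-- A homogeneous diffeomorphism which preserves the canonical one-form is canonical. -/
theorem isHomogCanonical_of_inner {χ : OpenPartialHomeomorph Phase Phase} (h : IsSmoothHomeo χ)
    (hs : ∀ a ∈ χ.source, a.2 ≠ 0) (ht : ∀ a ∈ χ.target, a.2 ≠ 0)
    (hc : ∀ a ∈ χ.source, ∀ t : ℝ, 0 < t → dil t a ∈ χ.source)
    (hh : ∀ a ∈ χ.source, ∀ t : ℝ, 0 < t → χ (dil t a) = dil t (χ a))
    (hα : ∀ a ∈ χ.source, ∀ v : Phase, inner ℝ (χ a).2 (fderiv ℝ χ a v).1 = inner ℝ a.2 v.1) :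
    IsHomogCanonical χ := by
  refine ⟨h.smooth, h.smooth_symm, hs, ht, hc, hh, fun a ha u v => ?_⟩
  have hχ := (h.smoothNear ha).contDiffAt
  have hd := (hχ.differentiableAt (by simp)).hasFDerivAt
  have hf : ∀ w, fderiv ℝ (fun s => (χ s).2) a w = (fderiv ℝ χ a w).2 := fun w => by
    rw [hd.snd.fderiv]; rfl
  have hg : ∀ s ∈ χ.source, ∀ w, fderiv ℝ (fun s => (χ s).1) s w = (fderiv ℝ χ s w).1 :=
    fun s hs w => by
      rw [(h.smoothNear hs).differentiableAt.hasFDerivAt.fst.fderiv]; rfl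
  have key := fderiv_inner_fderiv_sub hχ.snd hχ.fst v u
  have hα' : ∀ v u : Phase, fderiv ℝ (fun s => inner ℝ (χ s).2
      (fderiv ℝ (fun s => (χ s).1) s v)) a u = inner ℝ u.2 v.1 := by
    intro v u
    have h1 : (fun s => inner ℝ (χ s).2 (fderiv ℝ (fun s => (χ s).1) s v)) =ᶠ[𝓝 a]
        fun s : Phase => inner ℝ s.2 v.1 := by
      filter_upwards [χ.open_source.mem_nhds ha] with s hs
      rw [hg s hs, hα s hs]
    have h2 : HasFDerivAt (fun s : Phase => inner ℝ s.2 v.1) _ a :=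
      (hasFDerivAt_snd (p := a)).inner ℝ (hasFDerivAt_const v.1 a)
    rw [h1.fderiv_eq, h2.fderiv]
    simp [fderivInnerCLM_apply]
  rw [hα', hα', hf, hf, hg a ha, hg a ha] at key
  rw [symp_eq, symp_eq, real_inner_comm, real_inner_comm v.2 u.1,
    real_inner_comm (fderiv ℝ χ a v).2] at *
  linarith [real_inner_comm (fderiv ℝ χ a v).1 (fderiv ℝ χ a u).2, real_inner_comm v.1 u.2]

theorem IsHomogCanonical.trans {χ χ' : OpenPartialHomeomorph Phase Phase}
    (h : IsHomogCanonical χ) (h' : IsHomogCanonical χ') : IsHomogCanonical (χ.trans χ') := by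
  have hs := h.isSmoothHomeo.trans h'.isSmoothHomeo
  have hmem : ∀ a ∈ (χ.trans χ').source, a ∈ χ.source ∧ χ a ∈ χ'.source := fun a ha => ha
  refine ⟨hs.smooth, hs.smooth_symm, fun a ha => h.source_ne_zero a ha.1,
    fun a ha => h'.target_ne_zero a ha.1, fun a ha t ht => ⟨h.source_conic a ha.1 t ht, ?_⟩,
    fun a ha t ht => ?_, fun a ha u v => ?_⟩
  · change χ (dil t a) ∈ χ'.source
    rw [h.homogeneous a ha.1 t ht]
    exact h'.source_conic _ ha.2 t ht
  · change χ' (χ (dil t a)) = dil t (χ' (χ a))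
    rw [h.homogeneous a ha.1 t ht, h'.homogeneous _ (hmem a ha).2 t ht]
  · have : ∀ w, fderiv ℝ (χ.trans χ') a w = fderiv ℝ χ' (χ a) (fderiv ℝ χ a w) := fun w => by
      change fderiv ℝ (χ' ∘ χ) a w = _
      rw [fderiv_comp a (h'.isSmoothHomeo.smoothNear (hmem a ha).2).differentiableAt
        (h.isSmoothHomeo.smoothNear ha.1).differentiableAt]
      rfl
    rw [this, this, h'.symplectic _ (hmem a ha).2, h.symplectic _ ha.1]

theorem IsHomogCanonical.restr {χ : OpenPartialHomeomorph Phase Phase}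
    (h : IsHomogCanonical χ) {s : Set Phase} (hso : IsOpen s)
    (hs : ∀ a ∈ s, ∀ t : ℝ, 0 < t → dil t a ∈ s) : IsHomogCanonical (χ.restrOpen s hso) :=
  ⟨h.smooth.mono inter_subset_left, h.smooth_symm.mono inter_subset_left,
    fun a ha => h.source_ne_zero a ha.1, fun a ha => h.target_ne_zero a ha.1,
    fun a ha t ht => ⟨h.source_conic a ha.1 t ht, hs a ha.2 t ht⟩,
    fun a ha t ht => h.homogeneous a ha.1 t ht, fun a ha u v => h.symplectic a ha.1 u v⟩

/-- The transpose `Aᵀ ξ`. -/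
def covec (A : V3 →L[ℝ] V3) (ξ : V3) : V3 := WithLp.toLp 2 fun i => inner ℝ ξ (A (basisVec i))

theorem inner_covec (A : V3 →L[ℝ] V3) (ξ v : V3) : inner ℝ (covec A ξ) v = inner ℝ ξ (A v) := by
  conv_rhs => rw [eq_sum_basisVec v]
  simp only [map_add, map_smul, inner_add_right, inner_smul_right]
  simp [PiLp.inner_apply, covec, Fin.sum_univ_three]

theorem covec_unique {ξ η : V3} (h : ∀ v, inner ℝ ξ v = inner ℝ η v) : ξ = η :=
  ext_inner_right ℝ h

theorem contDiff_covec : ContDiff ℝ ∞ fun p : (V3 →L[ℝ] V3) × V3 => covec p.1 p.2 := by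
  unfold covec
  rw [contDiff_piLp]
  intro i
  exact contDiff_snd.inner ℝ (contDiff_fst.clm_apply contDiff_const)

section Lift

variable {ψ : OpenPartialHomeomorph V3 V3}

theorem contDiffOn_lift (h : IsSmoothHomeo ψ) :
    ContDiffOn ℝ ∞ (fun a : Phase => (ψ a.1, covec (fderiv ℝ ψ.symm (ψ a.1)) a.2))
      (ψ.source ×ˢ {0}ᶜ) := by
  have h1 : ContDiffOn ℝ ∞ (fun a : Phase => ψ a.1) (ψ.source ×ˢ {0}ᶜ) :=
    h.smooth.comp contDiffOn_fst (fun a ha => ha.1)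
  have h2 : ContDiffOn ℝ ∞ (fderiv ℝ ψ.symm) ψ.target :=
    h.smooth_symm.fderiv_of_isOpen ψ.open_target (by simp)
  exact h1.prodMk (contDiff_covec.comp_contDiffOn
    ((h2.comp h1 fun a ha => ψ.map_source ha.1).prodMk contDiffOn_snd))

theorem covec_fderiv_covec (h : IsSmoothHomeo ψ) {x : V3} (hx : x ∈ ψ.source) (ξ : V3) :
    covec (fderiv ℝ ψ x) (covec (fderiv ℝ ψ.symm (ψ x)) ξ) = ξ :=
  covec_unique fun v => by rw [inner_covec, inner_covec, h.fderiv_symm_fderiv hx]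

theorem covec_fderiv_symm_ne_zero (h : IsSmoothHomeo ψ) {x : V3} (hx : x ∈ ψ.source) {ξ : V3}
    (hξ : ξ ≠ 0) : covec (fderiv ℝ ψ.symm (ψ x)) ξ ≠ 0 := fun h0 => hξ <| by
  rw [← covec_fderiv_covec h hx ξ, h0]
  exact covec_unique fun v => by rw [inner_covec, inner_zero_left, inner_zero_left]

/-- The canonical transformation induced by a change of coordinates of the base. -/
def lift (ψ : OpenPartialHomeomorph V3 V3) (h : IsSmoothHomeo ψ) :
    OpenPartialHomeomorph Phase Phase where
  toFun a := (ψ a.1, covec (fderiv ℝ ψ.symm (ψ a.1)) a.2)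
  invFun b := (ψ.symm b.1, covec (fderiv ℝ ψ (ψ.symm b.1)) b.2)
  source := ψ.source ×ˢ {0}ᶜ
  target := ψ.target ×ˢ {0}ᶜ
  map_source' a ha := ⟨ψ.map_source ha.1, covec_fderiv_symm_ne_zero h ha.1 ha.2⟩
  map_target' b hb := ⟨ψ.map_target hb.1, covec_fderiv_symm_ne_zero h.symm hb.1 hb.2⟩
  left_inv' a ha := by
    refine Prod.ext (ψ.left_inv ha.1) ?_
    simp only [ψ.left_inv ha.1]
    exact covec_fderiv_covec h ha.1 a.2
  right_inv' b hb := by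
    refine Prod.ext (ψ.right_inv hb.1) ?_
    simp only [ψ.right_inv hb.1]
    exact covec_fderiv_covec h.symm hb.1 b.2
  open_source := ψ.open_source.prod isOpen_compl_singleton
  open_target := ψ.open_target.prod isOpen_compl_singleton
  continuousOn_toFun := (contDiffOn_lift h).continuousOn
  continuousOn_invFun := (contDiffOn_lift h.symm).continuousOn

theorem lift_apply (ψ : OpenPartialHomeomorph V3 V3) (h : IsSmoothHomeo ψ) (a : Phase) :
    lift ψ h a = (ψ a.1, covec (fderiv ℝ ψ.symm (ψ a.1)) a.2) := rfl

theorem fderiv_lift_fst {ψ : OpenPartialHomeomorph V3 V3} (h : IsSmoothHomeo ψ) {a : Phase}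
    (ha : a ∈ (lift ψ h).source) (v : Phase) :
    (fderiv ℝ (lift ψ h) a v).1 = fderiv ℝ ψ a.1 v.1 := by
  have h1 : DifferentiableAt ℝ (lift ψ h) a :=
    (ContDiffOn.smoothNear (contDiffOn_lift h) (lift ψ h).open_source ha).differentiableAt
  have h2 := h1.hasFDerivAt.fst
  have h3 := ((h.smoothNear ha.1).differentiableAt.hasFDerivAt.comp a
    (hasFDerivAt_fst (𝕜 := ℝ) (p := a)))
  exact congrArg (fun A : Phase →L[ℝ] V3 => A v) (h2.unique h3)

theorem isHomogCanonical_lift {ψ : OpenPartialHomeomorph V3 V3} (h : IsSmoothHomeo ψ) :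
    IsHomogCanonical (lift ψ h) := by
  refine isHomogCanonical_of_inner ⟨contDiffOn_lift h, contDiffOn_lift h.symm⟩
    (fun a ha => ha.2) (fun a ha => ha.2) (fun a ha t ht => ⟨ha.1, ?_⟩) (fun a ha t ht => ?_)
    (fun a ha v => ?_)
  · exact smul_ne_zero ht.ne' ha.2
  · refine Prod.ext rfl (covec_unique fun v => ?_)
    simp only [lift_apply, dil, inner_covec, inner_smul_left]
  · rw [fderiv_lift_fst h ha, lift_apply, inner_covec, h.fderiv_symm_fderiv ha.1]

end Lift

/-- The affine change of coordinates which moves the point `x₀` to the origin, and whose lift moves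
the covector `ξ₀` to `e₃`. -/
theorem exists_affine (a : Phase) (ha : a.2 ≠ 0) :
    ∃ (ψ : OpenPartialHomeomorph V3 V3) (h : IsSmoothHomeo ψ),
      a ∈ (lift ψ h).source ∧ lift ψ h a = (0, basisVec 2) := by
  obtain ⟨x₀, ξ₀⟩ := a
  have hn : ‖ξ₀‖ ≠ 0 := norm_ne_zero_iff.2 ha
  have hunit : ‖(‖ξ₀‖⁻¹ • ξ₀ : V3)‖ = ‖basisVec 2‖ := by
    rw [norm_smul, norm_inv, norm_norm, inv_mul_cancel₀ hn]
    simp [basisVec]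
  let R := (Submodule.span ℝ {(‖ξ₀‖⁻¹ • ξ₀ : V3) - basisVec 2})ᗮ.reflection
  have hR : R (‖ξ₀‖⁻¹ • ξ₀) = basisVec 2 := Submodule.reflection_sub hunit
  have hRR : ∀ v, R (R v) = v := fun v => Submodule.reflection_reflection _ v
  let ψ : OpenPartialHomeomorph V3 V3 := Homeomorph.toOpenPartialHomeomorph
    { toFun := fun x => ‖ξ₀‖ • R (x - x₀)
      invFun := fun y => ‖ξ₀‖⁻¹ • R y + x₀
      left_inv := fun x => by simp [hRR, smul_smul, hn]
      right_inv := fun y => by simp [hRR, smul_smul, hn]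
      continuous_toFun := by fun_prop
      continuous_invFun := by fun_prop }
  have hRs : ContDiff ℝ ∞ R := R.toContinuousLinearEquiv.contDiff
  have hψ : IsSmoothHomeo ψ := by
    constructor
    · change ContDiffOn ℝ ∞ (fun x => ‖ξ₀‖ • R (x - x₀)) _
      exact ((hRs.comp (contDiff_id.sub contDiff_const)).const_smul ‖ξ₀‖).contDiffOn
    · change ContDiffOn ℝ ∞ (fun y => ‖ξ₀‖⁻¹ • R y + x₀) _
      exact ((hRs.const_smul ‖ξ₀‖⁻¹).add contDiff_const).contDiffOn
  refine ⟨ψ, hψ, ⟨trivial, ha⟩, ?_⟩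
  have hd : ∀ y v, fderiv ℝ ψ.symm y v = ‖ξ₀‖⁻¹ • R v := by
    intro y v
    have : HasFDerivAt ψ.symm (‖ξ₀‖⁻¹ • (R.toContinuousLinearEquiv : V3 →L[ℝ] V3)) y := by
      exact (R.toContinuousLinearEquiv.hasFDerivAt.const_smul ‖ξ₀‖⁻¹).add_const x₀
    rw [this.fderiv]
    rfl
  refine Prod.ext ?_ (covec_unique fun v => ?_)
  · change ‖ξ₀‖ • R (x₀ - x₀) = 0
    simp
  · rw [lift_apply, inner_covec, hd, inner_smul_right]
    have h1 : ξ₀ = ‖ξ₀‖ • R (basisVec 2) := by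
      rw [← hR, hRR, smul_smul, mul_inv_cancel₀ hn, one_smul]
    conv_lhs => rw [h1]
    rw [inner_smul_left, LinearIsometryEquiv.inner_map_map, norm_smul, norm_norm,
      LinearIsometryEquiv.norm_map]
    have h2 : ‖basisVec 2‖ = 1 := by simp [basisVec]
    rw [h2]
    simp [hn]

/-- The time `1` flow of the Hamiltonian `|ξ'|² / (2 ξ₃)`, in the base variables. -/
def shearVec (ξ : V3) : V3 :=
  (ξ 0 / ξ 2) • basisVec 0 + (ξ 1 / ξ 2) • basisVec 1 -
    (((ξ 0 / ξ 2) ^ 2 + (ξ 1 / ξ 2) ^ 2) / 2) • basisVec 2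

theorem contDiffAt_shearVec {ξ : V3} (h : 0 < ξ 2) : ContDiffAt ℝ ∞ shearVec ξ := by
  have h0 : ∀ i, ContDiffAt ℝ ∞ (fun ξ : V3 => ξ i) ξ := fun i => by fun_prop
  have h1 := (h0 0).div (h0 2) h.ne'
  have h2 := (h0 1).div (h0 2) h.ne'
  exact ((h1.smul contDiffAt_const).add (h2.smul contDiffAt_const)).sub
    ((((h1.pow 2).add (h2.pow 2)).div_const 2).smul contDiffAt_const)

theorem shearVec_smul (ξ : V3) {t : ℝ} (ht : 0 < t) : shearVec (t • ξ) = shearVec ξ := by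
  simp [shearVec, mul_div_mul_left _ _ ht.ne']

/-- `shearVec` is constant along rays, and its values form a hypersurface conormal to `ξ`. -/
theorem fderiv_shearVec {ξ : V3} (h : 0 < ξ 2) (v : V3) :
    inner ℝ ξ (fderiv ℝ shearVec ξ v) = 0 ∧
      (ξ = basisVec 2 → fderiv ℝ shearVec ξ v = v 0 • basisVec 0 + v 1 • basisVec 1) := by
  have hl : ∀ i, HasDerivAt (fun s : ℝ => (ξ + s • v) i) (v i) 0 := fun i => by
    simpa using ((hasDerivAt_id (0 : ℝ)).mul_const (v i)).const_add (ξ i)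
  have hne : (ξ + (0 : ℝ) • v) 2 ≠ 0 := by simpa using h.ne'
  have h1 := (hl 0).fun_div (hl 2) hne
  have h2 := (hl 1).fun_div (hl 2) hne
  have h3 := ((h1.smul_const (basisVec 0)).add (h2.smul_const (basisVec 1))).sub
    ((((h1.pow 2).add (h2.pow 2)).div_const 2).smul_const (basisVec 2))
  have h4 := (hasDerivAt_line ((contDiffAt_shearVec h).differentiableAt (by simp)) v).unique h3
  rw [h4]
  constructor
  · rw [PiLp.inner_apply]
    simp [Fin.sum_univ_three, basisVec_apply]
    field_simp
    ring
  · rintro rfl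
    simp [basisVec_apply]

/-- The canonical transformation `(x, ξ) ↦ (x + t ∂_ξ H, ξ)`, with `H = |ξ'|² / (2 ξ₃)`, on the half
space `ξ₃ > 0`. -/
def shear (t : ℝ) : OpenPartialHomeomorph Phase Phase where
  toFun a := (a.1 + t • shearVec a.2, a.2)
  invFun b := (b.1 - t • shearVec b.2, b.2)
  source := {a | 0 < a.2 2}
  target := {a | 0 < a.2 2}
  map_source' _ h := h
  map_target' _ h := h
  left_inv' a _ := by simp
  right_inv' a _ := by simp
  open_source := isOpen_lt continuous_const (by fun_prop)
  open_target := isOpen_lt continuous_const (by fun_prop)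
  continuousOn_toFun := fun a ha => ((continuous_fst.continuousAt.add
    (((contDiffAt_shearVec ha).continuousAt.comp (f := fun a : Phase => a.2)
      continuous_snd.continuousAt).const_smul t)).prodMk
      continuous_snd.continuousAt).continuousWithinAt
  continuousOn_invFun := fun a ha => ((continuous_fst.continuousAt.sub
    (((contDiffAt_shearVec ha).continuousAt.comp (f := fun a : Phase => a.2)
      continuous_snd.continuousAt).const_smul t)).prodMk
      continuous_snd.continuousAt).continuousWithinAt

theorem shear_apply (t : ℝ) (a : Phase) : shear t a = (a.1 + t • shearVec a.2, a.2) := rfl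

theorem shear_source (t : ℝ) : (shear t).source = {a : Phase | 0 < a.2 2} := rfl

theorem fderiv_shear (t : ℝ) {a : Phase} (ha : 0 < a.2 2) (v : Phase) :
    fderiv ℝ (shear t) a v = (v.1 + t • fderiv ℝ shearVec a.2 v.2, v.2) := by
  have h1 := ((contDiffAt_shearVec ha).differentiableAt (by simp)).hasFDerivAt.comp a
    (hasFDerivAt_snd (𝕜 := ℝ) (p := a))
  have h2 := ((hasFDerivAt_fst (𝕜 := ℝ) (p := a)).add (h1.const_smul t)).prodMk
    (hasFDerivAt_snd (𝕜 := ℝ) (p := a))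
  have h3 : fderiv ℝ (shear t) a = _ := h2.fderiv
  rw [h3]
  rfl

theorem isHomogCanonical_shear (t : ℝ) : IsHomogCanonical (shear t) := by
  have hne : ∀ a : Phase, 0 < a.2 2 → a.2 ≠ 0 := fun a ha h0 => by simp [h0] at ha
  refine isHomogCanonical_of_inner ⟨?_, ?_⟩ hne hne (fun a ha r hr => ?_) (fun a ha r hr => ?_)
    (fun a ha v => ?_)
  · intro a ha
    exact ((contDiffAt_fst.add
      (((contDiffAt_shearVec ha).comp a contDiffAt_snd).const_smul t)).prodMk
      contDiffAt_snd).contDiffWithinAt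
  · intro a ha
    exact ((contDiffAt_fst.sub
      (((contDiffAt_shearVec ha).comp a contDiffAt_snd).const_smul t)).prodMk
      contDiffAt_snd).contDiffWithinAt
  · have : (0 : ℝ) < a.2 2 := ha
    change 0 < (r • a.2) 2
    simpa using mul_pos hr this
  · simp [shear_apply, dil, shearVec_smul _ hr]
  · rw [fderiv_shear t ha, shear_apply, inner_add_right, inner_smul_right,
      (fderiv_shearVec ha v.2).1]
    simp

end Canonical

/-! ### Flat relations under canonical transformations -/

section Flat

variable {C : Set (Phase × Phase)} {c : Phase × Phase} {γ : Phase → Phase × Phase}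
  {O : Set Phase} {χL χR : OpenPartialHomeomorph Phase Phase}

/-- A canonical relation with a common cusp set for both projections, whose two images are
coisotropic and nonradial. -/
structure FlatRel (C : Set (Phase × Phase)) : Prop where
  canonical : IsCanonicalRelation C
  cuspSet_eq : cuspSet Prod.fst C = cuspSet Prod.snd C
  flat_left : ∀ c ∈ cuspSet Prod.fst C,
    IsCoisotropic (Prod.fst '' tangentVecs (cuspSet Prod.fst C) c) ∧
      IsNonradial c.1 (Prod.fst '' tangentVecs (cuspSet Prod.fst C) c)
  flat_right : ∀ c ∈ cuspSet Prod.snd C,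
    IsCoisotropic (Prod.snd '' tangentVecs (cuspSet Prod.snd C) c) ∧
      IsNonradial c.2 (Prod.snd '' tangentVecs (cuspSet Prod.snd C) c)

theorem IsFlatTwoSidedCuspLocal.flatRel (h : IsFlatTwoSidedCuspLocal C) : FlatRel C :=
  ⟨h.canonical, h.cuspSet_eq, h.flat_left, h.flat_right⟩

theorem tangentVecs_conjugate (hL : IsSmoothHomeo χL) (hR : IsSmoothHomeo χR)
    {A A' : Set (Phase × Phase)} (hcL : c.1 ∈ χL.source) (hcR : c.2 ∈ χR.source)
    (hA : ∀ d ∈ A, d.1 ∈ χL.source → d.2 ∈ χR.source → (χL d.1, χR d.2) ∈ A')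
    {w : Phase × Phase} (hw : w ∈ tangentVecs A c) :
    (fderiv ℝ χL c.1 w.1, fderiv ℝ χR c.2 w.2) ∈ tangentVecs A' (χL c.1, χR c.2) := by
  obtain ⟨δ, hδ, rfl, hδA, rfl⟩ := hw
  refine ⟨fun t => (χL (δ t).1, χR (δ t).2), ?_, rfl, ?_, ?_⟩
  · exact ((hL.smoothNear hcL).contDiffAt.comp 0 hδ.fst).prodMk
      ((hR.smoothNear hcR).contDiffAt.comp 0 hδ.snd)
  · filter_upwards [hδA, hδ.fst.continuousAt.eventually (χL.open_source.mem_nhds hcL),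
      hδ.snd.continuousAt.eventually (χR.open_source.mem_nhds hcR)] with t h1 h2 h3
    exact hA _ h1 h2 h3
  · have hd := (hδ.differentiableAt (by simp)).hasDerivAt
    have h1 : HasDerivAt (fun t => (δ t).1) (deriv δ 0).1 0 :=
      (ContinuousLinearMap.fst ℝ Phase Phase).hasFDerivAt.comp_hasDerivAt 0 hd
    have h2 : HasDerivAt (fun t => (δ t).2) (deriv δ 0).2 0 :=
      (ContinuousLinearMap.snd ℝ Phase Phase).hasFDerivAt.comp_hasDerivAt 0 hd
    exact (((hL.smoothNear hcL).differentiableAt.hasFDerivAt.comp_hasDerivAt 0 h1).prodMk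
      ((hR.smoothNear hcR).differentiableAt.hasFDerivAt.comp_hasDerivAt 0 h2)).deriv

/-- Euler's identity: the radial vector field is invariant. -/
theorem IsHomogCanonical.fderiv_radial {χ : OpenPartialHomeomorph Phase Phase}
    (h : IsHomogCanonical χ) {a : Phase} (ha : a ∈ χ.source) :
    fderiv ℝ χ a (0, a.2) = (0, (χ a).2) := by
  have h1 := hasDerivAt_line ((h.isSmoothHomeo.smoothNear ha).differentiableAt) (0, a.2)
  have h2 : HasDerivAt (fun s : ℝ => dil (1 + s) (χ a)) (0, (χ a).2) 0 :=
    (hasDerivAt_const (0 : ℝ) (χ a).1).prodMk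
      (by simpa using ((hasDerivAt_id (0 : ℝ)).const_add 1).smul_const (χ a).2)
  refine h1.unique (h2.congr_of_eventuallyEq ?_)
  filter_upwards [lt_mem_nhds (show (-1 : ℝ) < 0 by norm_num)] with s hs
  rw [← h.homogeneous a ha _ (by linarith)]
  congr 1
  simp [dil, Prod.ext_iff, add_smul]

theorem IsHomogCanonical.isCoisotropic {χ : OpenPartialHomeomorph Phase Phase}
    (h : IsHomogCanonical χ) {a : Phase} (ha : a ∈ χ.source) {T T' : Set Phase}
    (hT : ∀ w ∈ T, fderiv ℝ χ a w ∈ T') (hco : IsCoisotropic T) : IsCoisotropic T' := by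
  intro u hu
  have hs := h.isSmoothHomeo.fderiv_fderiv_symm ha
  rw [← hs u]
  refine hT _ (hco _ fun w hw => ?_)
  rw [← h.symplectic a ha, hs]
  exact hu _ (hT w hw)

theorem IsHomogCanonical.isNonradial {χ : OpenPartialHomeomorph Phase Phase}
    (h : IsHomogCanonical χ) {a : Phase} (ha : a ∈ χ.source) {T T' : Set Phase}
    (hT : ∀ w ∈ T, fderiv ℝ χ a w ∈ T') (hr : IsNonradial a T) : IsNonradial (χ a) T' := by
  intro h0
  refine hr fun w hw => ?_
  rw [← h.symplectic a ha, h.fderiv_radial ha]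
  exact h0 _ (hT w hw)

theorem conjugate_conjugate (χL' χR' : OpenPartialHomeomorph Phase Phase) :
    conjugate χL' χR' (conjugate χL χR C) = conjugate (χL.trans χL') (χR.trans χR') C := by
  ext d
  constructor
  · rintro ⟨_, ⟨⟨c, ⟨hc, h1, h2⟩, rfl⟩, h3, h4⟩, rfl⟩
    exact ⟨c, ⟨hc, ⟨h1, h3⟩, ⟨h2, h4⟩⟩, rfl⟩
  · rintro ⟨c, ⟨hc, h1, h2⟩, rfl⟩
    exact ⟨(χL c.1, χR c.2), ⟨⟨c, ⟨hc, h1.1, h2.1⟩, rfl⟩, h1.2, h2.2⟩, rfl⟩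

theorem IsCanonicalRelation.conjugate (h : IsCanonicalRelation C) (hL : IsHomogCanonical χL)
    (hR : IsHomogCanonical χR) : IsCanonicalRelation (conjugate χL χR C) := by
  refine ⟨?_, ?_, ?_⟩
  · rintro _ ⟨c, ⟨-, h1, h2⟩, rfl⟩
    exact ⟨hL.target_ne_zero _ (χL.map_source h1), hR.target_ne_zero _ (χR.map_source h2)⟩
  · rintro _ ⟨c, ⟨hc, h1, h2⟩, rfl⟩ t ht
    refine ⟨dil₂ t c, ⟨h.conic c hc t ht, hL.source_conic _ h1 t ht, hR.source_conic _ h2 t ht⟩, ?_⟩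
    simp only [dil₂, hL.homogeneous _ h1 t ht, hR.homogeneous _ h2 t ht]
  · rintro _ ⟨c, ⟨hc, h1, h2⟩, rfl⟩
    obtain ⟨γ, O, hγ, -⟩ := h.lagrangian c hc
    refine ⟨_, _, hγ.conjugate hL.isSmoothHomeo hR.isSmoothHomeo h1 h2, ?_⟩
    rintro q ⟨hq, hqL, hqR⟩ u v
    have hd := (hγ.smoothNear hq).differentiableAt.hasFDerivAt
    have d1 := (hL.isSmoothHomeo.smoothNear hqL).differentiableAt.hasFDerivAt.comp q hd.fst
    have d2 := (hR.isSmoothHomeo.smoothNear hqR).differentiableAt.hasFDerivAt.comp q hd.snd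
    have d3 : fderiv ℝ (fun q => (χL (γ q).1, χR (γ q).2)) q = _ := (d1.prodMk d2).fderiv
    rw [d3]
    change symp (fderiv ℝ χL _ _) (fderiv ℝ χL _ _) = symp (fderiv ℝ χR _ _) (fderiv ℝ χR _ _)
    rw [hL.symplectic _ hqL, hR.symplectic _ hqR]
    exact h.symp_eq hγ hq u v

theorem FlatRel.conjugate (h : FlatRel C) (hL : IsHomogCanonical χL) (hR : IsHomogCanonical χR) :
    FlatRel (conjugate χL χR C) := by
  have hLs := hL.isSmoothHomeo
  have hRs := hR.isSmoothHomeo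
  have key1 : ∀ c ∈ C, c.1 ∈ χL.source → c.2 ∈ χR.source →
      ((χL c.1, χR c.2) ∈ cuspSet Prod.fst (FlatCusp.conjugate χL χR C) ↔
        c ∈ cuspSet Prod.fst C) := fun c hc h1 h2 => by
    obtain ⟨γ, O, hγ, -⟩ := h.canonical.lagrangian c hc
    exact mem_cuspSet_conjugate_left hLs hRs hγ h1 h2
  have key2 : ∀ c ∈ C, c.1 ∈ χL.source → c.2 ∈ χR.source →
      ((χL c.1, χR c.2) ∈ cuspSet Prod.snd (FlatCusp.conjugate χL χR C) ↔
        c ∈ cuspSet Prod.snd C) := fun c hc h1 h2 => by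
    obtain ⟨γ, O, hγ, -⟩ := h.canonical.lagrangian c hc
    exact mem_cuspSet_conjugate_right hLs hRs hγ h1 h2
  refine ⟨h.canonical.conjugate hL hR, ?_, ?_, ?_⟩
  · ext d
    constructor
    · intro hd
      obtain ⟨c, ⟨hc, h1, h2⟩, rfl⟩ := cuspSet_subset hd
      rw [key2 c hc h1 h2, ← h.cuspSet_eq]
      exact (key1 c hc h1 h2).1 hd
    · intro hd
      obtain ⟨c, ⟨hc, h1, h2⟩, rfl⟩ := cuspSet_subset hd
      rw [key1 c hc h1 h2, h.cuspSet_eq]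
      exact (key2 c hc h1 h2).1 hd
  · intro d hd
    obtain ⟨c, ⟨hc, h1, h2⟩, rfl⟩ := cuspSet_subset hd
    obtain ⟨h3, h4⟩ := h.flat_left c ((key1 c hc h1 h2).1 hd)
    have hT : ∀ w ∈ Prod.fst '' tangentVecs (cuspSet Prod.fst C) c, fderiv ℝ χL c.1 w ∈
        Prod.fst '' tangentVecs (cuspSet Prod.fst (FlatCusp.conjugate χL χR C))
          (χL c.1, χR c.2) := by
      rintro _ ⟨w, hw, rfl⟩
      exact ⟨_, tangentVecs_conjugate hLs hRs h1 h2
        (fun d hd hd1 hd2 => (key1 d (cuspSet_subset hd) hd1 hd2).2 hd) hw, rfl⟩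
    exact ⟨hL.isCoisotropic h1 hT h3, hL.isNonradial h1 hT h4⟩
  · intro d hd
    obtain ⟨c, ⟨hc, h1, h2⟩, rfl⟩ := cuspSet_subset hd
    obtain ⟨h3, h4⟩ := h.flat_right c ((key2 c hc h1 h2).1 hd)
    have hT : ∀ w ∈ Prod.snd '' tangentVecs (cuspSet Prod.snd C) c, fderiv ℝ χR c.2 w ∈
        Prod.snd '' tangentVecs (cuspSet Prod.snd (FlatCusp.conjugate χL χR C))
          (χL c.1, χR c.2) := by
      rintro _ ⟨w, hw, rfl⟩
      exact ⟨_, tangentVecs_conjugate hLs hRs h1 h2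
        (fun d hd hd1 hd2 => (key2 d (cuspSet_subset hd) hd1 hd2).2 hd) hw, rfl⟩
    exact ⟨hR.isCoisotropic h2 hT h3, hR.isNonradial h2 hT h4⟩

theorem FlatRel.mem_cuspSet_conjugate (h : FlatRel C) (hL : IsHomogCanonical χL)
    (hR : IsHomogCanonical χR) (hc : c ∈ C) (h1 : c.1 ∈ χL.source) (h2 : c.2 ∈ χR.source) :
    (χL c.1, χR c.2) ∈ cuspSet Prod.fst (FlatCusp.conjugate χL χR C) ↔
      c ∈ cuspSet Prod.fst C := by
  obtain ⟨γ, O, hγ, -⟩ := h.canonical.lagrangian c hc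
  exact mem_cuspSet_conjugate_left hL.isSmoothHomeo hR.isSmoothHomeo hγ h1 h2

end Flat

/-! ### The cusp set as a submanifold -/

section CuspGerm

variable {E : Type*} [NormedAddCommGroup E] [NormedSpace ℝ E] [FiniteDimensional ℝ E]

/-- If the kernel of `A p` is spanned by `v p`, then nearby kernels which contain `v q` are spanned
by it. -/
theorem eventually_ker_span {F : Type*} [NormedAddCommGroup F] [NormedSpace ℝ F]
    {A : E → E →L[ℝ] F} {v : E → E} {p : E} (hA : ContinuousAt A p) (hv : ContinuousAt v p)
    (hvp : v p ≠ 0) (hker : ∀ w, A p w = 0 → ∃ r : ℝ, w = r • v p) :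
    ∀ᶠ q in 𝓝 p, A q (v q) = 0 → ∀ w, A q w = 0 → ∃ r : ℝ, w = r • v q := by
  obtain ⟨l, -, hl⟩ := exists_dual_vector ℝ (v p) (norm_ne_zero_iff.2 hvp)
  have hlv : l (v p) ≠ 0 := by rw [hl]; simpa using hvp
  have hB : ContinuousAt (fun q => (A q).prod l) p :=
    (ContinuousLinearMap.prodL (𝕜 := ℝ) (S := ℝ) (E := E) (F := F) (G := ℝ)).continuous.continuousAt.comp
      (hA.prodMk (continuousAt_const (y := l)))
  have hinj : Function.Injective ((A p).prod l) := by
    rw [injective_iff_map_eq_zero]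
    intro w hw
    have h1 : A p w = 0 := congrArg Prod.fst hw
    have h2 : l w = 0 := congrArg Prod.snd hw
    obtain ⟨r, rfl⟩ := hker w h1
    rw [map_smul, smul_eq_mul, mul_eq_zero, or_iff_left hlv] at h2
    rw [h2, zero_smul]
  have hopen : ∀ᶠ q in 𝓝 p, Function.Injective ((A q).prod l) :=
    hB.eventually (ContinuousLinearMap.isOpen_injective.mem_nhds hinj)
  have hlq : ∀ᶠ q in 𝓝 p, l (v q) ≠ 0 :=
    (l.continuous.continuousAt.comp hv).eventually_ne hlv
  filter_upwards [hopen, hlq] with q h1 h2 hvq w hw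
  refine ⟨l w / l (v q), ?_⟩
  rw [← sub_eq_zero]
  refine (injective_iff_map_eq_zero _).1 h1 _ (Prod.ext ?_ ?_)
  · change A q _ = 0
    rw [map_sub, map_smul, hw, hvq, smul_zero, sub_zero]
  · change l _ = 0
    rw [map_sub, map_smul, smul_eq_mul, div_mul_cancel₀ _ h2, sub_self]

/-- Near a cusp there is a smooth kernel field `v`, and the cusp set is cut out by the Jacobian and
its derivative along `v`, which are independent there. -/
theorem IsCusp.exists_germ {f : E → E} {p : E} (hf : SmoothNear f p) (h : IsCusp f p) :
    ∃ v : E → E, SmoothNear v p ∧ (∀ᶠ q in 𝓝 p, v q ≠ 0) ∧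
      (∀ᶠ q in 𝓝 p, IsCusp f q ↔ jac f q = 0 ∧ fderiv ℝ (jac f) q (v q) = 0) ∧
      (∀ᶠ q in 𝓝 p, jac f q = 0 → fderiv ℝ f q (v q) = 0 ∧
        ∀ w, fderiv ℝ f q w = 0 → ∃ r : ℝ, w = r • v q) ∧
      fderiv ℝ (jac f) p ≠ 0 ∧ fderiv ℝ (jac f) p (v p) = 0 ∧
      fderiv ℝ (fun q => fderiv ℝ (jac f) q (v q)) p (v p) ≠ 0 := by
  obtain ⟨hrank, hker, N, v, hN, hpN, hv, hvp, hvker, hvd⟩ := h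
  have hJ0 := jac_eq_zero_of_rank hrank
  have hvS : SmoothNear v p := ContDiffOn.smoothNear hv hN hpN
  have hspan : ∀ w, fderiv ℝ f p w = 0 → ∃ r : ℝ, w = r • v p := by
    have hdim : Module.finrank ℝ (LinearMap.ker (fderiv ℝ f p).toLinearMap) = 1 := by
      have := LinearMap.finrank_range_add_finrank_ker (fderiv ℝ f p).toLinearMap
      have := hrank.1
      omega
    intro w hw
    obtain ⟨r, hr⟩ := (finrank_eq_one_iff_of_nonzero' (⟨v p, hvker p hpN hJ0⟩ :
      LinearMap.ker (fderiv ℝ f p).toLinearMap) (by simpa [Subtype.ext_iff] using hvp)).1 hdim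
      ⟨w, hw⟩
    exact ⟨r, (congrArg Subtype.val hr).symm⟩
  have hv0 : ∀ᶠ q in 𝓝 p, v q ≠ 0 := hvS.continuousAt.eventually_ne hvp
  have hkerq : ∀ᶠ q in 𝓝 p, jac f q = 0 → fderiv ℝ f q (v q) = 0 ∧
        ∀ w, fderiv ℝ f q w = 0 → ∃ r : ℝ, w = r • v q := by
    filter_upwards [eventually_ker_span hf.fderiv.continuousAt hvS.continuousAt hvp hspan,
      hN.mem_nhds hpN] with q h1 h2 h3
    exact ⟨hvker q h2 h3, h1 (hvker q h2 h3)⟩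
  have hhS : SmoothNear (fun q => fderiv ℝ (jac f) q (v q)) p := by
    filter_upwards [hf.jac.fderiv, hvS] with q h1 h2 using h1.clm_apply h2
  have hJne : ∀ᶠ q in 𝓝 p, fderiv ℝ (jac f) q ≠ 0 :=
    hf.jac.fderiv.continuousAt.eventually_ne hrank.2
  have hdne : ∀ᶠ q in 𝓝 p, fderiv ℝ (fun q => fderiv ℝ (jac f) q (v q)) q (v q) ≠ 0 :=
    (hhS.fderiv.continuousAt.clm_apply hvS.continuousAt).eventually_ne hvd
  refine ⟨v, hvS, hv0, ?_, hkerq, hrank.2, hker _ (hvker p hpN hJ0), hvd⟩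
  filter_upwards [hv0, hkerq, hN.mem_nhds hpN, hJne, hdne] with q h1 h2 h3 h4 h5
  constructor
  · intro hcusp
    have hq0 := jac_eq_zero_of_rank hcusp.1
    exact ⟨hq0, hcusp.2.1 _ (h2 hq0).1⟩
  · rintro ⟨hq0, hq1⟩
    obtain ⟨h6, h7⟩ := h2 hq0
    refine ⟨⟨?_, h4⟩, fun w hw => ?_, N, v, hN, h3, hv, h1, hvker, h5⟩
    · have hdim : Module.finrank ℝ (LinearMap.ker (fderiv ℝ f q).toLinearMap) = 1 := by
        refine (finrank_eq_one_iff_of_nonzero' (⟨v q, h6⟩ :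
          LinearMap.ker (fderiv ℝ f q).toLinearMap) (by simpa [Subtype.ext_iff] using h1)).2 ?_
        rintro ⟨w, hw⟩
        obtain ⟨r, hr⟩ := h7 w hw
        exact ⟨r, Subtype.ext hr.symm⟩
      have := LinearMap.finrank_range_add_finrank_ker (fderiv ℝ f q).toLinearMap
      omega
    · obtain ⟨r, rfl⟩ := h7 w hw
      rw [map_smul, hq1, smul_zero]

/-- A function which vanishes where the independent functions `J`, `h` do has a differential in the
span of `dJ` and `dh`. -/
theorem fderiv_eq_zero_of_vanishing {J h g : E → ℝ} {p : E} (hJ : SmoothNear J p)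
    (hh : SmoothNear h p) (hg : SmoothNear g p) (hJ0 : J p = 0) (hh0 : h p = 0)
    (hsurj : ∀ a b : ℝ, ∃ w, fderiv ℝ J p w = a ∧ fderiv ℝ h p w = b)
    (hg0 : ∀ᶠ q in 𝓝 p, J q = 0 → h q = 0 → g q = 0) {w : E} (hw : fderiv ℝ J p w = 0)
    (hw' : fderiv ℝ h p w = 0) : fderiv ℝ g p w = 0 := by
  have : CompleteSpace E := FiniteDimensional.complete ℝ E
  have hs : ∀ {k : E → ℝ}, SmoothNear k p → HasStrictFDerivAt k (fderiv ℝ k p) p := fun hk =>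
    hk.contDiffAt.hasStrictFDerivAt (by simp)
  have hext : IsLocalExtrOn g {q | (J q, h q) = (J p, h p)} p := by
    left
    change ∀ᶠ q in 𝓝[_] p, _
    filter_upwards [nhdsWithin_le_nhds hg0, self_mem_nhdsWithin] with q h1 h2
    have h3 : J q = 0 := (congrArg Prod.fst h2).trans hJ0
    have h4 : h q = 0 := (congrArg Prod.snd h2).trans hh0
    rw [h1 h3 h4, hg0.self_of_nhds hJ0 hh0]
  obtain ⟨Λ, Λ₀, hne, hΛ⟩ := hext.exists_linear_map_of_hasStrictFDerivAt
    ((hs hJ).prodMk (hs hh)) (hs hg)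
  have hΛ₀ : Λ₀ ≠ 0 := by
    rintro rfl
    apply hne
    refine Prod.ext (LinearMap.ext fun ab => ?_) rfl
    obtain ⟨w, h1, h2⟩ := hsurj ab.1 ab.2
    have := hΛ w
    simpa [h1, h2] using this
  have := hΛ w
  simpa [hw, hw', hΛ₀, ← Prod.zero_eq_mk] using this

end CuspGerm

/-! ### Tangent spaces of the cusp set -/

section CuspData

variable {C : Set (Phase × Phase)} {c : Phase × Phase} {γ : Phase → Phase × Phase}
  {O : Set Phase} {J h : Phase → ℝ} {v : Phase → Phase} {p : Phase}
  {χL χR : OpenPartialHomeomorph Phase Phase}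

theorem fderiv_fst_comp (hγ : DifferentiableAt ℝ γ p) (w : Phase) :
    fderiv ℝ (Prod.fst ∘ γ) p w = (fderiv ℝ γ p w).1 := by
  have : HasFDerivAt (Prod.fst ∘ γ) _ p := hγ.hasFDerivAt.fst
  rw [this.fderiv]; rfl

theorem fderiv_snd_comp (hγ : DifferentiableAt ℝ γ p) (w : Phase) :
    fderiv ℝ (Prod.snd ∘ γ) p w = (fderiv ℝ γ p w).2 := by
  have : HasFDerivAt (Prod.snd ∘ γ) _ p := hγ.hasFDerivAt.snd
  rw [this.fderiv]; rfl

/-- In the parametrization `γ` of `C`, the cusp set is cut out by the independent functions `J` and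
`h`, both projections are immersions of it, and along it `ker dπ_L` is spanned by `v`. -/
structure CuspData (C : Set (Phase × Phase)) (c : Phase × Phase) (γ : Phase → Phase × Phase)
    (O : Set Phase) (J h : Phase → ℝ) (v : Phase → Phase) : Prop where
  param : IsLocalParam C c γ O
  smooth_J : SmoothNear J 0
  smooth_h : SmoothNear h 0
  smooth_v : SmoothNear v 0
  J_zero : J 0 = 0
  h_zero : h 0 = 0
  mem : ∀ᶠ q in 𝓝 0, γ q ∈ cuspSet Prod.fst C ↔ J q = 0 ∧ h q = 0
  surj : ∀ a b : ℝ, ∃ w, fderiv ℝ J 0 w = a ∧ fderiv ℝ h 0 w = b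
  left : ∀ w, fderiv ℝ J 0 w = 0 → fderiv ℝ h 0 w = 0 → (fderiv ℝ γ 0 w).1 = 0 → w = 0
  right : ∀ w, fderiv ℝ J 0 w = 0 → fderiv ℝ h 0 w = 0 → (fderiv ℝ γ 0 w).2 = 0 → w = 0
  ker : ∀ᶠ q in 𝓝 0, v q ≠ 0 ∧ (J q = 0 → h q = 0 → (fderiv ℝ γ q (v q)).1 = 0 ∧
    ∀ w, (fderiv ℝ γ q w).1 = 0 → ∃ r : ℝ, w = r • v q)

/-- The cusp set is a manifold of codimension two in `C`. As it is the cusp set of both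
projections, and neither kernel is tangent to the cusp set of its own projection, both projections
are immersions of it. -/
theorem FlatRel.exists_cuspData (hC : FlatRel C) (hc : c ∈ cuspSet Prod.fst C) :
    ∃ γ O J h v, CuspData C c γ O J h v := by
  obtain ⟨γ, O, hγ, -⟩ := hC.canonical.lagrangian c (cuspSet_subset hc)
  have hOn : ∀ᶠ q in 𝓝 (0 : Phase), q ∈ O := hγ.isOpen.mem_nhds hγ.zero_mem
  have hs := hγ.smoothNear hγ.zero_mem
  have hsL : SmoothNear (Prod.fst ∘ γ) 0 := (ContDiff.smoothNear contDiff_fst _).comp hs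
  have hsR : SmoothNear (Prod.snd ∘ γ) 0 := (ContDiff.smoothNear contDiff_snd _).comp hs
  have hcL : IsCusp (Prod.fst ∘ γ) 0 :=
    (mem_cuspSet_iff contDiff_fst hγ hγ.zero_mem).1 (by rwa [hγ.map_zero])
  have hcR : IsCusp (Prod.snd ∘ γ) 0 :=
    (mem_cuspSet_iff contDiff_snd hγ hγ.zero_mem).1 (by rwa [hγ.map_zero, ← hC.cuspSet_eq])
  obtain ⟨v, hv, hv0, hcusp, hker, hJ, hJv, hhv⟩ := hcL.exists_germ hsL
  obtain ⟨v', hv', -, hcusp', hker', -, hJv', hhv'⟩ := hcR.exists_germ hsR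
  set J := jac (Prod.fst ∘ γ) with hJdef
  set h : Phase → ℝ := fun q => fderiv ℝ J q (v q) with hhdef
  set h' : Phase → ℝ := fun q => fderiv ℝ (jac (Prod.snd ∘ γ)) q (v' q) with hhdef'
  have hJs : SmoothNear J 0 := hsL.jac
  have hhs : SmoothNear h 0 := by
    filter_upwards [hJs.fderiv, hv] with q h1 h2 using h1.clm_apply h2
  have hhs' : SmoothNear h' 0 := by
    filter_upwards [hsR.jac.fderiv, hv'] with q h1 h2 using h1.clm_apply h2
  have hJ0 : J 0 = 0 := jac_eq_zero_of_rank hcL.1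
  have hmem : ∀ᶠ q in 𝓝 0, γ q ∈ cuspSet Prod.fst C ↔ J q = 0 ∧ h q = 0 := by
    filter_upwards [hOn, hcusp] with q h1 h2
    rw [mem_cuspSet_iff contDiff_fst hγ h1, h2]
  have hsurj : ∀ a b : ℝ, ∃ w, fderiv ℝ J 0 w = a ∧ fderiv ℝ h 0 w = b := by
    intro a b
    obtain ⟨w, hw⟩ : ∃ w, fderiv ℝ J 0 w ≠ 0 := by
      by_contra! h0
      exact hJ (ContinuousLinearMap.ext h0)
    refine ⟨(a / fderiv ℝ J 0 w) • w +
      ((b - a / fderiv ℝ J 0 w * fderiv ℝ h 0 w) / fderiv ℝ h 0 (v 0)) • v 0, ?_, ?_⟩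
    · simp [hJv, hw]
    · simp [hhv]
  refine ⟨γ, O, J, h, v, hγ, hJs, hhs, hv, hJ0, hJv, hmem, hsurj, ?_, ?_, ?_⟩
  · intro w _ h2 h3
    obtain ⟨r, rfl⟩ := (hker.self_of_nhds hJ0).2 w (by rwa [fderiv_fst_comp hs.differentiableAt])
    rw [map_smul, smul_eq_mul, mul_eq_zero, or_iff_left hhv] at h2
    rw [h2, zero_smul]
  · intro w h1 h2 h3
    obtain ⟨r, rfl⟩ := (hker'.self_of_nhds (jac_eq_zero_of_rank hcR.1)).2 w
      (by rwa [fderiv_snd_comp hs.differentiableAt])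
    have h4 := fderiv_eq_zero_of_vanishing hJs hhs hhs' hJ0 hJv hsurj (by
      filter_upwards [hmem, hOn, hcusp'] with q h5 h6 h7 h8 h9
      have h10 := h5.2 ⟨h8, h9⟩
      rw [hC.cuspSet_eq, mem_cuspSet_iff contDiff_snd hγ h6, h7] at h10
      exact h10.2) h1 h2
    rw [map_smul, smul_eq_mul, mul_eq_zero, or_iff_left hhv'] at h4
    rw [h4, zero_smul]
  · filter_upwards [hv0, hker, hs] with q h1 h2 h3
    refine ⟨h1, fun h4 _ => ?_⟩
    have h5 := h3.differentiableAt (by simp)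
    obtain ⟨h6, h7⟩ := h2 h4
    rw [fderiv_fst_comp h5] at h6
    exact ⟨h6, fun w hw => h7 w (by rwa [fderiv_fst_comp h5])⟩

theorem fderiv_conjugate (hL : IsSmoothHomeo χL) (hR : IsSmoothHomeo χR) {q : Phase}
    (hγ : DifferentiableAt ℝ γ q) (h1 : (γ q).1 ∈ χL.source) (h2 : (γ q).2 ∈ χR.source)
    (w : Phase) : fderiv ℝ (fun q => (χL (γ q).1, χR (γ q).2)) q w =
      (fderiv ℝ χL (γ q).1 (fderiv ℝ γ q w).1, fderiv ℝ χR (γ q).2 (fderiv ℝ γ q w).2) := by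
  have d1 := (hL.smoothNear h1).differentiableAt.hasFDerivAt.comp q hγ.hasFDerivAt.fst
  have d2 := (hR.smoothNear h2).differentiableAt.hasFDerivAt.comp q hγ.hasFDerivAt.snd
  have d3 : fderiv ℝ (fun q => (χL (γ q).1, χR (γ q).2)) q = _ := (d1.prodMk d2).fderiv
  rw [d3]; rfl

theorem IsSmoothHomeo.fderiv_eq_zero_iff {E : Type*} [NormedAddCommGroup E] [NormedSpace ℝ E]
    {χ : OpenPartialHomeomorph E E} (h : IsSmoothHomeo χ) {a : E} (ha : a ∈ χ.source) (w : E) :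
    fderiv ℝ χ a w = 0 ↔ w = 0 := by
  refine ⟨fun h0 => ?_, fun h0 => by rw [h0, map_zero]⟩
  rw [← h.fderiv_symm_fderiv ha w, h0, map_zero]

theorem CuspData.conjugate (hC : FlatRel C) (hD : CuspData C c γ O J h v)
    (hL : IsHomogCanonical χL) (hR : IsHomogCanonical χR) (h1 : c.1 ∈ χL.source)
    (h2 : c.2 ∈ χR.source) :
    CuspData (conjugate χL χR C) (χL c.1, χR c.2) (fun q => (χL (γ q).1, χR (γ q).2))
      {q ∈ O | (γ q).1 ∈ χL.source ∧ (γ q).2 ∈ χR.source} J h v := by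
  have hLs := hL.isSmoothHomeo
  have hRs := hR.isSmoothHomeo
  have hp := hD.param.conjugate hLs hRs h1 h2
  have hs := hD.param.smoothNear hD.param.zero_mem
  have hd0 := fderiv_conjugate hLs hRs hs.differentiableAt (hD.param.map_zero ▸ h1)
    (hD.param.map_zero ▸ h2)
  have hOn := hp.isOpen.mem_nhds hp.zero_mem
  refine ⟨hp, hD.smooth_J, hD.smooth_h, hD.smooth_v, hD.J_zero, hD.h_zero, ?_, hD.surj, ?_, ?_, ?_⟩
  · filter_upwards [hD.mem, hOn] with q h3 h4
    rw [← h3]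
    exact hC.mem_cuspSet_conjugate hL hR (hD.param.mem h4.1) h4.2.1 h4.2.2
  · intro w h3 h4 h5
    rw [hd0] at h5
    refine hD.left w h3 h4 ((hLs.fderiv_eq_zero_iff (hD.param.map_zero ▸ h1) _).1 h5)
  · intro w h3 h4 h5
    rw [hd0] at h5
    refine hD.right w h3 h4 ((hRs.fderiv_eq_zero_iff (hD.param.map_zero ▸ h2) _).1 h5)
  · filter_upwards [hD.ker, hOn] with q h3 h4
    refine ⟨h3.1, fun h5 h6 => ?_⟩
    obtain ⟨h7, h8⟩ := h3.2 h5 h6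
    have hd := fderiv_conjugate hLs hRs (hD.param.smoothNear h4.1).differentiableAt h4.2.1 h4.2.2
    refine ⟨by rw [hd, h7, map_zero], fun w hw => h8 w ?_⟩
    rw [hd] at hw
    exact (hLs.fderiv_eq_zero_iff h4.2.1 _).1 hw

/-- The tangent space of the cusp set in parameter space. -/
def cuspTangent (J h : Phase → ℝ) : Submodule ℝ Phase :=
  LinearMap.ker (fderiv ℝ J 0).toLinearMap ⊓ LinearMap.ker (fderiv ℝ h 0).toLinearMap

theorem CuspData.finrank_cuspTangent (hD : CuspData C c γ O J h v) :
    Module.finrank ℝ (cuspTangent J h) = 4 := by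
  have h1 := LinearMap.finrank_range_add_finrank_ker
    ((fderiv ℝ J 0).toLinearMap.prod (fderiv ℝ h 0).toLinearMap)
  have h2 : LinearMap.range ((fderiv ℝ J 0).toLinearMap.prod (fderiv ℝ h 0).toLinearMap) = ⊤ := by
    rw [LinearMap.range_eq_top]
    rintro ⟨a, b⟩
    obtain ⟨w, h3, h4⟩ := hD.surj a b
    exact ⟨w, Prod.ext h3 h4⟩
  rw [h2, LinearMap.ker_prod, finrank_top] at h1
  simp only [Module.finrank_prod, Module.finrank_self, finrank_euclideanSpace_fin] at h1
  change _ + Module.finrank ℝ (cuspTangent J h) = _ at h1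
  omega

theorem CuspData.exists_of_mem_tangentVecs (hD : CuspData C c γ O J h v) {w : Phase × Phase}
    (hw : w ∈ tangentVecs (cuspSet Prod.fst C) c) :
    ∃ u ∈ cuspTangent J h, fderiv ℝ γ 0 u = w := by
  obtain ⟨s, hs, hs0, hsA, rfl⟩ := hD.param.exists_curve hD.param.zero_mem cuspSet_subset
    (by rwa [hD.param.map_zero])
  have key : ∀ {k : Phase → ℝ}, SmoothNear k 0 → (∀ᶠ t in 𝓝 0, k (s t) = 0) →
      fderiv ℝ k 0 (deriv s 0) = 0 := by
    intro k hk hk0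
    have h1 : HasFDerivAt k (fderiv ℝ k 0) (s 0) := by
      rw [hs0]; exact hk.differentiableAt.hasFDerivAt
    refine (h1.comp_hasDerivAt 0 (hs.differentiableAt (by simp)).hasDerivAt).unique ?_
    exact (hasDerivAt_const (0 : ℝ) (0 : ℝ)).congr_of_eventuallyEq hk0
  have hst : Tendsto s (𝓝 0) (𝓝 0) := by
    have := hs.continuousAt.tendsto
    rwa [hs0] at this
  have hmem : ∀ᶠ t in 𝓝 0, J (s t) = 0 ∧ h (s t) = 0 := by
    filter_upwards [hst.eventually hD.mem, hsA] with t h1 h2 using h1.1 h2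
  exact ⟨_, ⟨key hD.smooth_J (hmem.mono fun _ h => h.1), key hD.smooth_h (hmem.mono fun _ h => h.2)⟩,
    rfl⟩

theorem FlatRel.dil_mem_cuspSet (hC : FlatRel C) (hc : c ∈ cuspSet Prod.fst C) {t : ℝ}
    (ht : 0 < t) : dil₂ t c ∈ cuspSet Prod.fst C :=
  (dil_mem_cuspSet_iff hC.canonical (cuspSet_subset hc) ht).2 hc

theorem CuspData.mem_cuspSet (hD : CuspData C c γ O J h v) : c ∈ cuspSet Prod.fst C := by
  have := hD.mem.self_of_nhds.2 ⟨hD.J_zero, hD.h_zero⟩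
  rwa [hD.param.map_zero] at this

/-- The radial vector is tangent to the cusp set. -/
theorem CuspData.exists_radial (hC : FlatRel C) (hD : CuspData C c γ O J h v) :
    ∃ u ∈ cuspTangent J h, fderiv ℝ γ 0 u = radial c :=
  hD.exists_of_mem_tangentVecs (radial_mem_tangentVecs
    (fun _ hc _ ht => hC.dil_mem_cuspSet hc ht) hD.mem_cuspSet)

theorem IsCoisotropic.mono {T T' : Set Phase} (h : IsCoisotropic T) (hT : T ⊆ T') :
    IsCoisotropic T' := fun u hu => hT (h u fun w hw => hu w (hT hw))

theorem IsNonradial.mono {a : Phase} {T T' : Set Phase} (h : IsNonradial a T) (hT : T ⊆ T') :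
    IsNonradial a T' := fun h0 => h fun w hw => h0 w (hT hw)

/-- The image in `T*X` of the tangent space of the cusp set. -/
def leftTangent (γ : Phase → Phase × Phase) (J h : Phase → ℝ) : Submodule ℝ Phase :=
  (cuspTangent J h).map (LinearMap.fst ℝ Phase Phase ∘ₗ (fderiv ℝ γ 0).toLinearMap)

/-- The image in `T*Y` of the tangent space of the cusp set. -/
def rightTangent (γ : Phase → Phase × Phase) (J h : Phase → ℝ) : Submodule ℝ Phase :=
  (cuspTangent J h).map (LinearMap.snd ℝ Phase Phase ∘ₗ (fderiv ℝ γ 0).toLinearMap)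

/-- A four dimensional coisotropic subspace of `T_a(T*ℝ³)` which contains the radial vector, but
not in its orthogonal. -/
structure IsFlatSpace (a : Phase) (T : Submodule ℝ Phase) : Prop where
  finrank_eq : Module.finrank ℝ T = 4
  coisotropic : IsCoisotropic (T : Set Phase)
  nonradial : IsNonradial a (T : Set Phase)
  radial_mem : ((0 : V3), a.2) ∈ T

theorem finrank_map_of_injective {E F : Type*} [AddCommGroup E] [Module ℝ E] [AddCommGroup F]
    [Module ℝ F] (f : E →ₗ[ℝ] F) (p : Submodule ℝ E) (hf : ∀ w ∈ p, f w = 0 → w = 0) :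
    Module.finrank ℝ (p.map f) = Module.finrank ℝ p := by
  rw [← LinearMap.range_domRestrict]
  refine LinearMap.finrank_range_of_inj ((injective_iff_map_eq_zero _).2 fun w hw => ?_)
  exact Subtype.ext (hf w w.2 hw)

theorem CuspData.isFlatSpace_left (hC : FlatRel C) (hD : CuspData C c γ O J h v) :
    IsFlatSpace c.1 (leftTangent γ J h) := by
  have hT : Prod.fst '' tangentVecs (cuspSet Prod.fst C) c ⊆ (leftTangent γ J h : Set Phase) := by
    rintro _ ⟨w, hw, rfl⟩
    obtain ⟨u, hu, rfl⟩ := hD.exists_of_mem_tangentVecs hw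
    exact ⟨u, hu, rfl⟩
  obtain ⟨h1, h2⟩ := hC.flat_left c hD.mem_cuspSet
  refine ⟨?_, h1.mono hT, h2.mono hT, ?_⟩
  · exact (finrank_map_of_injective _ (cuspTangent J h) fun w hw h0 =>
      hD.left w hw.1 hw.2 h0).trans
      hD.finrank_cuspTangent
  · obtain ⟨u, hu, hur⟩ := hD.exists_radial hC
    exact ⟨u, hu, congrArg Prod.fst hur⟩

theorem CuspData.isFlatSpace_right (hC : FlatRel C) (hD : CuspData C c γ O J h v) :
    IsFlatSpace c.2 (rightTangent γ J h) := by
  have hT : Prod.snd '' tangentVecs (cuspSet Prod.fst C) c ⊆ (rightTangent γ J h : Set Phase) := by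
    rintro _ ⟨w, hw, rfl⟩
    obtain ⟨u, hu, rfl⟩ := hD.exists_of_mem_tangentVecs hw
    exact ⟨u, hu, rfl⟩
  obtain ⟨h1, h2⟩ := hC.flat_right c (hC.cuspSet_eq ▸ hD.mem_cuspSet)
  rw [← hC.cuspSet_eq] at h1 h2
  refine ⟨?_, h1.mono hT, h2.mono hT, ?_⟩
  · exact (finrank_map_of_injective _ (cuspTangent J h) fun w hw h0 =>
      hD.right w hw.1 hw.2 h0).trans
      hD.finrank_cuspTangent
  · obtain ⟨u, hu, hur⟩ := hD.exists_radial hC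
    exact ⟨u, hu, congrArg Prod.snd hur⟩

end CuspData

/-! ### Making the cusp set transversal to the fibres -/

section Transversal

variable {a : Phase} {T : Submodule ℝ Phase}

/-- The symplectic form as a bilinear form. -/
def sympForm : LinearMap.BilinForm ℝ Phase :=
  LinearMap.mk₂ ℝ symp
    (fun a b c => by simp only [symp_eq, Prod.fst_add, Prod.snd_add, inner_add_left]; ring)
    (fun r a b => by
      simp only [symp_eq, Prod.smul_fst, Prod.smul_snd, real_inner_smul_left, smul_eq_mul]; ring)
    (fun a b c => by simp only [symp_eq, Prod.fst_add, Prod.snd_add, inner_add_right]; ring)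
    (fun r a b => by
      simp only [symp_eq, Prod.smul_fst, Prod.smul_snd, real_inner_smul_right, smul_eq_mul]; ring)

theorem sympForm_apply (a b : Phase) : sympForm a b = symp a b := rfl

theorem symp_swap (a b : Phase) : symp a b = - symp b a := by
  rw [symp_eq, symp_eq, real_inner_comm b.1, real_inner_comm b.2]; ring

theorem eq_zero_of_symp_eq_zero (h : ∀ b, symp a b = 0) : a = 0 := by
  have h1 := h (a.2, -a.1)
  rw [symp_eq] at h1
  simp only [inner_neg_right, sub_neg_eq_add, real_inner_self_eq_norm_sq] at h1
  have h2 : ‖a.1‖ = 0 := by nlinarith [sq_nonneg ‖a.1‖, sq_nonneg ‖a.2‖]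
  have h3 : ‖a.2‖ = 0 := by nlinarith [sq_nonneg ‖a.1‖, sq_nonneg ‖a.2‖]
  exact Prod.ext (norm_eq_zero.1 h2) (norm_eq_zero.1 h3)

theorem nondegenerate_sympForm : sympForm.Nondegenerate := by
  refine ⟨fun a h => eq_zero_of_symp_eq_zero h, fun a h => eq_zero_of_symp_eq_zero fun b => ?_⟩
  rw [symp_swap, ← sympForm_apply, h, neg_zero]

/-- The tangent vectors in `T` orthogonal to the radial vector form an isotropic space: it is
spanned by the orthogonal of `T` and the radial vector. -/
theorem IsFlatSpace.symp_eq_zero (hT : IsFlatSpace a T) {w w' : Phase} (hw : w ∈ T) (hw' : w' ∈ T)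
    (h : symp ((0 : V3), a.2) w = 0) (h' : symp ((0 : V3), a.2) w' = 0) : symp w w' = 0 := by
  set R : Phase := ((0 : V3), a.2) with hR
  have hL : sympForm.orthogonal T ≤ T := fun u hu => hT.coisotropic u fun w hw => by
    rw [symp_swap, ← sympForm_apply, hu w hw, neg_zero]
  have hRL : R ∉ sympForm.orthogonal T := fun h0 => hT.nonradial fun w hw => by
    rw [symp_swap, ← sympForm_apply, h0 w hw, neg_zero]
  have hdL := LinearMap.BilinForm.finrank_orthogonal nondegenerate_sympForm T
  rw [hT.finrank_eq] at hdL
  simp only [Module.finrank_prod, finrank_euclideanSpace_fin] at hdL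
  set K : Submodule ℝ Phase := T ⊓ sympForm.orthogonal (Submodule.span ℝ {R}) with hK
  have hmemK : ∀ {u}, u ∈ K ↔ u ∈ T ∧ symp R u = 0 := by
    intro u
    rw [hK, Submodule.mem_inf, LinearMap.BilinForm.mem_orthogonal_iff]
    refine and_congr_right fun _ => ⟨fun h0 => h0 R (Submodule.mem_span_singleton_self R), ?_⟩
    intro h0 n hn
    obtain ⟨r, rfl⟩ := Submodule.mem_span_singleton.1 hn
    change sympForm (r • R) u = 0
    rw [map_smul, LinearMap.smul_apply, sympForm_apply, h0, smul_zero]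
  have hKlt : K < T := by
    refine lt_of_le_of_ne inf_le_left fun h0 => hT.nonradial fun u hu => ?_
    have hu' : u ∈ K := by rw [h0]; exact hu
    exact (hmemK.1 hu').2
  have hKd : Module.finrank ℝ K < 4 := hT.finrank_eq ▸ Submodule.finrank_lt_finrank_of_lt hKlt
  have hRK : R ∈ K := hmemK.2 ⟨hT.radial_mem, by simp [symp_eq, hR]⟩
  have hLK : sympForm.orthogonal T ≤ K := fun u hu => hmemK.2 ⟨hL hu, hu R hT.radial_mem⟩
  have hlt : sympForm.orthogonal T < sympForm.orthogonal T ⊔ Submodule.span ℝ {R} := by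
    refine lt_of_le_of_ne le_sup_left fun h0 => hRL ?_
    rw [h0]
    exact Submodule.mem_sup_right (Submodule.mem_span_singleton_self R)
  have hlt' := Submodule.finrank_lt_finrank_of_lt hlt
  have hle : sympForm.orthogonal T ⊔ Submodule.span ℝ {R} ≤ K :=
    sup_le hLK ((Submodule.span_singleton_le_iff_mem _ _).2 hRK)
  have heq := Submodule.eq_of_le_of_finrank_le hle (by omega)
  have hwK : w ∈ sympForm.orthogonal T ⊔ Submodule.span ℝ {R} := by
    rw [heq]; exact hmemK.2 ⟨hw, h⟩
  obtain ⟨l, hl, r, hr, rfl⟩ := Submodule.mem_sup.1 hwK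
  obtain ⟨s, rfl⟩ := Submodule.mem_span_singleton.1 hr
  rw [← sympForm_apply, map_add, LinearMap.add_apply, map_smul, LinearMap.smul_apply,
    sympForm_apply, sympForm_apply, h', smul_zero, add_zero, symp_swap, ← sympForm_apply,
    hl w' hw', neg_zero]

theorem IsFlatSpace.map {χ : OpenPartialHomeomorph Phase Phase} (hT : IsFlatSpace a T)
    (hχ : IsHomogCanonical χ) (ha : a ∈ χ.source) :
    IsFlatSpace (χ a) (T.map (fderiv ℝ χ a).toLinearMap) := by
  have h0 : ∀ w ∈ (T : Set Phase), fderiv ℝ χ a w ∈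
      (T.map (fderiv ℝ χ a).toLinearMap : Set Phase) := fun w hw => ⟨w, hw, rfl⟩
  refine ⟨?_, hχ.isCoisotropic ha h0 hT.coisotropic, hχ.isNonradial ha h0 hT.nonradial,
    ⟨_, hT.radial_mem, hχ.fderiv_radial ha⟩⟩
  exact (finrank_map_of_injective _ _ fun w _ h1 =>
    (hχ.isSmoothHomeo.fderiv_eq_zero_iff ha w).1 h1).trans hT.finrank_eq

/-- A suitable shear makes a flat space transversal to the fibre, modulo the radial vector: the
vectors which violate this for three different shears would be orthogonal in a plane. -/
theorem IsFlatSpace.exists_shear (hT : IsFlatSpace (0, basisVec 2) T) :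
    ∃ t : ℝ, ∀ w ∈ T, (fderiv ℝ (shear t) (0, basisVec 2) w).1 = 0 →
      (fderiv ℝ (shear t) (0, basisVec 2) w).2 2 = 0 → w = 0 := by
  by_contra! hne
  have hpos : (0 : ℝ) < ((0, basisVec 2) : Phase).2 2 := by simp [basisVec_apply]
  have key : ∀ t : ℝ, ∃ w ∈ T, w.1 0 = -(t * w.2 0) ∧ w.1 1 = -(t * w.2 1) ∧ w.1 2 = 0 ∧
      w.2 2 = 0 ∧ (w.2 0 ≠ 0 ∨ w.2 1 ≠ 0) := by
    intro t
    obtain ⟨w, hw, h1, h2, h3⟩ := hne t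
    rw [fderiv_shear t hpos] at h1 h2
    rw [(fderiv_shearVec hpos w.2).2 rfl] at h1
    have e0 : w.1 0 = -(t * w.2 0) := by
      have := congrArg (fun u : V3 => u 0) h1
      simp [basisVec_apply] at this
      linarith
    have e1 : w.1 1 = -(t * w.2 1) := by
      have := congrArg (fun u : V3 => u 1) h1
      simp [basisVec_apply] at this
      linarith
    have e2 : w.1 2 = 0 := by
      have := congrArg (fun u : V3 => u 2) h1
      simpa [basisVec_apply] using this
    refine ⟨w, hw, e0, e1, e2, h2, ?_⟩
    by_contra! h4
    refine h3 (Prod.ext ?_ ?_)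
    · ext i; fin_cases i <;> simp [e0, e1, e2, h4.1, h4.2]
    · ext i; fin_cases i <;> simp [h4.1, h4.2]; exact h2
  have horth : ∀ {s t : ℝ} {w w' : Phase}, s ≠ t → w ∈ T → w' ∈ T → w.1 0 = -(s * w.2 0) →
      w.1 1 = -(s * w.2 1) → w.1 2 = 0 → w.2 2 = 0 → w'.1 0 = -(t * w'.2 0) →
      w'.1 1 = -(t * w'.2 1) → w'.1 2 = 0 → w'.2 2 = 0 →
      w.2 0 * w'.2 0 + w.2 1 * w'.2 1 = 0 := by
    intro s t w w' hst hw hw' a0 a1 a2 a3 b0 b1 b2 b3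
    have h0 := hT.symp_eq_zero hw hw' (by simp [symp, basisVec_apply, a2])
      (by simp [symp, basisVec_apply, b2])
    simp only [symp, Fin.sum_univ_three, a0, a1, a2, a3, b0, b1, b2, b3] at h0
    have : (s - t) * (w.2 0 * w'.2 0 + w.2 1 * w'.2 1) = 0 := by linarith
    exact (mul_eq_zero.1 this).resolve_left (sub_ne_zero.2 hst)
  -- the shears for the times `0`, `1`, `2` would give three orthogonal nonzero vectors in a plane
  obtain ⟨u, hu, u0, u1, u2, u3, hu0⟩ := key 0
  obtain ⟨v, hv, v0, v1, v2, v3, hv0⟩ := key 1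
  obtain ⟨w, hw, w0, w1, w2, w3, hw0⟩ := key 2
  have huv := horth (by norm_num) hu hv u0 u1 u2 u3 v0 v1 v2 v3
  have huw := horth (by norm_num) hu hw u0 u1 u2 u3 w0 w1 w2 w3
  have hvw := horth (by norm_num) hv hw v0 v1 v2 v3 w0 w1 w2 w3
  have hsq : ∀ {x y : ℝ}, (x ≠ 0 ∨ y ≠ 0) → 0 < x ^ 2 + y ^ 2 := by
    intro x y hxy
    rcases hxy with h | h <;> positivity
  -- two vectors orthogonal to `v.2` are parallel
  have hpar : u.2 0 * w.2 1 - u.2 1 * w.2 0 = 0 := by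
    have := hsq hv0
    have h1 : (v.2 0 ^ 2 + v.2 1 ^ 2) * (u.2 0 * w.2 1 - u.2 1 * w.2 0) = 0 := by
      linear_combination (v.2 0 * w.2 1 - v.2 1 * w.2 0) * huv +
        (v.2 0 * u.2 1 - v.2 1 * u.2 0) * hvw * (-1)
    exact (mul_eq_zero.1 h1).resolve_left this.ne'
  have h1 : (u.2 0 ^ 2 + u.2 1 ^ 2) * (w.2 0 ^ 2 + w.2 1 ^ 2) = 0 := by
    linear_combination (u.2 0 * w.2 0 + u.2 1 * w.2 1) * huw +
      (u.2 0 * w.2 1 - u.2 1 * w.2 0) * hpar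
  exact (mul_pos (hsq hu0) (hsq hw0)).ne' h1

theorem IsFlatSpace.exists_transversal (hT : IsFlatSpace a T) (ha : a.2 ≠ 0) :
    ∃ χ : OpenPartialHomeomorph Phase Phase, IsHomogCanonical χ ∧ a ∈ χ.source ∧
      χ a = (0, basisVec 2) ∧ ∀ w ∈ T, (fderiv ℝ χ a w).1 = 0 → (fderiv ℝ χ a w).2 2 = 0 →
        w = 0 := by
  obtain ⟨ψ, h, h1, h2⟩ := exists_affine a ha
  have hc := isHomogCanonical_lift h
  obtain ⟨t, ht⟩ := (h2 ▸ hT.map hc h1).exists_shear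
  have hsrc : ((0, basisVec 2) : Phase) ∈ (shear t).source := by
    simp [shear_source, basisVec_apply]
  refine ⟨(lift ψ h).trans (shear t), hc.trans (isHomogCanonical_shear t),
    ⟨h1, by change lift ψ h a ∈ (shear t).source; rwa [h2]⟩, ?_, fun w hw h3 h4 => ?_⟩
  · change shear t (lift ψ h a) = _
    rw [h2, shear_apply]
    simp [shearVec, basisVec_apply]
  · have hd : fderiv ℝ ((lift ψ h).trans (shear t)) a w =
        fderiv ℝ (shear t) (0, basisVec 2) (fderiv ℝ (lift ψ h) a w) := by
      have d1 := (hc.isSmoothHomeo.smoothNear h1).differentiableAt.hasFDerivAt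
      have d2 := ((isHomogCanonical_shear t).isSmoothHomeo.smoothNear
        (show lift ψ h a ∈ (shear t).source by rwa [h2])).differentiableAt.hasFDerivAt
      have d3 : fderiv ℝ ((lift ψ h).trans (shear t)) a = _ := (d2.comp a d1).fderiv
      rw [d3, h2]; rfl
    rw [hd] at h3 h4
    exact (hc.isSmoothHomeo.fderiv_eq_zero_iff h1 w).1 (ht _ ⟨w, hw, rfl⟩ h3 h4)

end Transversal

/-! ### The cusp set as a graph over the base -/

section Section

variable {C : Set (Phase × Phase)} {c : Phase × Phase} {γ : Phase → Phase × Phase}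
  {O : Set Phase} {J h : Phase → ℝ} {v : Phase → Phase}
  {χL χR : OpenPartialHomeomorph Phase Phase}

/-- The point `(0, dx₃; 0, dy₃)`. -/
def basePoint : Phase × Phase := ((0, basisVec 2), (0, basisVec 2))

/-- After canonical transformations, a cusp point becomes `(0, dx₃; 0, dy₃)` and the cusp set is
transversal to the fibres modulo the radial vector, on both sides. -/
theorem FlatRel.exists_transversal (hC : FlatRel C) (hc : c ∈ cuspSet Prod.fst C) :
    ∃ χL χR : OpenPartialHomeomorph Phase Phase, IsHomogCanonical χL ∧ IsHomogCanonical χR ∧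
      c.1 ∈ χL.source ∧ c.2 ∈ χR.source ∧ χL c.1 = (0, basisVec 2) ∧ χR c.2 = (0, basisVec 2) ∧
      ∃ γ O J h v, CuspData (FlatCusp.conjugate χL χR C) basePoint γ O J h v ∧
        (∀ w ∈ cuspTangent J h, (fderiv ℝ γ 0 w).1.1 = 0 → (fderiv ℝ γ 0 w).1.2 2 = 0 → w = 0) ∧
        ∀ w ∈ cuspTangent J h, (fderiv ℝ γ 0 w).2.1 = 0 → (fderiv ℝ γ 0 w).2.2 2 = 0 → w = 0 := by
  obtain ⟨γ, O, J, h, v, hD⟩ := hC.exists_cuspData hc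
  have hne := hC.canonical.ne_zero c (cuspSet_subset hc)
  obtain ⟨χL, hL, h1, h2, h3⟩ := (hD.isFlatSpace_left hC).exists_transversal hne.1
  obtain ⟨χR, hR, h4, h5, h6⟩ := (hD.isFlatSpace_right hC).exists_transversal hne.2
  have hD' := hD.conjugate hC hL hR h1 h4
  have hd := fderiv_conjugate hL.isSmoothHomeo hR.isSmoothHomeo
    (hD.param.smoothNear hD.param.zero_mem).differentiableAt (hD.param.map_zero ▸ h1)
    (hD.param.map_zero ▸ h4)
  rw [h2, h5] at hD'
  refine ⟨χL, χR, hL, hR, h1, h4, h2, h5, _, _, J, h, v, hD', fun w hw h7 h8 => ?_,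
    fun w hw h7 h8 => ?_⟩
  · rw [hd, hD.param.map_zero] at h7 h8
    exact hD.left w hw.1 hw.2 (h3 _ ⟨w, hw, rfl⟩ h7 h8)
  · rw [hd, hD.param.map_zero] at h7 h8
    exact hD.right w hw.1 hw.2 (h6 _ ⟨w, hw, rfl⟩ h7 h8)

theorem IsCanonicalRelation.symp_tangentVecs (hC : IsCanonicalRelation C) (hc : c ∈ C)
    {w w' : Phase × Phase} (hw : w ∈ tangentVecs C c) (hw' : w' ∈ tangentVecs C c) :
    symp w.1 w'.1 = symp w.2 w'.2 := by
  obtain ⟨γ, O, hγ, hs⟩ := hC.lagrangian c hc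
  rw [← hγ.map_zero] at hw hw'
  obtain ⟨s, -, -, -, rfl⟩ := hγ.exists_curve hγ.zero_mem subset_rfl hw
  obtain ⟨s', -, -, -, rfl⟩ := hγ.exists_curve hγ.zero_mem subset_rfl hw'
  exact hs 0 hγ.zero_mem _ _

/-- The points of the cusp set are the positive multiples of the points `p x` over `x`, and along
them the kernel of `dπ_L` projects to the direction of `Z x` in the right base. -/
structure CuspSection (C : Set (Phase × Phase)) (p : V3 → Phase × Phase) (Z : V3 → V3) :
    Prop where
  smooth_p : SmoothNear p 0
  smooth_Z : SmoothNear Z 0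
  p_zero : p 0 = basePoint
  Z_ne_zero : Z 0 ≠ 0
  base : ∀ᶠ x in 𝓝 0, (p x).1.1 = x
  norm : ∀ᶠ x in 𝓝 0, (p x).1.2 2 = 1
  mem : ∀ᶠ x in 𝓝 0, p x ∈ cuspSet Prod.fst C
  cusp_iff : ∀ᶠ d in 𝓝 basePoint, d ∈ cuspSet Prod.fst C ↔ d = dil₂ (d.1.2 2) (p d.1.1)
  inner_eq : ∀ᶠ x in 𝓝 0, ∀ u, inner ℝ (p x).1.2 u =
    inner ℝ (p x).2.2 (fderiv ℝ (fun x => (p x).2.1) x u)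
  injective : ∀ u, fderiv ℝ (fun x => (p x).2.1) 0 u = 0 → u = 0
  inner_Z : ∀ᶠ x in 𝓝 0, inner ℝ (p x).2.2 (Z x) = 0
  ker : ∀ᶠ x in 𝓝 0, ∀ w ∈ tangentVecs C (p x), w.1 = 0 → ∃ r : ℝ, w.2.1 = r • Z x

theorem dil₂_dil₂ (s t : ℝ) (d : Phase × Phase) : dil₂ s (dil₂ t d) = dil₂ (s * t) d := by
  simp [dil₂, dil, smul_smul]

theorem dil₂_one (d : Phase × Phase) : dil₂ 1 d = d := by simp [dil₂, dil]

/-- By transversality `(x, ξ₃, J, h)` are local coordinates of `C`, so that the part `ξ₃ = 1` of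
the cusp set `J = h = 0` is a graph over `x`; the rest follows by homogeneity. -/
theorem CuspData.exists_section (hC : FlatRel C) (hD : CuspData C basePoint γ O J h v)
    (htL : ∀ w ∈ cuspTangent J h,
      (fderiv ℝ γ 0 w).1.1 = 0 → (fderiv ℝ γ 0 w).1.2 2 = 0 → w = 0) :
    ∃ κ : V3 → Phase, SmoothNear κ 0 ∧ κ 0 = 0 ∧
      (∀ᶠ x in 𝓝 0, J (κ x) = 0 ∧ h (κ x) = 0 ∧ (γ (κ x)).1.1 = x ∧ (γ (κ x)).1.2 2 = 1) ∧
      ∀ᶠ d in 𝓝 basePoint, d ∈ cuspSet Prod.fst C ↔ d = dil₂ (d.1.2 2) (γ (κ d.1.1)) := by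
  have hs := hD.param.smoothNear hD.param.zero_mem
  let ℓ : V3 →L[ℝ] ℝ := EuclideanSpace.proj 2
  let G : Phase → V3 × ℝ × ℝ × ℝ := fun q => ((γ q).1.1, (γ q).1.2 2, J q, h q)
  have hG : SmoothNear G 0 := by
    filter_upwards [hs, hD.smooth_J, hD.smooth_h] with q h1 h2 h3
    exact h1.fst.fst.prodMk (((ℓ.contDiff.contDiffAt).comp q h1.fst.snd).prodMk (h2.prodMk h3))
  have hGd : HasFDerivAt G _ 0 :=
    hs.differentiableAt.hasFDerivAt.fst.fst.prodMk
      ((ℓ.hasFDerivAt.comp 0 hs.differentiableAt.hasFDerivAt.fst.snd).prodMk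
        (hD.smooth_J.differentiableAt.hasFDerivAt.prodMk
          hD.smooth_h.differentiableAt.hasFDerivAt))
  obtain ⟨e, he0, heG, hes, hes'⟩ := hG.exists_openPartialHomeomorph_of_injective
    (by simp) (by
      intro w hw
      rw [hGd.fderiv] at hw
      have h1 : fderiv ℝ J 0 w = 0 := congrArg (fun z : V3 × ℝ × ℝ × ℝ => z.2.2.1) hw
      have h2 : fderiv ℝ h 0 w = 0 := congrArg (fun z : V3 × ℝ × ℝ × ℝ => z.2.2.2) hw
      exact htL w ⟨h1, h2⟩ (congrArg (fun z : V3 × ℝ × ℝ × ℝ => z.1) hw)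
        (congrArg (fun z : V3 × ℝ × ℝ × ℝ => z.2.1) hw))
  have hG0 : e 0 = (0, 1, 0, 0) := by
    simp [heG, G, hD.param.map_zero, basePoint, hD.J_zero, hD.h_zero, basisVec_apply]
  let ι : V3 → V3 × ℝ × ℝ × ℝ := fun x => (x, 1, 0, 0)
  have hι : ContDiff ℝ ∞ ι := contDiff_id.prodMk contDiff_const
  have hιt : ι 0 ∈ e.target := by
    change (0, 1, 0, 0) ∈ e.target
    rw [← hG0]; exact e.map_source he0
  let κ : V3 → Phase := fun x => e.symm (ι x)
  have hκ : SmoothNear κ 0 :=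
    SmoothNear.comp (g := e.symm) (ContDiffOn.smoothNear hes' e.open_target hιt)
      (ContDiff.smoothNear hι 0)
  have hκ0 : κ 0 = 0 := by
    change e.symm (0, 1, 0, 0) = 0
    rw [← hG0, e.left_inv he0]
  have hGκ : ∀ᶠ x in 𝓝 0, G (κ x) = ι x := by
    filter_upwards [hι.continuous.continuousAt.eventually (e.open_target.mem_nhds hιt)] with x hx
    rw [← heG, e.right_inv hx]
  have hcusp : ∀ᶠ x in 𝓝 0, γ (κ x) ∈ cuspSet Prod.fst C := by
    have h1 := hκ.continuousAt.eventually (hκ0.symm ▸ hD.mem)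
    filter_upwards [h1, hGκ] with x h2 h3
    exact h2.2 ⟨congrArg (fun z => z.2.2.1) h3, congrArg (fun z => z.2.2.2) h3⟩
  refine ⟨κ, hκ, hκ0, hGκ.mono fun x hx => ⟨congrArg (fun z => z.2.2.1) hx,
    congrArg (fun z => z.2.2.2) hx, congrArg (fun z => z.1) hx, congrArg (fun z => z.2.1) hx⟩, ?_⟩
  obtain ⟨U, k, hU, hk, hkO, hkC⟩ := hD.param.exists_lift
  have hbU : basePoint ∈ U := hD.param.map_zero ▸ (hkO 0 hD.param.zero_mem).2
  have hk0 : k basePoint = 0 := hD.param.map_zero ▸ (hkO 0 hD.param.zero_mem).1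
  let n : Phase × Phase → Phase × Phase := fun d => dil₂ (d.1.2 2)⁻¹ d
  have hn0 : n basePoint = basePoint := by simp [n, basePoint, dil₂, dil, basisVec_apply]
  have hb2 : basePoint.1.2 2 = 1 := by simp [basePoint, basisVec_apply]
  have hℓ : Continuous fun d : Phase × Phase => d.1.2 2 :=
    ℓ.continuous.comp (continuous_snd.comp continuous_fst)
  have hn : Tendsto n (𝓝 basePoint) (𝓝 basePoint) := by
    have h1 : ContinuousAt (fun d : Phase × Phase => (d.1.2 2)⁻¹) basePoint :=
      hℓ.continuousAt.inv₀ (by rw [hb2]; exact one_ne_zero)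
    have h2 : ContinuousAt n basePoint :=
      (continuous_fst.fst.continuousAt.prodMk (h1.smul continuous_fst.snd.continuousAt)).prodMk
        (continuous_snd.fst.continuousAt.prodMk (h1.smul continuous_snd.snd.continuousAt))
    have h3 := h2.tendsto
    rwa [hn0] at h3
  have hkc : Tendsto k (𝓝 basePoint) (𝓝 0) := by
    have := (hk.continuousOn.continuousAt (hU.mem_nhds hbU)).tendsto
    rwa [hk0] at this
  have hbase : Tendsto (fun d : Phase × Phase => d.1.1) (𝓝 basePoint) (𝓝 0) :=
    continuous_fst.fst.continuousAt
  have hpos : ∀ᶠ d : Phase × Phase in 𝓝 basePoint, 0 < d.1.2 2 :=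
    hℓ.continuousAt.eventually (lt_mem_nhds (by simp only [hb2, one_pos]))
  filter_upwards [hbase.eventually hcusp, hpos, hn.eventually (hU.mem_nhds hbU),
    (hkc.comp hn).eventually hD.mem, (hkc.comp hn).eventually (e.open_source.mem_nhds he0)]
    with d h1 h2 h3 h4 h5
  constructor
  · intro hd
    have hd' : n d ∈ cuspSet Prod.fst C := hC.dil_mem_cuspSet hd (inv_pos.2 h2)
    obtain ⟨-, h6⟩ := hkC (n d) ⟨cuspSet_subset hd', h3⟩
    have h7 := h4.1 (by rw [Function.comp_apply, h6]; exact hd')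
    have h8 : e (k (n d)) = ι d.1.1 := by
      rw [heG]
      simp only [G, h6, ι]
      refine Prod.ext rfl (Prod.ext ?_ (Prod.ext h7.1 h7.2))
      simp [n, dil₂, dil, h2.ne']
    have h9 : κ d.1.1 = k (n d) := by
      change e.symm (ι d.1.1) = _
      rw [← h8]; exact e.left_inv h5
    rw [h9, h6, dil₂_dil₂, mul_inv_cancel₀ h2.ne', dil₂_one]
  · intro hd
    rw [hd]
    exact hC.dil_mem_cuspSet h1 h2

/-- The image of the kernel vector of `dπ_L` under `dπ_R` is symplectically orthogonal to the image
of the cusp set, hence tangent to it by coisotropy, and by the nonradial condition it is not a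
multiple of the radial vector. So its projection `Z` to the base does not vanish. -/
theorem CuspData.exists_cuspSection (hC : FlatRel C) (hD : CuspData C basePoint γ O J h v)
    (htL : ∀ w ∈ cuspTangent J h,
      (fderiv ℝ γ 0 w).1.1 = 0 → (fderiv ℝ γ 0 w).1.2 2 = 0 → w = 0)
    (htR : ∀ w ∈ cuspTangent J h,
      (fderiv ℝ γ 0 w).2.1 = 0 → (fderiv ℝ γ 0 w).2.2 2 = 0 → w = 0) :
    ∃ p Z, CuspSection C p Z := by
  obtain ⟨κ, hκ, hκ0, hκJ, hiff⟩ := hD.exists_section hC htL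
  have hs := hD.param.smoothNear hD.param.zero_mem
  have hs' : SmoothNear γ (κ 0) := by rwa [hκ0]
  have hv' : SmoothNear v (κ 0) := by rw [hκ0]; exact hD.smooth_v
  have hp : SmoothNear (fun x => γ (κ x)) 0 := hs'.comp hκ
  have hκt : Tendsto κ (𝓝 0) (𝓝 0) := by
    have := hκ.continuousAt.tendsto
    rwa [hκ0] at this
  have hOn : ∀ᶠ x in 𝓝 0, κ x ∈ O :=
    hκt.eventually (hD.param.isOpen.mem_nhds hD.param.zero_mem)
  have hker := hκt.eventually hD.ker
  have hmem : ∀ᶠ x in 𝓝 0, γ (κ x) ∈ cuspSet Prod.fst C := by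
    filter_upwards [hκt.eventually hD.mem, hκJ] with x h1 h2
    exact h1.2 ⟨h2.1, h2.2.1⟩
  have hder : ∀ᶠ x in 𝓝 0, ∀ u, fderiv ℝ (fun x => γ (κ x)) x u =
      fderiv ℝ γ (κ x) (fderiv ℝ κ x u) := by
    filter_upwards [hκ, hOn] with x h1 h2 u
    have h3 : HasFDerivAt (fun x => γ (κ x)) _ x :=
      (hD.param.smoothNear h2).differentiableAt.hasFDerivAt.comp x
        (h1.differentiableAt (by simp)).hasFDerivAt
    rw [h3.fderiv]; rfl
  have hbase : ∀ᶠ x in 𝓝 0, (γ (κ x)).1.1 = x := hκJ.mono fun x hx => hx.2.2.1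
  have hderL : ∀ᶠ x in 𝓝 0, ∀ u, (fderiv ℝ (fun x => γ (κ x)) x u).1.1 = u := by
    filter_upwards [hp, hbase.eventually_nhds] with x h1 h2 u
    have h3 := (h1.differentiableAt (by simp)).hasFDerivAt.fst.fst
    have h4 := h3.unique ((hasFDerivAt_id x).congr_of_eventuallyEq h2)
    exact congrArg (fun A : V3 →L[ℝ] V3 => A u) h4
  have hderR : ∀ᶠ x in 𝓝 0, ∀ u, fderiv ℝ (fun x => (γ (κ x)).2.1) x u =
      (fderiv ℝ (fun x => γ (κ x)) x u).2.1 := by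
    filter_upwards [hp] with x h1 u
    have h3 : HasFDerivAt (fun x => (γ (κ x)).2.1) _ x :=
      (h1.differentiableAt (by simp)).hasFDerivAt.snd.fst
    rw [h3.fderiv]; rfl
  have hκT : ∀ u, fderiv ℝ κ 0 u ∈ cuspTangent J h := by
    intro u
    have key : ∀ {k : Phase → ℝ}, SmoothNear k 0 → (∀ᶠ x in 𝓝 0, k (κ x) = 0) →
        fderiv ℝ k 0 (fderiv ℝ κ 0 u) = 0 := by
      intro k hk hk0
      have h1 : HasFDerivAt k (fderiv ℝ k 0) (κ 0) := by
        rw [hκ0]; exact hk.differentiableAt.hasFDerivAt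
      have h2 := (h1.comp 0 hκ.differentiableAt.hasFDerivAt).unique
        ((hasFDerivAt_const (0 : ℝ) (0 : V3)).congr_of_eventuallyEq hk0)
      exact congrArg (fun A : V3 →L[ℝ] ℝ => A u) h2
    exact ⟨key hD.smooth_J (hκJ.mono fun x hx => hx.1),
      key hD.smooth_h (hκJ.mono fun x hx => hx.2.1)⟩
  obtain ⟨ρ, hρ, hρr⟩ := hD.exists_radial hC
  -- modulo the radial vector, tangent vectors with vanishing right base component are zero
  have hrad : ∀ w ∈ cuspTangent J h, (fderiv ℝ γ 0 w).2.1 = 0 →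
      w = ((fderiv ℝ γ 0 w).2.2 2) • ρ := by
    intro w hw h0
    rw [← sub_eq_zero]
    refine htR _ (sub_mem hw (Submodule.smul_mem _ _ hρ)) ?_ ?_
    · rw [map_sub, map_smul, hρr]
      simp [h0, radial]
    · rw [map_sub, map_smul, hρr]
      simp [radial, basePoint, basisVec_apply]
  refine ⟨fun x => γ (κ x), fun x => (fderiv ℝ γ (κ x) (v (κ x))).2.1, hp, ?_,
    by simp only [hκ0, hD.param.map_zero], ?_, hbase,
    hκJ.mono fun x hx => hx.2.2.2, hmem, hiff, ?_, ?_, ?_, ?_⟩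
  · have h1 : SmoothNear (fun q => (fderiv ℝ γ q (v q)).2.1) (κ 0) := by
      filter_upwards [hs'.fderiv, hv'] with q h1 h2 using (h1.clm_apply h2).snd.fst
    exact h1.comp hκ
  · simp only [hκ0]
    intro hZ
    obtain ⟨hv0, hv1⟩ := hD.ker.self_of_nhds
    obtain ⟨hv2, -⟩ := hv1 hD.J_zero hD.h_zero
    have hF := hD.isFlatSpace_right hC
    -- the image of the kernel vector is orthogonal to the tangent space, hence tangent
    have horth : ∀ w ∈ (rightTangent γ J h : Set Phase), symp (fderiv ℝ γ 0 (v 0)).2 w = 0 := by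
      rintro _ ⟨u, hu, rfl⟩
      have := hC.canonical.symp_eq hD.param hD.param.zero_mem (v 0) u
      rw [hv2] at this
      simpa [symp] using this.symm
    obtain ⟨u, hu, hu'⟩ := hF.coisotropic _ horth
    have hu'' : (fderiv ℝ γ 0 u).2 = (fderiv ℝ γ 0 (v 0)).2 := hu'
    have h1 := hrad u hu (by rw [hu'']; exact hZ)
    rw [hu''] at h1
    set r := (fderiv ℝ γ 0 (v 0)).2.2 2
    have h2 : (fderiv ℝ γ 0 (v 0)).2 = r • (radial basePoint).2 := by
      rw [← hu'', h1, map_smul, hρr]; rfl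
    have hr : r ≠ 0 := by
      intro hr
      rw [hr, zero_smul] at h2
      exact hv0 (hD.param.injective_fderiv hD.param.zero_mem (Prod.ext hv2 h2))
    refine hF.nonradial fun w hw => ?_
    have h3 := horth w hw
    rw [h2, ← sympForm_apply, map_smul, LinearMap.smul_apply, smul_eq_mul, mul_eq_zero,
      or_iff_right hr] at h3
    exact h3
  · filter_upwards [hOn, hder, hderL, hderR] with x h1 h2 h3 h4 u
    have h5 := hC.canonical.inner_eq hD.param h1 (fderiv ℝ κ x u)
    rw [← h2, h3] at h5
    rw [h5, h4]
  · intro u hu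
    rw [hderR.self_of_nhds, hder.self_of_nhds, hκ0] at hu
    have h1 := hrad _ (hκT u) hu
    have h2 := hderL.self_of_nhds u
    rw [hder.self_of_nhds, hκ0, h1, map_smul, hρr] at h2
    rw [← h2]
    simp [radial]
  · filter_upwards [hOn, hκJ, hker] with x h1 h2 h3
    have h4 := hC.canonical.inner_eq hD.param h1 (v (κ x))
    rw [(h3.2 h2.1 h2.2.1).1] at h4
    simpa using h4.symm
  · filter_upwards [hOn, hκJ, hker] with x h1 h2 h3 w hw hw0
    obtain ⟨s, -, -, -, rfl⟩ := hD.param.exists_curve h1 subset_rfl hw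
    obtain ⟨r, hr⟩ := (h3.2 h2.1 h2.2.1).2 _ hw0
    exact ⟨r, by rw [hr, map_smul]; rfl⟩

end Section

/-! ### Straightening the cusp set -/

section Straight

variable {C : Set (Phase × Phase)} {c : Phase × Phase} {p : V3 → Phase × Phase} {Z : V3 → V3}
  {χL χR : OpenPartialHomeomorph Phase Phase}

/-- A flat relation whose cusp set is the diagonal `{(x, s dx₃; x, s dx₃)}`, along which the kernel
of `dπ_L` is in the direction of `∂/∂y₁`. -/
structure StraightRel (C : Set (Phase × Phase)) : Prop where
  flat : FlatRel C
  cusp_iff : ∀ᶠ c in 𝓝 basePoint,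
    c ∈ cuspSet Prod.fst C ↔ c.1.2 = (c.1.2 2) • basisVec 2 ∧ c.2 = c.1
  ker : ∀ᶠ x in 𝓝 (0 : V3), ∀ w ∈ tangentVecs C ((x, basisVec 2), (x, basisVec 2)), w.1 = 0 →
    ∃ r : ℝ, w.2.1 = r • basisVec 0

theorem dil_tangentVecs (hC : ∀ c ∈ C, ∀ t : ℝ, 0 < t → dil₂ t c ∈ C) {t : ℝ} (ht : 0 < t)
    {w : Phase × Phase} (hw : w ∈ tangentVecs C c) : dil₂ t w ∈ tangentVecs C (dil₂ t c) := by
  obtain ⟨δ, h1, rfl, h2, rfl⟩ := hw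
  have hd := (h1.differentiableAt (by simp)).hasDerivAt
  let L : Phase × Phase →L[ℝ] Phase × Phase :=
    ((ContinuousLinearMap.id ℝ V3).prodMap (t • ContinuousLinearMap.id ℝ V3)).prodMap
      ((ContinuousLinearMap.id ℝ V3).prodMap (t • ContinuousLinearMap.id ℝ V3))
  exact ⟨fun s => dil₂ t (δ s), (L.contDiff.contDiffAt).comp 0 h1, rfl,
    h2.mono fun s hs => hC _ hs t ht, (L.hasFDerivAt.comp_hasDerivAt 0 hd).deriv⟩

theorem tangentVecs_conjugate_symm (hL : IsSmoothHomeo χL) (hR : IsSmoothHomeo χR)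
    (hcL : c.1 ∈ χL.source) (hcR : c.2 ∈ χR.source) {w : Phase × Phase}
    (hw : w ∈ tangentVecs (conjugate χL χR C) (χL c.1, χR c.2)) :
    (fderiv ℝ χL.symm (χL c.1) w.1, fderiv ℝ χR.symm (χR c.2) w.2) ∈ tangentVecs C c := by
  have := tangentVecs_conjugate (A' := C) hL.symm hR.symm (c := (χL c.1, χR c.2))
    (χL.map_source hcL) (χR.map_source hcR) (by
      rintro _ ⟨d, ⟨h1, h2, h3⟩, rfl⟩ - -
      simpa [χL.left_inv h2, χR.left_inv h3] using h1) hw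
  simpa [χL.left_inv hcL, χR.left_inv hcR] using this

/-- The base point map of a cusp section to the right, as a local diffeomorphism. -/
theorem CuspSection.exists_homeo (hp : CuspSection C p Z) :
    ∃ e : OpenPartialHomeomorph V3 V3, IsSmoothHomeo e ∧ 0 ∈ e.source ∧ e 0 = 0 ∧
      ∀ x, e x = (p x).2.1 := by
  have hY : SmoothNear (fun x => (p x).2.1) 0 := by
    filter_upwards [hp.smooth_p] with x h using h.snd.fst
  obtain ⟨e, h1, h2, h3, h4⟩ := hY.exists_openPartialHomeomorph_of_injective rfl hp.injective
  exact ⟨e, ⟨h3, h4⟩, h1, by rw [h2, hp.p_zero]; rfl, h2⟩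

/-- The image of the cusp set in `T*Y` consists of multiples of a one form `β`; coisotropy says that
`dβ` vanishes on `ker β`, up to multiples of `β`. -/
theorem CuspSection.integrable (hC : FlatRel C) (hp : CuspSection C p Z)
    {e : OpenPartialHomeomorph V3 V3} (he : IsSmoothHomeo e) (he0 : 0 ∈ e.source) (hee : e 0 = 0)
    (hep : ∀ x, e x = (p x).2.1) {β : V3 → V3} (hβ : β = fun y => (p (e.symm y)).2.2)
    (hβs : SmoothNear β 0) :
    ∀ᶠ y in 𝓝 0, ∀ q, inner ℝ (β y) q = 0 → ∃ r : ℝ, ∀ u,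
      inner ℝ (fderiv ℝ β y u) q - inner ℝ (fderiv ℝ β y q) u = r * inner ℝ (β y) u := by
  have hes : e.symm 0 = 0 := by rw [← hee, e.left_inv he0, hee]
  have hsrc : ∀ᶠ x in 𝓝 0, x ∈ e.source := e.open_source.mem_nhds he0
  have hpt : Tendsto p (𝓝 0) (𝓝 basePoint) := by
    have := hp.smooth_p.continuousAt.tendsto
    rwa [hp.p_zero] at this
  have hbase : Tendsto (fun d : Phase × Phase => d.1.1) (𝓝 basePoint) (𝓝 0) :=
    continuous_fst.fst.continuousAt
  have hrep : ∀ᶠ d in 𝓝 basePoint, d ∈ cuspSet Prod.fst C → d.2.2 = (d.1.2 2) • β d.2.1 := by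
    filter_upwards [hp.cusp_iff, hbase.eventually hsrc] with d h1 h2 h3
    have h4 := h1.1 h3
    have h5 : d.2.1 = e d.1.1 := by
      rw [hep]; exact congrArg (fun z => z.2.1) h4
    rw [h5, hβ]
    simp only [e.left_inv h2]
    exact congrArg (fun z => z.2.2) h4
  have hest : Tendsto e.symm (𝓝 0) (𝓝 0) := by
    have := (he.symm.smoothNear (hee ▸ e.map_source he0)).continuousAt.tendsto
    rwa [hes] at this
  have htgt : ∀ᶠ y in 𝓝 0, y ∈ e.target := e.open_target.mem_nhds (hee ▸ e.map_source he0)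
  filter_upwards [hest.eventually (hpt.eventually hrep.eventually_nhds), hest.eventually hp.mem,
    hest.eventually hp.norm, htgt, hβs] with y h1 h2 h3 h4 h5 q hq
  set x := e.symm y with hx
  have hy : (p x).2.1 = y := by rw [← hep, hx, e.right_inv h4]
  have hT : ∀ w ∈ tangentVecs (cuspSet Prod.fst C) (p x),
      ∃ r : ℝ, w.2.2 = fderiv ℝ β y w.2.1 + r • β y := by
    rintro _ ⟨δ, hδ, hδ0, hδA, rfl⟩
    have hd := (hδ.differentiableAt (by simp)).hasDerivAt
    have d1 : HasDerivAt (fun t => (δ t).2.2) (deriv δ 0).2.2 0 :=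
      ((ContinuousLinearMap.snd ℝ V3 V3).comp
        (ContinuousLinearMap.snd ℝ Phase Phase)).hasFDerivAt.comp_hasDerivAt 0 hd
    have d2 : HasDerivAt (fun t => (δ t).2.1) (deriv δ 0).2.1 0 :=
      ((ContinuousLinearMap.fst ℝ V3 V3).comp
        (ContinuousLinearMap.snd ℝ Phase Phase)).hasFDerivAt.comp_hasDerivAt 0 hd
    have d3 : HasDerivAt (fun t => (δ t).1.2 2) ((deriv δ 0).1.2 2) 0 :=
      ((EuclideanSpace.proj (𝕜 := ℝ) (2 : Fin 3)).comp ((ContinuousLinearMap.snd ℝ V3 V3).comp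
        (ContinuousLinearMap.fst ℝ Phase Phase))).hasFDerivAt.comp_hasDerivAt 0 hd
    have hδy : (δ 0).2.1 = y := by rw [hδ0, hy]
    have d4 : HasDerivAt (fun t => β (δ t).2.1) (fderiv ℝ β y (deriv δ 0).2.1) 0 := by
      have h6 : HasFDerivAt β (fderiv ℝ β y) (δ 0).2.1 := by
        rw [hδy]; exact (h5.differentiableAt (by simp)).hasFDerivAt
      exact h6.comp_hasDerivAt 0 d2
    have d5 := d3.smul d4
    have hδt : Tendsto δ (𝓝 0) (𝓝 (p x)) := by
      have := hδ.continuousAt.tendsto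
      rwa [hδ0] at this
    have d6 := d1.unique (d5.congr_of_eventuallyEq (by
      filter_upwards [hδt.eventually h1, hδA] with t h6 h7 using h6 h7))
    rw [hδy, hδ0, h3, one_smul] at d6
    exact ⟨_, d6⟩
  have hcR : p x ∈ cuspSet Prod.snd C := hC.cuspSet_eq ▸ h2
  obtain ⟨w, hw, hwq⟩ := (hC.flat_right (p x) hcR).1 (q, covec (fderiv ℝ β y) q) (by
    rintro _ ⟨w, hw, rfl⟩
    rw [← hC.cuspSet_eq] at hw
    obtain ⟨r, hr⟩ := hT w hw
    rw [symp_eq]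
    simp only [inner_covec, hr, inner_add_right, real_inner_smul_right]
    rw [real_inner_comm] at hq
    rw [hq]
    ring)
  rw [← hC.cuspSet_eq] at hw
  obtain ⟨r, hr⟩ := hT w hw
  rw [hwq] at hr
  refine ⟨r, fun u => ?_⟩
  have h6 := congrArg (fun z => inner ℝ z u) hr
  simp only [inner_covec, inner_add_left, real_inner_smul_left] at h6
  rw [real_inner_comm, h6]
  ring

/-- Adapted coordinates on the right, transplanted to the left by the cusp set itself, make the cusp
set diagonal. -/
theorem CuspSection.exists_straight (hC : FlatRel C) (hp : CuspSection C p Z) :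
    ∃ χL χR : OpenPartialHomeomorph Phase Phase, IsHomogCanonical χL ∧ IsHomogCanonical χR ∧
      (0, basisVec 2) ∈ χL.source ∧ (0, basisVec 2) ∈ χR.source ∧
      χL (0, basisVec 2) = (0, basisVec 2) ∧ χR (0, basisVec 2) = (0, basisVec 2) ∧
      StraightRel (conjugate χL χR C) := by
  obtain ⟨e, he, he0, hee, hep⟩ := hp.exists_homeo
  have het0 : (0 : V3) ∈ e.target := hee ▸ e.map_source he0
  have hes : e.symm 0 = 0 := by rw [← hee, e.left_inv he0, hee]
  have hess : SmoothNear e.symm 0 := he.symm.smoothNear het0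
  have hest : Tendsto e.symm (𝓝 0) (𝓝 0) := by
    have := hess.continuousAt.tendsto
    rwa [hes] at this
  obtain ⟨β, hβ⟩ : ∃ β : V3 → V3, β = fun y => (p (e.symm y)).2.2 := ⟨_, rfl⟩
  obtain ⟨Z', hZ'⟩ : ∃ Z' : V3 → V3, Z' = fun y => Z (e.symm y) := ⟨_, rfl⟩
  have hβs : SmoothNear β 0 := by
    rw [hβ]
    have h1 : SmoothNear p (e.symm 0) := by rw [hes]; exact hp.smooth_p
    filter_upwards [h1.comp hess] with y h2 using h2.snd.snd
  have hZs : SmoothNear Z' 0 := by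
    rw [hZ']
    have h1 : SmoothNear Z (e.symm 0) := by rw [hes]; exact hp.smooth_Z
    exact h1.comp hess
  have hβ0 : β 0 = basisVec 2 := by simp only [hβ, hes, hp.p_zero]; rfl
  have hβZ : ∀ᶠ y in 𝓝 0, inner ℝ (β y) (Z' y) = 0 := by
    filter_upwards [hest.eventually hp.inner_Z] with y h1
    rw [hβ, hZ']; exact h1
  obtain ⟨Ψ, hΨ0, hΨ00, hΨs, hΨs', hΨβ, hΨ⟩ := exists_adapted_coordinates hβs hZs hβ0
    (by simp only [hZ', hes]; exact hp.Z_ne_zero) hβZ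
    (hp.integrable hC he he0 hee hep hβ hβs)
  have hΨh : IsSmoothHomeo Ψ := ⟨hΨs, hΨs'⟩
  have hΨt0 : (0 : V3) ∈ Ψ.target := hΨ00 ▸ Ψ.map_source hΨ0
  have hΨsy : Ψ.symm 0 = 0 := by rw [← hΨ00, Ψ.left_inv hΨ0, hΨ00]
  have hΨc : Tendsto Ψ (𝓝 0) (𝓝 0) := by
    have := (hΨh.smoothNear hΨ0).continuousAt.tendsto
    rwa [hΨ00] at this
  have hsm : IsSmoothHomeo (e.trans Ψ.symm) := he.trans hΨh.symm
  set χL := lift (e.trans Ψ.symm) hsm with hχL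
  set χR := lift Ψ.symm hΨh.symm with hχR
  have hL : IsHomogCanonical χL := isHomogCanonical_lift hsm
  have hR : IsHomogCanonical χR := isHomogCanonical_lift hΨh.symm
  obtain ⟨ρ, hρ⟩ : ∃ ρ : V3 → ℝ, ρ = fun u => inner ℝ (β (Ψ u)) (fderiv ℝ Ψ u (basisVec 2)) :=
    ⟨_, rfl⟩
  have hρ0 : ρ 0 = 1 := by
    simp only [hρ, hΨ00, hΨβ]
    simp [basisVec_apply]
  have hρpos : ∀ᶠ u in 𝓝 0, 0 < ρ u := by
    have h1 : ContinuousAt ρ 0 := by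
      rw [hρ]
      have h2 : ContinuousAt (fun u => β (Ψ u)) 0 :=
        ContinuousAt.comp (by rw [hΨ00]; exact hβs.continuousAt)
          (hΨh.smoothNear hΨ0).continuousAt
      exact h2.inner ((hΨh.smoothNear hΨ0).fderiv.continuousAt.clm_apply continuousAt_const)
    exact h1.eventually (lt_mem_nhds (by rw [hρ0]; exact one_pos))
  -- `X u` is the point of the left base which corresponds to `u` in the adapted coordinates
  obtain ⟨X, hX⟩ : ∃ X : V3 → V3, X = fun u => e.symm (Ψ u) := ⟨_, rfl⟩
  have hXt : Tendsto X (𝓝 0) (𝓝 0) := by rw [hX]; exact hest.comp hΨc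
  have hX0 : X 0 = 0 := by simp only [hX, hΨ00, hes]
  have key : ∀ᶠ u in 𝓝 0, (p (X u)).1 ∈ χL.source ∧ (p (X u)).2 ∈ χR.source ∧
      χL (p (X u)).1 = (u, ρ u • basisVec 2) ∧ χR (p (X u)).2 = (u, ρ u • basisVec 2) := by
    filter_upwards [Ψ.open_source.mem_nhds hΨ0, hΨc.eventually (e.open_target.mem_nhds het0),
      hΨ, hXt.eventually hp.base, hXt.eventually hp.inner_eq, hXt.eventually hp.mem]
      with u h1 h2 h3 h4 h5 h6
    obtain ⟨-, r, hr⟩ := h3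
    have hρu : ρ u = r := by
      simp only [hρ, hr]
      simp [basisVec_apply]
    have hne := hC.canonical.ne_zero _ (cuspSet_subset h6)
    have hXs : X u ∈ e.source := by rw [hX]; exact e.map_target h2
    have heX : e (X u) = Ψ u := by rw [hX]; exact e.right_inv h2
    have hp2 : (p (X u)).2 = (Ψ u, β (Ψ u)) := by
      refine Prod.ext ?_ ?_
      · rw [← hep, heX]
      · simp only [hβ, hX]
    refine ⟨⟨?_, hne.1⟩, ⟨?_, hne.2⟩, ?_, ?_⟩
    · rw [h4]
      exact ⟨hXs, by change e (X u) ∈ Ψ.target; rw [heX]; exact Ψ.map_source h1⟩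
    · rw [hp2]; exact Ψ.map_source h1
    · rw [hχL, lift_apply, h4]
      have h7 : (e.trans Ψ.symm) (X u) = u := by
        change Ψ.symm (e (X u)) = u
        rw [heX, Ψ.left_inv h1]
      rw [h7]
      refine Prod.ext rfl (covec_unique fun v => ?_)
      have h8 : fderiv ℝ (e.trans Ψ.symm).symm u v =
          fderiv ℝ e.symm (e (X u)) (fderiv ℝ Ψ u v) := by
        have d1 := (hΨh.smoothNear h1).differentiableAt.hasFDerivAt
        have d2 := (he.symm.smoothNear h2).differentiableAt.hasFDerivAt
        have d3 : fderiv ℝ (e.trans Ψ.symm).symm u = _ := (d2.comp u d1).fderiv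
        rw [d3, heX]; rfl
      rw [inner_covec, h5, h8]
      simp only [← hep]
      change inner ℝ _ (fderiv ℝ e (X u) _) = _
      rw [he.fderiv_fderiv_symm hXs, hp2, hr, hρu, real_inner_smul_left, inner_basisVec]
    · rw [hχR, lift_apply, hp2]
      simp only
      rw [Ψ.left_inv h1]
      refine Prod.ext rfl (covec_unique fun v => ?_)
      rw [inner_covec]
      change inner ℝ _ (fderiv ℝ Ψ u v) = _
      rw [hr, hρu, real_inner_smul_left, inner_basisVec]
  have hbase := key.self_of_nhds
  rw [hX0, hp.p_zero, hρ0, one_smul] at hbase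
  obtain ⟨hL0, hR0, hL1, hR1⟩ := hbase
  have hdil : ∀ {u t}, 0 < t → (p (X u)).1 ∈ χL.source → (p (X u)).2 ∈ χR.source →
      χL (p (X u)).1 = (u, ρ u • basisVec 2) → χR (p (X u)).2 = (u, ρ u • basisVec 2) →
      (χL (dil₂ t (p (X u))).1, χR (dil₂ t (p (X u))).2) =
        ((u, (t * ρ u) • basisVec 2), (u, (t * ρ u) • basisVec 2)) := by
    intro u t ht h1 h2 h3 h4
    change (χL (dil t _), χR (dil t _)) = _
    rw [hL.homogeneous _ h1 t ht, hR.homogeneous _ h2 t ht, h3, h4]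
    simp [dil, smul_smul]
  -- the transformed cusp set is the diagonal because the one given by `p` is pulled back to it
  refine ⟨χL, χR, hL, hR, hL0, hR0, hL1, hR1, hC.conjugate hL hR, ?_, ?_⟩
  · let d : Phase × Phase → Phase × Phase := fun c => (χL.symm c.1, χR.symm c.2)
    have hLt : ((0, basisVec 2) : Phase) ∈ χL.target := hL1 ▸ χL.map_source hL0
    have hRt : ((0, basisVec 2) : Phase) ∈ χR.target := hR1 ▸ χR.map_source hR0
    have hLs : χL.symm (0, basisVec 2) = (0, basisVec 2) := by
      conv_lhs => rw [← hL1]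
      exact χL.left_inv hL0
    have hRs : χR.symm (0, basisVec 2) = (0, basisVec 2) := by
      conv_lhs => rw [← hR1]
      exact χR.left_inv hR0
    have hd : Tendsto d (𝓝 basePoint) (𝓝 basePoint) := by
      have h1 : ContinuousAt d basePoint :=
        ((hL.isSmoothHomeo.symm.smoothNear hLt).continuousAt.comp_of_eq
          continuous_fst.continuousAt rfl).prodMk
        ((hR.isSmoothHomeo.symm.smoothNear hRt).continuousAt.comp_of_eq
          continuous_snd.continuousAt rfl)
      have h2 : d basePoint = basePoint := Prod.ext hLs hRs
      have h3 := h1.tendsto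
      rwa [h2] at h3
    have hb : Tendsto (fun c : Phase × Phase => c.1.1) (𝓝 basePoint) (𝓝 0) :=
      continuous_fst.fst.continuousAt
    have hpos : ∀ᶠ c : Phase × Phase in 𝓝 basePoint, 0 < c.1.2 2 := by
      have h1 : Continuous fun c : Phase × Phase => c.1.2 2 :=
        (EuclideanSpace.proj (𝕜 := ℝ) (2 : Fin 3)).continuous.comp
          (continuous_snd.comp continuous_fst)
      exact h1.continuousAt.eventually (lt_mem_nhds (by simp [basePoint, basisVec_apply]))
    have hec : Tendsto e (𝓝 0) (𝓝 0) := by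
      have := (he.smoothNear he0).continuousAt.tendsto
      rwa [hee] at this
    have hu : Tendsto (fun c => Ψ.symm (e (d c).1.1)) (𝓝 basePoint) (𝓝 0) := by
      have h1 := (hΨh.symm.smoothNear hΨt0).continuousAt.tendsto
      rw [hΨsy] at h1
      exact h1.comp (hec.comp (hb.comp hd))
    filter_upwards [hd.eventually hp.cusp_iff, hd.eventually hpos, hu.eventually key,
      (hb.comp hd).eventually (e.open_source.mem_nhds he0),
      (hec.comp (hb.comp hd)).eventually (Ψ.open_target.mem_nhds hΨt0),
      hb.eventually key, hb.eventually hρpos, hpos, hb.eventually (hXt.eventually hp.mem)]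
      with c h1 h2 h3 h4 h5 h6 h7 h8 h9
    constructor
    · intro hc
      obtain ⟨d', ⟨hd1, hd2, hd3⟩, hcd⟩ := cuspSet_subset hc
      change (χL d'.1, χR d'.2) = c at hcd
      have hdd : d c = d' := by
        rw [← hcd]
        exact Prod.ext (χL.left_inv hd2) (χR.left_inv hd3)
      have hdc : d c ∈ cuspSet Prod.fst C := by
        rw [hdd, ← hC.mem_cuspSet_conjugate hL hR hd1 hd2 hd3]
        rwa [hcd]
      have h10 := h1.1 hdc
      have hXu : X (Ψ.symm (e (d c).1.1)) = (d c).1.1 := by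
        simp only [hX]
        rw [show Ψ (Ψ.symm (e (d c).1.1)) = e (d c).1.1 from Ψ.right_inv h5]
        exact e.left_inv h4
      have h11 := hdil h2 h3.1 h3.2.1 h3.2.2.1 h3.2.2.2
      rw [hXu, ← h10, hdd] at h11
      have h12 : c = _ := hcd.symm.trans h11
      rw [h12]
      simp [basisVec_apply]
    · rintro ⟨hc1, hc2⟩
      have h10 := hdil (t := c.1.2 2 / ρ c.1.1) (div_pos h8 h7) h6.1 h6.2.1 h6.2.2.1 h6.2.2.2
      rw [div_mul_cancel₀ _ h7.ne', ← hc1] at h10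
      have h11 : c = (χL (dil₂ (c.1.2 2 / ρ c.1.1) (p (X c.1.1))).1,
          χR (dil₂ (c.1.2 2 / ρ c.1.1) (p (X c.1.1))).2) := by
        rw [h10]; exact Prod.ext rfl hc2
      have h12 := hC.dil_mem_cuspSet h9 (div_pos h8 h7)
      rw [h11, hC.mem_cuspSet_conjugate hL hR (cuspSet_subset h12)
        (hL.source_conic _ h6.1 _ (div_pos h8 h7)) (hR.source_conic _ h6.2.1 _ (div_pos h8 h7))]
      exact h12
  · filter_upwards [key, hρpos, hΨ, hXt.eventually hp.ker, Ψ.open_source.mem_nhds hΨ0,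
      hΨc.eventually (e.open_target.mem_nhds het0)] with u h1 h2 h3 h4 h5 h6 w hw hw0
    have h7 := dil_tangentVecs (hC.canonical.conjugate hL hR).conic h2 hw
    have h8 : dil₂ (ρ u) (((u, basisVec 2), (u, basisVec 2)) : Phase × Phase) =
        (χL (p (X u)).1, χR (p (X u)).2) := by
      rw [h1.2.2.1, h1.2.2.2]; rfl
    rw [h8] at h7
    have h9 := tangentVecs_conjugate_symm hL.isSmoothHomeo hR.isSmoothHomeo h1.1 h1.2.1 h7
    obtain ⟨r, hr⟩ := h4 _ h9 (by simp [dil₂, hw0, dil, ← Prod.zero_eq_mk])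
    refine ⟨r, ?_⟩
    have h10 := congrArg Prod.fst (hR.isSmoothHomeo.fderiv_fderiv_symm h1.2.1 (dil₂ (ρ u) w).2)
    rw [fderiv_lift_fst hΨh.symm h1.2.1] at h10
    have h11 : (p (X u)).2.1 = Ψ u := by
      rw [← hep, hX]; exact e.right_inv h6
    have h12 : Z (X u) = fderiv ℝ Ψ u (basisVec 0) := by
      rw [h3.1, hZ', hX]
    change fderiv ℝ Ψ.symm _ ((fderiv ℝ χR.symm (χR (p (X u)).2)) (dil₂ (ρ u) w).2).1 = w.2.1 at h10
    rw [← h10, h11, hr, h12, map_smul, hΨh.fderiv_symm_fderiv h5]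

/-- At every cusp point a flat relation is straightened by homogeneous canonical transformations.
-/
theorem FlatRel.exists_straight (hC : FlatRel C) (hc : c ∈ cuspSet Prod.fst C) :
    ∃ χL χR : OpenPartialHomeomorph Phase Phase, IsHomogCanonical χL ∧ IsHomogCanonical χR ∧
      c.1 ∈ χL.source ∧ c.2 ∈ χR.source ∧ χL c.1 = (0, basisVec 2) ∧ χR c.2 = (0, basisVec 2) ∧
      StraightRel (FlatCusp.conjugate χL χR C) := by
  obtain ⟨χL, χR, hL, hR, h1, h2, h3, h4, γ, O, J, h, v, hD, htL, htR⟩ := hC.exists_transversal hc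
  have hC' := hC.conjugate hL hR
  obtain ⟨p, Z, hp⟩ := hD.exists_cuspSection hC' htL htR
  obtain ⟨χL', χR', hL', hR', h5, h6, h7, h8, hs⟩ := hp.exists_straight hC'
  refine ⟨χL.trans χL', χR.trans χR', hL.trans hL', hR.trans hR',
    ⟨h1, by change χL c.1 ∈ χL'.source; rwa [h3]⟩, ⟨h2, by change χR c.2 ∈ χR'.source; rwa [h4]⟩,
    (congrArg χL' h3).trans h7, (congrArg χR' h4).trans h8, ?_⟩
  rwa [conjugate_conjugate] at hs

end Straight

/-! ### Directional derivatives and Taylor expansion with parameters -/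

section Directional

variable {E : Type*} [NormedAddCommGroup E] [NormedSpace ℝ E]

/-- The directional derivative of `f` along the constant vector field `w`. -/
def dd (w : E) (f : E → ℝ) (z : E) : ℝ := fderiv ℝ f z w

variable {f : E → ℝ} {w : E}

theorem contDiff_dd (hf : ContDiff ℝ ∞ f) (w : E) : ContDiff ℝ ∞ (dd w f) :=
  (hf.fderiv_right (m := ∞) (by simp)).clm_apply contDiff_const

theorem fderiv_dd (hf : ContDiff ℝ ∞ f) (w u z : E) :
    fderiv ℝ (dd w f) z u = fderiv ℝ (fderiv ℝ f) z u w := by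
  have h1 : DifferentiableAt ℝ (fderiv ℝ f) z :=
    (hf.fderiv_right (m := ∞) (by simp)).differentiable (by simp) z
  have h2 : HasFDerivAt (dd w f) _ z := h1.hasFDerivAt.clm_apply (hasFDerivAt_const w z)
  rw [h2.fderiv]
  simp

theorem dd_comm (hf : ContDiff ℝ ∞ f) (u w : E) : dd u (dd w f) = dd w (dd u f) := by
  funext z
  have h : IsSymmSndFDerivAt ℝ f z :=
    hf.contDiffAt.isSymmSndFDerivAt (by simp only [minSmoothness_of_isRCLikeNormedField]; norm_cast)
  rw [dd, dd, fderiv_dd hf, fderiv_dd hf]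
  exact h.eq u w

theorem iteratedDeriv_line (hf : ContDiff ℝ ∞ f) (z w : E) (n : ℕ) :
    iteratedDeriv n (fun t : ℝ => f (z + t • w)) = fun t => (dd w)^[n] f (z + t • w) := by
  induction n generalizing f with
  | zero => simp
  | succ n ih =>
    rw [iteratedDeriv_succ']
    have h : deriv (fun t : ℝ => f (z + t • w)) = fun t => dd w f (z + t • w) := by
      funext t
      have h1 : HasDerivAt (fun t : ℝ => z + t • w) w t := by
        simpa using ((hasDerivAt_id t).smul_const w).const_add z
      exact ((hf.differentiable (by simp) _).hasFDerivAt.comp_hasDerivAt t h1).deriv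
    rw [h, ih (contDiff_dd hf w)]
    rfl

end Directional

theorem iteratedDeriv_pow_mul {h : ℝ → ℝ} (hh : ContDiff ℝ ∞ h) (n : ℕ) :
    iteratedDeriv n (fun t => t ^ n * h t) 0 = n.factorial * h 0 := by
  induction n generalizing h with
  | zero => simp
  | succ n ih =>
    rw [iteratedDeriv_succ']
    have h1 : deriv (fun t => t ^ (n + 1) * h t) =
        fun t => t ^ n * ((n + 1) * h t + t * deriv h t) := by
      funext t
      have h2 := ((hasDerivAt_pow (n + 1) t).mul
        (hh.differentiable (by simp) t).hasDerivAt).deriv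
      simp only [Nat.add_sub_cancel] at h2
      refine h2.trans ?_
      push_cast
      ring
    have h3 : ContDiff ℝ ∞ (deriv h) := ((contDiff_succ_iff_deriv (n := ∞)).1 hh).2.2
    rw [h1, ih (by fun_prop), Nat.factorial_succ]
    push_cast
    ring

/-- Taylor's formula with a smooth remainder, for a function which vanishes to order `n` at `t = 0`
when the parameter is near `a`. -/
theorem exists_eq_pow_mul {P : Type} [NormedAddCommGroup P] [NormedSpace ℝ P] {f : P × ℝ → ℝ}
    (hf : ContDiff ℝ ∞ f) (a : P) (n : ℕ)
    (h0 : ∀ k < n, ∀ᶠ p in 𝓝 a, iteratedDeriv k (fun t => f (p, t)) 0 = 0) :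
    ∃ h : P × ℝ → ℝ, ContDiff ℝ ∞ h ∧ (∀ᶠ p in 𝓝 a, ∀ t, f (p, t) = t ^ n * h (p, t)) ∧
      ∀ᶠ p in 𝓝 a, iteratedDeriv n (fun t => f (p, t)) 0 = n.factorial * h (p, 0) := by
  induction n with
  | zero => exact ⟨f, hf, by simp, by simp⟩
  | succ n ih =>
    obtain ⟨h, hh, h1, h2⟩ := ih fun k hk => h0 k (by omega)
    have h3 : ∀ᶠ p in 𝓝 a, h (p, 0) = 0 := by
      filter_upwards [h2, h0 n (by omega)] with p h3 h4
      rw [h4] at h3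
      have : (n.factorial : ℝ) ≠ 0 := by positivity
      exact (mul_eq_zero.1 h3.symm).resolve_left this
    obtain ⟨k, hk, hk'⟩ := exists_eq_mul_of_vanishing (f := fun q : P × ℝ => h q - h (q.1, 0))
      (hh.sub (hh.comp (contDiff_fst.prodMk contDiff_const))) (fun p => sub_self _)
    have h4 : ∀ᶠ p in 𝓝 a, ∀ t, f (p, t) = t ^ (n + 1) * k (p, t) := by
      filter_upwards [h1, h3] with p h5 h6 t
      have h7 := hk' p t
      simp only [h6, sub_zero] at h7
      rw [h5, h7]; ring
    refine ⟨k, hk, h4, ?_⟩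
    filter_upwards [h4] with p h5
    simp only [h5]
    exact iteratedDeriv_pow_mul (h := fun t => k (p, t))
      (hk.comp (contDiff_const.prodMk contDiff_id)) (n + 1)

/-! ### Generating functions -/

section Generating

/-- The arguments `(x, y₁, τ)` of a generating function. -/
abbrev GenArg : Type := V3 × ℝ × ℝ

/-- The direction `∂/∂x_i`. -/
def dirX (i : Fin 3) : GenArg := (basisVec i, 0, 0)

/-- The direction `∂/∂y₁`. -/
def dirY : GenArg := (0, 1, 0)

/-- The direction `∂/∂τ`. -/
def dirT : GenArg := (0, 0, 1)

/-- The gradient in `x`. -/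
def gradX (g : GenArg → ℝ) (z : GenArg) : V3 := WithLp.toLp 2 fun i => dd (dirX i) g z

/-- The point with `η = (η₁, τ, 1)` of the relation generated by `g`. -/
def genPoint (g : GenArg → ℝ) (z : GenArg) : Phase × Phase :=
  ((z.1, gradX g z),
    (!₂[z.2.1, dd dirT g z, g z - z.2.2 * dd dirT g z], !₂[-dd dirY g z, z.2.2, 1]))

/-- `(x, (y₁, θ₂, θ₃)) ↦ (x, y₁, θ₂ / θ₃)`. -/
def slice (q : Phase) : GenArg := (q.1, q.2 0, q.2 1 / q.2 2)

/-- The conic relation generated by `g`, parametrized by `(x, (y₁, θ₂, θ₃))`. -/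
def genParam (g : GenArg → ℝ) (q : Phase) : Phase × Phase := dil₂ (q.2 2) (genPoint g (slice q))

/-- The homogeneous extension of degree one of a function of `(x, y₁, τ)`. -/
def homog (F : GenArg → ℝ) (q : Phase) : ℝ := q.2 2 * F (slice q)

/-- The points `(x, x₁, 0)`. -/
def diagArg : V3 →L[ℝ] GenArg :=
  (ContinuousLinearMap.id ℝ V3).prod ((EuclideanSpace.proj 0).prod 0)

/-- The points `(x, (x₁, 0, 1))`. -/
def diagPt (x : V3) : Phase := (x, !₂[x 0, 0, 1])

theorem diagArg_apply (x : V3) : diagArg x = (x, x 0, 0) := rfl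

theorem slice_diagPt (x : V3) : slice (diagPt x) = diagArg x := by
  simp [slice, diagPt, diagArg_apply]

theorem continuous_diagPt : Continuous diagPt := by
  refine continuous_id.prodMk ?_
  refine (PiLp.continuous_toLp 2 _).comp (continuous_pi fun i => ?_)
  fin_cases i
  · exact (EuclideanSpace.proj (𝕜 := ℝ) (0 : Fin 3)).continuous
  · exact continuous_const
  · exact continuous_const

variable {g F : GenArg → ℝ} {q : Phase}

theorem contDiff_coord (i : Fin 3) : ContDiff ℝ ∞ fun q : Phase => q.2 i :=
  (EuclideanSpace.proj (𝕜 := ℝ) i).contDiff.comp contDiff_snd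

theorem hasFDerivAt_coord (i : Fin 3) (q : Phase) :
    HasFDerivAt (fun q : Phase => q.2 i)
      ((EuclideanSpace.proj (𝕜 := ℝ) i).comp (ContinuousLinearMap.snd ℝ V3 V3)) q :=
  ((EuclideanSpace.proj (𝕜 := ℝ) i).comp (ContinuousLinearMap.snd ℝ V3 V3)).hasFDerivAt

theorem eventually_coord_pos (hq : 0 < q.2 2) : ∀ᶠ q' in 𝓝 q, 0 < q'.2 2 :=
  (contDiff_coord 2).continuous.continuousAt.eventually (lt_mem_nhds hq)

theorem smoothNear_slice (hq : 0 < q.2 2) : SmoothNear slice q := by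
  filter_upwards [eventually_coord_pos hq] with q' hq'
  exact contDiffAt_fst.prodMk ((contDiff_coord 0).contDiffAt.prodMk
    ((contDiff_coord 1).contDiffAt.div (contDiff_coord 2).contDiffAt hq'.ne'))

theorem smoothNear_homog (hF : ContDiff ℝ ∞ F) (hq : 0 < q.2 2) : SmoothNear (homog F) q :=by
  filter_upwards [smoothNear_slice hq] with q' hq'
  exact (contDiff_coord 2).contDiffAt.mul (hF.contDiffAt.comp q' hq')

theorem fderiv_slice (hq : 0 < q.2 2) (w : Phase) :
    fderiv ℝ slice q w = (w.1, w.2 0, w.2 1 / q.2 2 - q.2 1 * w.2 2 / q.2 2 ^ 2) := by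
  have h0 : HasFDerivAt (fun q : Phase => q.2 1 * (q.2 2)⁻¹) _ q :=
    (hasFDerivAt_coord 1 q).mul
      ((hasDerivAt_inv hq.ne').comp_hasFDerivAt q (hasFDerivAt_coord 2 q))
  simp only [← div_eq_mul_inv] at h0
  have h2 : HasFDerivAt slice _ q := hasFDerivAt_fst.prodMk ((hasFDerivAt_coord 0 q).prodMk h0)
  rw [h2.fderiv]
  refine Prod.ext rfl (Prod.ext rfl ?_)
  simp
  field_simp
  ring

theorem fderiv_comp_slice (hF : ContDiff ℝ ∞ F) (hq : 0 < q.2 2) (w : Phase) :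
    fderiv ℝ (fun q => F (slice q)) q w =
      dd (w.1, w.2 0, w.2 1 / q.2 2 - q.2 1 * w.2 2 / q.2 2 ^ 2) F (slice q) := by
  have h1 : HasFDerivAt (fun q => F (slice q)) _ q :=
    (hF.differentiable (by simp) _).hasFDerivAt.comp q
      (smoothNear_slice hq).differentiableAt.hasFDerivAt
  rw [h1.fderiv, dd, ← fderiv_slice hq]; rfl

theorem fderiv_homog (hF : ContDiff ℝ ∞ F) (hq : 0 < q.2 2) (w : Phase) :
    fderiv ℝ (homog F) q w = w.2 2 * F (slice q) +
      q.2 2 * dd (w.1, w.2 0, w.2 1 / q.2 2 - q.2 1 * w.2 2 / q.2 2 ^ 2) F (slice q) := by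
  have h1 : DifferentiableAt ℝ (fun q => F (slice q)) q :=
    (hF.differentiable (by simp) _).comp q (smoothNear_slice hq).differentiableAt
  have h3 : HasFDerivAt (homog F) _ q := (hasFDerivAt_coord 2 q).mul h1.hasFDerivAt
  rw [h3.fderiv, ← fderiv_comp_slice hF hq, add_comm, mul_comm (w.2 2)]
  rfl

theorem fst_comp_genParam :
    Prod.fst ∘ genParam g = fun q => (q.1, q.2 2 • gradX g (slice q)) := rfl

theorem contDiff_gradX (hg : ContDiff ℝ ∞ g) : ContDiff ℝ ∞ (gradX g) :=
  contDiff_euclidean.2 fun i => contDiff_dd hg (dirX i)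

theorem smoothNear_fst_genParam (hg : ContDiff ℝ ∞ g) (hq : 0 < q.2 2) :
    SmoothNear (Prod.fst ∘ genParam g) q := by
  rw [fst_comp_genParam]
  filter_upwards [smoothNear_slice hq] with q' hq'
  exact contDiffAt_fst.prodMk
    ((contDiff_coord 2).contDiffAt.smul ((contDiff_gradX hg).contDiffAt.comp q' hq'))

theorem fderiv_fst_genParam (hg : ContDiff ℝ ∞ g) (hq : 0 < q.2 2) (w : Phase) :
    (fderiv ℝ (Prod.fst ∘ genParam g) q w).1 = w.1 ∧
      ∀ i, (fderiv ℝ (Prod.fst ∘ genParam g) q w).2 i =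
        fderiv ℝ (homog (dd (dirX i) g)) q w := by
  have h := (smoothNear_fst_genParam hg hq).differentiableAt.hasFDerivAt
  constructor
  · exact congrArg (fun A : Phase →L[ℝ] V3 => A w) (h.fst.unique hasFDerivAt_fst)
  · intro i
    have h1 : HasFDerivAt (homog (dd (dirX i) g)) _ q :=
      (EuclideanSpace.proj (𝕜 := ℝ) i).hasFDerivAt.comp q h.snd
    rw [h1.fderiv]; rfl

theorem dd_smul (r : ℝ) (w : GenArg) (F : GenArg → ℝ) (z : GenArg) :
    dd (r • w) F z = r * dd w F z := by simp [dd]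

theorem dd_add (u w : GenArg) (F : GenArg → ℝ) (z : GenArg) :
    dd (u + w) F z = dd u F z + dd w F z := by simp [dd]

theorem dd_vertical (r s : ℝ) (F : GenArg → ℝ) (z : GenArg) :
    dd (0, r, s) F z = r * dd dirY F z + s * dd dirT F z := by
  rw [← dd_smul, ← dd_smul, ← dd_add]
  simp [dirY, dirT]

/-- The determinant of the components `i`, `k` of the vectors `∂²g/∂x∂τ` and `∂g/∂x`. -/
def minor (g : GenArg → ℝ) (i k : Fin 3) (z : GenArg) : ℝ :=
  dd dirT (dd (dirX i) g) z * dd (dirX k) g z - dd dirT (dd (dirX k) g) z * dd (dirX i) g z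

/-- The determinant of `∂²g/∂x∂y₁`, `∂²g/∂x∂τ`, `∂g/∂x`. -/
def genJac (g : GenArg → ℝ) (z : GenArg) : ℝ :=
  dd dirY (dd (dirX 0) g) z * minor g 1 2 z - dd dirY (dd (dirX 1) g) z * minor g 0 2 z +
    dd dirY (dd (dirX 2) g) z * minor g 0 1 z

/-- The determinant of a block triangular map with identity as the first diagonal block. -/
theorem det_of_fst_eq {A : Phase →L[ℝ] Phase} (hA : ∀ w, (A w).1 = w.1) :
    A.det = (Matrix.of fun i j => (A (0, basisVec j)).2 i).det := by
  let b : Module.Basis (Fin 3) ℝ V3 := (EuclideanSpace.basisFun (Fin 3) ℝ).toBasis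
  have hb : ∀ j, b j = basisVec j := fun j => by simp [b, basisVec]
  have hr : ∀ (v : V3) (i : Fin 3), b.repr v i = v i := fun v i => by simp [b]
  have h1 : A.det = LinearMap.det A.toLinearMap := rfl
  rw [h1, ← LinearMap.det_toMatrix (b.prod b)]
  have h2 : LinearMap.toMatrix (b.prod b) (b.prod b) A.toLinearMap = Matrix.fromBlocks 1 0
      (Matrix.of fun i j => (A (basisVec j, 0)).2 i)
      (Matrix.of fun i j => (A (0, basisVec j)).2 i) := by
    ext i j
    rcases i with i | i <;> rcases j with j | j
    · simp [LinearMap.toMatrix_apply, hb, hA, hr, basisVec_apply, Matrix.one_apply]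
    · simp [LinearMap.toMatrix_apply, hb, hA]
    · simp [LinearMap.toMatrix_apply, hb, hr]
    · simp [LinearMap.toMatrix_apply, hb, hr]
  rw [h2, Matrix.det_fromBlocks_zero₁₂, Matrix.det_one, one_mul]

/-- In the coordinates `(x, (y₁, θ₂, θ₃))` the Jacobian of `π_L` is `∂²φ/∂x∂(y₁, θ)`, with `φ = θ₃
g(x, y₁, θ₂ / θ₃)`. -/
theorem jac_genParam (hg : ContDiff ℝ ∞ g) (hq : 0 < q.2 2) :
    jac (Prod.fst ∘ genParam g) q = homog (genJac g) q := by
  rw [jac, det_of_fst_eq fun w => (fderiv_fst_genParam hg hq w).1, Matrix.det_fin_three]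
  have hq' := hq.ne'
  simp only [Matrix.of_apply, (fderiv_fst_genParam hg hq _).2,
    fderiv_homog (contDiff_dd hg _) hq, dd_vertical, basisVec_apply, homog, genJac, minor]
  simp
  field_simp
  ring

theorem contDiff_genPoint (hg : ContDiff ℝ ∞ g) : ContDiff ℝ ∞ (genPoint g) := by
  have h1 := contDiff_dd hg dirT
  have h2 := contDiff_dd hg dirY
  refine (contDiff_fst.prodMk (contDiff_gradX hg)).prodMk (ContDiff.prodMk ?_ ?_)
  · refine contDiff_euclidean.2 fun i => ?_
    fin_cases i
    · exact contDiff_fst.comp contDiff_snd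
    · exact h1
    · exact hg.sub ((contDiff_snd.comp contDiff_snd).mul h1)
  · refine contDiff_euclidean.2 fun i => ?_
    fin_cases i
    · exact h2.neg
    · exact contDiff_snd.comp contDiff_snd
    · exact contDiff_const

theorem smoothNear_genParam (hg : ContDiff ℝ ∞ g) (hq : 0 < q.2 2) :
    SmoothNear (genParam g) q := by
  filter_upwards [smoothNear_slice hq] with q' hq'
  have h1 := (contDiff_genPoint hg).contDiffAt.comp q' hq'
  have h2 := (contDiff_coord 2).contDiffAt (x := q')
  exact (h1.fst.fst.prodMk (h2.smul h1.fst.snd)).prodMk (h1.snd.fst.prodMk (h2.smul h1.snd.snd))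

end Generating

/-! ### The cusp conditions on the generating function -/

section CuspConditions

variable {g : GenArg → ℝ}

/-- The derivative along the diagonal of a function which is affine there. -/
theorem eventually_dd_diag {f : GenArg → ℝ} (hf : ContDiff ℝ ∞ f) {r : ℝ} {ℓ : V3 →L[ℝ] ℝ}
    (h : ∀ᶠ x in 𝓝 (0 : V3), f (diagArg x) = r + ℓ x) :
    ∀ᶠ x in 𝓝 (0 : V3), ∀ i, dd (dirX i) f (diagArg x) +
      basisVec i 0 * dd dirY f (diagArg x) = ℓ (basisVec i) := by
  filter_upwards [h.eventually_nhds] with x hx i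
  have h1 : HasFDerivAt (fun x => f (diagArg x)) _ x :=
    (hf.differentiable (by simp) _).hasFDerivAt.comp x diagArg.hasFDerivAt
  have h2 := h1.unique ((ℓ.hasFDerivAt.const_add r).congr_of_eventuallyEq hx)
  have h3 := congrArg (fun A : V3 →L[ℝ] ℝ => A (basisVec i)) h2
  rw [← h3, ← dd_smul, ← dd_add]
  change fderiv ℝ f _ _ = fderiv ℝ f _ (diagArg (basisVec i))
  congr 1
  simp [dirX, dirY, diagArg_apply]

theorem eventually_dd_diag_zero {f : GenArg → ℝ} (hf : ContDiff ℝ ∞ f)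
    (h : ∀ᶠ x in 𝓝 (0 : V3), f (diagArg x) = 0) :
    ∀ᶠ x in 𝓝 (0 : V3), ∀ i, dd (dirX i) f (diagArg x) +
      basisVec i 0 * dd dirY f (diagArg x) = 0 := by
  have := eventually_dd_diag hf (r := 0) (ℓ := 0) (by simpa using h)
  simpa using this

theorem dd_mul {f m : GenArg → ℝ} (hf : ContDiff ℝ ∞ f) (hm : ContDiff ℝ ∞ m) (w : GenArg) :
    dd w (fun z => f z * m z) = fun z => dd w f z * m z + f z * dd w m z := by
  funext z
  have h := (hf.differentiable (by simp) z).hasFDerivAt.mul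
    (hm.differentiable (by simp) z).hasFDerivAt
  have h1 : fderiv ℝ (fun z => f z * m z) z = _ := h.fderiv
  rw [dd, h1]
  simp only [_root_.add_apply, _root_.smul_apply, smul_eq_mul, dd]
  ring

theorem dd_fun_add {f m : GenArg → ℝ} (hf : ContDiff ℝ ∞ f) (hm : ContDiff ℝ ∞ m) (w : GenArg) :
    dd w (fun z => f z + m z) = fun z => dd w f z + dd w m z := by
  funext z
  have h1 : fderiv ℝ (fun z => f z + m z) z = _ := ((hf.differentiable (by simp) z).hasFDerivAt.add
    (hm.differentiable (by simp) z).hasFDerivAt).fderiv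
  rw [dd, h1]; rfl

theorem dd_fun_sub {f m : GenArg → ℝ} (hf : ContDiff ℝ ∞ f) (hm : ContDiff ℝ ∞ m) (w : GenArg) :
    dd w (fun z => f z - m z) = fun z => dd w f z - dd w m z := by
  funext z
  have h1 : fderiv ℝ (fun z => f z - m z) z = _ := ((hf.differentiable (by simp) z).hasFDerivAt.sub
    (hm.differentiable (by simp) z).hasFDerivAt).fderiv
  rw [dd, h1]; rfl

theorem contDiff_minor (hg : ContDiff ℝ ∞ g) (i k : Fin 3) : ContDiff ℝ ∞ (minor g i k) :=
  ((contDiff_dd (contDiff_dd hg _) _).mul (contDiff_dd hg _)).sub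
    ((contDiff_dd (contDiff_dd hg _) _).mul (contDiff_dd hg _))

theorem contDiff_genJac (hg : ContDiff ℝ ∞ g) : ContDiff ℝ ∞ (genJac g) :=
  (((contDiff_dd (contDiff_dd hg _) _).mul (contDiff_minor hg _ _)).sub
    ((contDiff_dd (contDiff_dd hg _) _).mul (contDiff_minor hg _ _))).add
    ((contDiff_dd (contDiff_dd hg _) _).mul (contDiff_minor hg _ _))

/-- Where `∂²g/∂x∂y₁` vanishes, only this column of the determinant has to be differentiated. -/
theorem dd_genJac (hg : ContDiff ℝ ∞ g) {z : GenArg} (h : ∀ i, dd dirY (dd (dirX i) g) z = 0)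
    (w : GenArg) : dd w (genJac g) z =
      dd w (dd dirY (dd (dirX 0) g)) z * minor g 1 2 z -
      dd w (dd dirY (dd (dirX 1) g)) z * minor g 0 2 z +
      dd w (dd dirY (dd (dirX 2) g)) z * minor g 0 1 z := by
  have ha := fun i => contDiff_dd (contDiff_dd hg (dirX i)) dirY
  have hm := contDiff_minor hg
  unfold genJac
  rw [dd_fun_add (((ha 0).mul (hm 1 2)).sub ((ha 1).mul (hm 0 2))) ((ha 2).mul (hm 0 1)),
    dd_fun_sub ((ha 0).mul (hm 1 2)) ((ha 1).mul (hm 0 2)), dd_mul (ha 0) (hm 1 2),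
    dd_mul (ha 1) (hm 0 2), dd_mul (ha 2) (hm 0 1)]
  simp [h]

theorem dd_dd_genJac (hg : ContDiff ℝ ∞ g) {z : GenArg} (h : ∀ i, dd dirY (dd (dirX i) g) z = 0)
    {w : GenArg} (h' : ∀ i, dd w (dd dirY (dd (dirX i) g)) z = 0) : dd w (dd w (genJac g)) z =
      dd w (dd w (dd dirY (dd (dirX 0) g))) z * minor g 1 2 z -
      dd w (dd w (dd dirY (dd (dirX 1) g))) z * minor g 0 2 z +
      dd w (dd w (dd dirY (dd (dirX 2) g))) z * minor g 0 1 z := by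
  have ha := fun i => contDiff_dd (contDiff_dd hg (dirX i)) dirY
  have hm := contDiff_minor hg
  have key : ∀ {f m : GenArg → ℝ} (hf : ContDiff ℝ ∞ f) (hm : ContDiff ℝ ∞ m),
      dd w (dd w (fun z => f z * m z)) = fun z => dd w (dd w f) z * m z +
        2 * (dd w f z * dd w m z) + f z * dd w (dd w m) z := by
    intro f m hf hm
    rw [dd_mul hf hm, dd_fun_add ((contDiff_dd hf w).mul hm) (hf.mul (contDiff_dd hm w)),
      dd_mul (contDiff_dd hf w) hm, dd_mul hf (contDiff_dd hm w)]
    funext z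
    ring
  unfold genJac
  rw [dd_fun_add (((ha 0).mul (hm 1 2)).sub ((ha 1).mul (hm 0 2))) ((ha 2).mul (hm 0 1)),
    dd_fun_sub ((ha 0).mul (hm 1 2)) ((ha 1).mul (hm 0 2)),
    dd_fun_add ((contDiff_dd ((ha 0).mul (hm 1 2)) w).sub (contDiff_dd ((ha 1).mul (hm 0 2)) w))
      (contDiff_dd ((ha 2).mul (hm 0 1)) w),
    dd_fun_sub (contDiff_dd ((ha 0).mul (hm 1 2)) w) (contDiff_dd ((ha 1).mul (hm 0 2)) w),
    key (ha 0) (hm 1 2), key (ha 1) (hm 0 2), key (ha 2) (hm 0 1)]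
  simp [h, h']

/-- The second derivative along a line is determined by the restriction to the line. -/
theorem second_fderiv_line {f : Phase → ℝ} {p w : Phase} (hf : SmoothNear f p) {F : GenArg → ℝ}
    (hF : ContDiff ℝ ∞ F) {z w' : GenArg} (h : ∀ᶠ t : ℝ in 𝓝 0, f (p + t • w) = F (z + t • w')) :
    fderiv ℝ (fderiv ℝ f) p w w = dd w' (dd w' F) z := by
  have hline : Tendsto (fun t : ℝ => p + t • w) (𝓝 0) (𝓝 p) := by
    have : ContinuousAt (fun t : ℝ => p + t • w) 0 := by fun_prop
    simpa [ContinuousAt] using this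
  have hlp : ∀ t : ℝ, HasDerivAt (fun t : ℝ => p + t • w) w t := fun t => by
    simpa using ((hasDerivAt_id t).smul_const w).const_add p
  have hlz : ∀ t : ℝ, HasDerivAt (fun t : ℝ => z + t • w') w' t := fun t => by
    simpa using ((hasDerivAt_id t).smul_const w').const_add z
  have h1 : ∀ᶠ t : ℝ in 𝓝 0, fderiv ℝ f (p + t • w) w = dd w' F (z + t • w') := by
    filter_upwards [hline.eventually hf, h.eventually_nhds] with t h2 h3
    have d1 := (h2.differentiableAt (by simp)).hasFDerivAt.comp_hasDerivAt t (hlp t)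
    have d2 := (hF.differentiable (by simp) (z + t • w')).hasFDerivAt.comp_hasDerivAt t (hlz t)
    exact d1.unique (d2.congr_of_eventuallyEq h3)
  have d1 : HasDerivAt (fun t : ℝ => fderiv ℝ f (p + t • w) w)
      (fderiv ℝ (fderiv ℝ f) p w w) 0 := by
    have h2 : HasFDerivAt (fderiv ℝ f) (fderiv ℝ (fderiv ℝ f) p) (p + (0 : ℝ) • w) := by
      rw [zero_smul, add_zero]; exact hf.fderiv.differentiableAt.hasFDerivAt
    exact (ContinuousLinearMap.apply ℝ ℝ w).hasFDerivAt.comp_hasDerivAt 0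
      (h2.comp_hasDerivAt 0 (hlp 0))
  have d2 : HasDerivAt (fun t : ℝ => dd w' F (z + t • w')) (dd w' (dd w' F) z) 0 := by
    have h2 := ((contDiff_dd hF w').differentiable (by simp)
      (z + (0 : ℝ) • w')).hasFDerivAt.comp_hasDerivAt 0 (hlz 0)
    rwa [zero_smul, add_zero] at h2
  exact d1.unique (d2.congr_of_eventuallyEq h1)

/-- The values of the derivatives of a generating function at the point `(x, x₁, 0)` of the diagonal,
which are forced when the diagonal is the cusp set and `∂/∂y₁` spans the kernel along it. The last
two express that the functions differentiated there in `x₁` are constant along the diagonal. -/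
structure DiagVanishing (g : GenArg → ℝ) (x : V3) : Prop where
  val : g (diagArg x) = x 2
  dT : dd dirT g (diagArg x) = x 1
  dY : dd dirY g (diagArg x) = 0
  dX : ∀ i, dd (dirX i) g (diagArg x) = basisVec 2 i
  dYX : ∀ i, dd dirY (dd (dirX i) g) (diagArg x) = 0
  dYT : dd dirY (dd dirT g) (diagArg x) = 0
  dTX : ∀ i, dd dirT (dd (dirX i) g) (diagArg x) = basisVec 1 i
  dYYX : ∀ i, dd dirY (dd dirY (dd (dirX i) g)) (diagArg x) = 0
  dYY : dd dirY (dd dirY g) (diagArg x) = 0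
  dYYY : dd dirY (dd dirY (dd dirY g)) (diagArg x) = 0
  dXYT : dd (dirX 0) (dd dirY (dd dirT g)) (diagArg x) = -dd dirY (dd dirY (dd dirT g)) (diagArg x)
  dXYYY : dd (dirX 0) (dd dirY (dd dirY (dd dirY g))) (diagArg x) =
    -dd dirY (dd dirY (dd dirY (dd dirY g))) (diagArg x)

theorem diagPt_two_pos (x : V3) : 0 < (diagPt x).2 2 := by simp [diagPt]

theorem fderiv_homog_diagPt {F : GenArg → ℝ} (hF : ContDiff ℝ ∞ F) (x : V3) (w : Phase) :
    fderiv ℝ (homog F) (diagPt x) w = w.2 2 * F (diagArg x) +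
      dd (w.1, w.2 0, w.2 1) F (diagArg x) := by
  rw [fderiv_homog hF (diagPt_two_pos x), slice_diagPt]
  simp [diagPt]

theorem jac_genParam_eventuallyEq (hg : ContDiff ℝ ∞ g) (x : V3) :
    jac (Prod.fst ∘ genParam g) =ᶠ[𝓝 (diagPt x)] homog (genJac g) := by
  filter_upwards [eventually_coord_pos (diagPt_two_pos x)] with q hq using jac_genParam hg hq

theorem minor_of_diag {x : V3} (h1 : ∀ i, dd (dirX i) g (diagArg x) = basisVec 2 i)
    (h2 : ∀ i, dd dirT (dd (dirX i) g) (diagArg x) = basisVec 1 i) :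
    minor g 1 2 (diagArg x) = 1 ∧ minor g 0 2 (diagArg x) = 0 ∧ minor g 0 1 (diagArg x) = 0 := by
  simp [minor, h1, h2, basisVec_apply]

/-- The position of the diagonal gives the derivatives of first order. Since the kernel is in the
direction of `y₁`, the functions `∂²g/∂x∂y₁` and `∂²g/∂τ∂y₁` vanish, and since it is tangent to the
singular set, `∂³g/∂x₁∂y₁²` does. Differentiating these identities along the diagonal gives the
others. -/
theorem eventually_diagVanishing (hg : ContDiff ℝ ∞ g)
    (h1 : ∀ᶠ x in 𝓝 (0 : V3), genPoint g (diagArg x) = ((x, basisVec 2), (x, basisVec 2)))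
    (h2 : ∀ᶠ x in 𝓝 (0 : V3), IsCusp (Prod.fst ∘ genParam g) (diagPt x))
    (h3 : ∀ᶠ x in 𝓝 (0 : V3), ∀ w, (fderiv ℝ (genParam g) (diagPt x) w).1 = 0 →
      ∃ r : ℝ, (fderiv ℝ (genParam g) (diagPt x) w).2 = (r • basisVec 0, 0)) :
    ∀ᶠ x in 𝓝 (0 : V3), DiagVanishing g x := by
  have hX := fun i => contDiff_dd hg (dirX i)
  have hY := contDiff_dd hg dirY
  have hT := contDiff_dd hg dirT
  have e1 : ∀ᶠ x in 𝓝 (0 : V3), g (diagArg x) = x 2 ∧ dd dirT g (diagArg x) = x 1 ∧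
      dd dirY g (diagArg x) = 0 ∧ ∀ i, dd (dirX i) g (diagArg x) = basisVec 2 i := by
    filter_upwards [h1] with x hx
    have a1 := congrArg (fun c : Phase × Phase => c.2.1 1) hx
    have a2 := congrArg (fun c : Phase × Phase => c.2.1 2) hx
    have a3 := congrArg (fun c : Phase × Phase => c.2.2 0) hx
    refine ⟨?_, ?_, ?_, fun i => congrArg (fun c : Phase × Phase => c.1.2 i) hx⟩
    · simpa [genPoint, diagArg_apply] using a2
    · simpa [genPoint, diagArg_apply] using a1
    · simpa [genPoint, diagArg_apply, basisVec_apply] using a3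
  -- the kernel of the projection is spanned by the direction of `y₁`
  have e2 : ∀ᶠ x in 𝓝 (0 : V3), (∀ i, dd dirY (dd (dirX i) g) (diagArg x) = 0) ∧
      dd dirY (dd dirT g) (diagArg x) = 0 ∧
      fderiv ℝ (Prod.fst ∘ genParam g) (diagPt x) (0, basisVec 0) = 0 := by
    filter_upwards [h2, h3] with x hx hk
    have hpos := diagPt_two_pos x
    have hd := (smoothNear_genParam hg hpos).differentiableAt
    obtain ⟨w, hw, hw0⟩ : ∃ w, fderiv ℝ (Prod.fst ∘ genParam g) (diagPt x) w = 0 ∧ w ≠ 0 := by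
      by_contra! h0
      exact (det_ne_zero_iff_injective _).2 h0 (jac_eq_zero_of_rank hx.1)
    have hw' := hw
    rw [fderiv_fst_comp hd] at hw'
    obtain ⟨r, hr⟩ := hk w hw'
    have c1 : fderiv ℝ (homog fun z => z.2.2) (diagPt x) w = 0 := by
      have d1 : HasFDerivAt (fun q => (genParam g q).2.2 1) _ (diagPt x) :=
        (EuclideanSpace.proj (𝕜 := ℝ) (1 : Fin 3)).hasFDerivAt.comp _ hd.hasFDerivAt.snd.snd
      have d2 : (homog fun z => z.2.2) = fun q => (genParam g q).2.2 1 := rfl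
      rw [d2, d1.fderiv]
      change (fderiv ℝ (genParam g) (diagPt x) w).2.2 1 = 0
      rw [hr]; rfl
    have c2 : fderiv ℝ (homog fun _ => 1) (diagPt x) w = 0 := by
      have d1 : HasFDerivAt (fun q => (genParam g q).2.2 2) _ (diagPt x) :=
        (EuclideanSpace.proj (𝕜 := ℝ) (2 : Fin 3)).hasFDerivAt.comp _ hd.hasFDerivAt.snd.snd
      have d2 : (homog fun _ => 1) = fun q => (genParam g q).2.2 2 := rfl
      rw [d2, d1.fderiv]
      change (fderiv ℝ (genParam g) (diagPt x) w).2.2 2 = 0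
      rw [hr]; rfl
    have c3 : fderiv ℝ (fun q => dd dirT g (slice q)) (diagPt x) w = 0 := by
      have d1 : HasFDerivAt (fun q => (genParam g q).2.1 1) _ (diagPt x) :=
        (EuclideanSpace.proj (𝕜 := ℝ) (1 : Fin 3)).hasFDerivAt.comp _ hd.hasFDerivAt.snd.fst
      have d2 : (fun q => dd dirT g (slice q)) = fun q => (genParam g q).2.1 1 := rfl
      rw [d2, d1.fderiv]
      change (fderiv ℝ (genParam g) (diagPt x) w).2.1 1 = 0
      rw [hr]; simp [basisVec_apply]
    rw [fderiv_homog_diagPt (by fun_prop)] at c1 c2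
    have hw1 : w.1 = 0 := by
      rw [← (fderiv_fst_genParam hg hpos w).1, hw]; rfl
    have hw22 : w.2 2 = 0 := by simpa [dd] using c2
    have hw21 : w.2 1 = 0 := by
      have h4 : fderiv ℝ (fun z : GenArg => z.2.2) (diagArg x) =
          (ContinuousLinearMap.snd ℝ ℝ ℝ).comp (ContinuousLinearMap.snd ℝ V3 (ℝ × ℝ)) :=
        ((ContinuousLinearMap.snd ℝ ℝ ℝ).comp (ContinuousLinearMap.snd ℝ V3 (ℝ × ℝ))).fderiv
      rw [hw22, zero_mul, zero_add, dd, h4] at c1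
      exact c1
    have hw2 : w = w.2 0 • ((0, basisVec 0) : Phase) := by
      refine Prod.ext (by simp [hw1]) ?_
      ext i
      fin_cases i <;> simp [basisVec_apply, hw21, hw22]
    have hw20 : w.2 0 ≠ 0 := by
      intro h0
      rw [h0, zero_smul] at hw2
      exact hw0 hw2
    rw [hw2, map_smul] at hw
    have hk0 := (smul_eq_zero.1 hw).resolve_left hw20
    refine ⟨fun i => ?_, ?_, hk0⟩
    · have h5 := (fderiv_fst_genParam hg hpos (0, basisVec 0)).2 i
      rw [hk0, fderiv_homog_diagPt (hX i), dd_vertical] at h5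
      simpa [basisVec_apply] using h5.symm
    · rw [fderiv_comp_slice hT hpos, hw1, hw21, hw22, slice_diagPt, dd_vertical] at c3
      simpa [hw20] using c3
  have e3 : ∀ᶠ x in 𝓝 (0 : V3), ∀ i, dd dirT (dd (dirX i) g) (diagArg x) = basisVec 1 i := by
    filter_upwards [eventually_dd_diag hT (r := 0) (ℓ := EuclideanSpace.proj 1)
      (by filter_upwards [e1] with x hx; simpa using hx.2.1), e2] with x hx hx' i
    have h4 := hx i
    rw [hx'.2.1, mul_zero, add_zero, dd_comm hg] at h4
    rw [h4]
    simp [basisVec_apply, eq_comm]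
  -- the kernel is tangent to the singular set
  have e4 : ∀ᶠ x in 𝓝 (0 : V3), dd dirY (dd dirY (dd (dirX 0) g)) (diagArg x) = 0 := by
    filter_upwards [h2, e1, e2, e3] with x hx h4 h5 h6
    have h7 := hx.2.1 _ h5.2.2
    rw [(jac_genParam_eventuallyEq hg x).fderiv_eq, fderiv_homog_diagPt (contDiff_genJac hg),
      dd_vertical, dd_genJac hg h5.1, (minor_of_diag h4.2.2.2 h6).1,
      (minor_of_diag h4.2.2.2 h6).2.1, (minor_of_diag h4.2.2.2 h6).2.2] at h7
    simpa [basisVec_apply] using h7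
  have e5 : ∀ᶠ x in 𝓝 (0 : V3), dd dirY (dd dirY g) (diagArg x) = 0 := by
    filter_upwards [eventually_dd_diag_zero hY (e1.mono fun x hx => hx.2.2.1), e2] with x h4 h5
    have h6 := h4 0
    rw [dd_comm hg, h5.1 0] at h6
    simpa [basisVec_apply] using h6
  have hYY := contDiff_dd hY dirY
  have e6 := eventually_dd_diag_zero hYY e5
  have e7 : ∀ᶠ x in 𝓝 (0 : V3), dd dirY (dd dirY (dd dirY g)) (diagArg x) = 0 := by
    filter_upwards [e6, e4] with x h4 h5
    have h6 := h4 0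
    rw [dd_comm hY, dd_comm hg, h5] at h6
    simpa [basisVec_apply] using h6
  have e8 := eventually_dd_diag_zero (contDiff_dd hYY dirY) e7
  have e9 := eventually_dd_diag_zero (contDiff_dd hT dirY) (e2.mono fun x hx => hx.2.1)
  filter_upwards [e1, e2, e3, e5, e6, e7, e8, e9] with x a1 a2 a3 a5 a6 a7 a8 a9
  refine ⟨a1.1, a1.2.1, a1.2.2.1, a1.2.2.2, a2.1, a2.2.1, a3, fun i => ?_, a5, a7, ?_, ?_⟩
  · have h4 := a6 i
    rw [a7, mul_zero, add_zero, dd_comm hY, dd_comm hg] at h4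
    exact h4
  · have h4 := a9 0
    simp only [basisVec_apply, if_true, one_mul] at h4
    linarith
  · have h4 := a8 0
    simp only [basisVec_apply, if_true, one_mul] at h4
    linarith

theorem dd_eq_sum (u : V3) (r s : ℝ) (F : GenArg → ℝ) (z : GenArg) :
    dd (u, r, s) F z = u 0 * dd (dirX 0) F z + u 1 * dd (dirX 1) F z + u 2 * dd (dirX 2) F z +
      r * dd dirY F z + s * dd dirT F z := by
  have h : ((u, r, s) : GenArg) =
      u 0 • dirX 0 + u 1 • dirX 1 + u 2 • dirX 2 + r • dirY + s • dirT := by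
    conv_lhs => rw [eq_sum_basisVec u]
    simp [dirX, dirY, dirT]
  rw [h, dd_add, dd_add, dd_add, dd_add, dd_smul, dd_smul, dd_smul, dd_smul, dd_smul]

/-- The cusp condition of third order: differentiating the kernel equation along the singular set
shows that a kernel field may be replaced by `∂/∂y₁`. -/
theorem IsCusp.genJac_ne_zero (hg : ContDiff ℝ ∞ g)
    (hv : ∀ᶠ x in 𝓝 (0 : V3), DiagVanishing g x)
    (hc : IsCusp (Prod.fst ∘ genParam g) (diagPt 0)) :
    dd dirT (genJac g) 0 ≠ 0 ∧ dd dirY (dd dirY (dd dirT g)) 0 ≠ 0 ∧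
      dd dirY (dd dirY (dd dirY (dd dirY g))) 0 ≠ 0 := by
  have hX := fun i => contDiff_dd hg (dirX i)
  have hY := contDiff_dd hg dirY
  have hT := contDiff_dd hg dirT
  have ha0 := contDiff_dd (hX 0) dirY
  have hJs := contDiff_genJac hg
  have h0 := hv.self_of_nhds
  have hd0 : diagArg 0 = 0 := map_zero diagArg
  obtain ⟨m1, m2, m3⟩ := minor_of_diag h0.dX h0.dTX
  have hpos := diagPt_two_pos 0
  have hπ := smoothNear_fst_genParam hg hpos
  set π := Prod.fst ∘ genParam g with hπdef
  have hJe := jac_genParam_eventuallyEq hg 0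
  have hJsm : SmoothNear (jac π) (diagPt 0) := hπ.jac
  have hj : ∀ w, dd w (genJac g) (diagArg 0) = dd w (dd dirY (dd (dirX 0) g)) (diagArg 0) := by
    intro w
    rw [dd_genJac hg h0.dYX, m1, m2, m3]; ring
  obtain ⟨κ, hκ⟩ : ∃ κ, κ = dd dirT (genJac g) (diagArg 0) := ⟨_, rfl⟩
  have hJ0 : genJac g (diagArg 0) = 0 := by
    simp only [genJac, h0.dYX]; ring
  have hXa := (eventually_dd_diag_zero ha0 (hv.mono fun x hx => hx.dYX 0)).self_of_nhds
  simp only [h0.dYYX, mul_zero, add_zero] at hXa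
  have hdJ : ∀ w, fderiv ℝ (jac π) (diagPt 0) w = w.2 1 * κ := by
    intro w
    rw [hJe.fderiv_eq, fderiv_homog_diagPt hJs, hJ0, dd_eq_sum, hκ]
    simp only [hj, hXa, h0.dYYX]
    ring
  -- the differential of `ξ₂` is proportional to that of the Jacobian
  obtain ⟨π₁, hπ₁⟩ : ∃ π₁, π₁ = homog (dd (dirX 1) g) := ⟨_, rfl⟩
  have hπ₁s : SmoothNear π₁ (diagPt 0) := hπ₁ ▸ smoothNear_homog (hX 1) hpos
  have hdπ₁ : ∀ w, fderiv ℝ π₁ (diagPt 0) w = w.2 1 := by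
    intro w
    have h1 := (eventually_dd_diag_zero (hX 1) (hv.mono fun x hx => by
      rw [hx.dX 1]; simp [basisVec_apply])).self_of_nhds
    simp only [h0.dYX, mul_zero, add_zero] at h1
    rw [hπ₁, fderiv_homog_diagPt (hX 1), dd_eq_sum w.1]
    simp only [h1, h0.dX, h0.dYX, h0.dTX, basisVec_apply]
    simp
  obtain ⟨⟨hrank, hdJne⟩, -, N, v, hN, hpN, hvs, hvp, hvker, hvd⟩ := hc
  have hJz : jac π (diagPt 0) = 0 := by
    rw [hJe.eq_of_nhds, homog, slice_diagPt, hJ0, mul_zero]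
  have hvS : SmoothNear v (diagPt 0) := ContDiffOn.smoothNear hvs hN hpN
  have hκ0 : κ ≠ 0 := by
    rintro rfl
    exact hdJne (ContinuousLinearMap.ext fun w => by rw [hdJ, mul_zero]; rfl)
  -- the kernel is spanned by the direction of `y₁`
  obtain ⟨r, hr, hvr⟩ : ∃ r : ℝ, r ≠ 0 ∧ v (diagPt 0) = r • ((0, basisVec 0) : Phase) := by
    have hk := hvker _ hpN hJz
    have h1 : (v (diagPt 0)).1 = 0 := by
      rw [← (fderiv_fst_genParam hg hpos _).1, ← hπdef, hk]; rfl
    have h2 : ∀ i, fderiv ℝ (homog (dd (dirX i) g)) (diagPt 0) (v (diagPt 0)) = 0 := fun i => by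
      rw [← (fderiv_fst_genParam hg hpos _).2, ← hπdef, hk]; rfl
    have h3 : (v (diagPt 0)).2 1 = 0 := by rw [← hdπ₁, hπ₁]; exact h2 1
    have h4 : (v (diagPt 0)).2 2 = 0 := by
      have := h2 2
      rw [fderiv_homog_diagPt (hX 2), h1, h3, dd_vertical, h0.dX, h0.dYX] at this
      simpa [basisVec_apply] using this
    have h5 : v (diagPt 0) = (v (diagPt 0)).2 0 • ((0, basisVec 0) : Phase) := by
      refine Prod.ext (by simp [h1]) ?_
      ext i
      fin_cases i <;> simp [basisVec_apply, h3, h4]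
    refine ⟨_, fun h6 => ?_, h5⟩
    rw [h6, zero_smul] at h5
    exact hvp h5
  set e : Phase := (0, basisVec 0) with he
  have hline : ∀ (F : GenArg → ℝ) (t : ℝ), homog F (diagPt 0 + t • e) = F (diagArg 0 + t • dirY) := by
    intro F t
    simp [homog, slice, diagPt, diagArg_apply, e, dirY, basisVec_apply]
  have hprod : ∀ {k : Phase → ℝ}, SmoothNear k (diagPt 0) →
      fderiv ℝ (fun q => fderiv ℝ k q (v q)) (diagPt 0) (v (diagPt 0)) =
        r ^ 2 * fderiv ℝ (fderiv ℝ k) (diagPt 0) e e +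
          fderiv ℝ k (diagPt 0) (fderiv ℝ v (diagPt 0) (v (diagPt 0))) := by
    intro k hk
    have h1 : HasFDerivAt (fun q => fderiv ℝ k q (v q)) _ (diagPt 0) :=
      hk.fderiv.differentiableAt.hasFDerivAt.clm_apply hvS.differentiableAt.hasFDerivAt
    have h2 : fderiv ℝ (fderiv ℝ k) (diagPt 0) (v (diagPt 0)) (v (diagPt 0)) =
        r ^ 2 * fderiv ℝ (fderiv ℝ k) (diagPt 0) e e := by
      rw [hvr]
      simp only [map_smul, _root_.smul_apply, smul_eq_mul]
      ring
    rw [h1.fderiv, ← h2]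
    simp [add_comm]
  -- the derivative of the field has no component which changes the Jacobian
  have hvd1 : (fderiv ℝ v (diagPt 0) (v (diagPt 0))).2 1 = 0 := by
    have hk : SmoothNear (fun q => fderiv ℝ π₁ q (v q)) (diagPt 0) := by
      filter_upwards [hπ₁s.fderiv, hvS] with q h1 h2 using h1.clm_apply h2
    have hx : SmoothNear (fun q : Phase => q.1 0) (diagPt 0) :=
      ContDiff.smoothNear ((EuclideanSpace.proj (𝕜 := ℝ) (0 : Fin 3)).contDiff.comp contDiff_fst) _
    have hxd : ∀ w, fderiv ℝ (fun q : Phase => q.1 0) (diagPt 0) w = w.1 0 := by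
      intro w
      have h1 : HasFDerivAt (fun q : Phase => q.1 0)
          ((EuclideanSpace.proj (𝕜 := ℝ) (0 : Fin 3)).comp (ContinuousLinearMap.fst ℝ V3 V3))
          (diagPt 0) :=
        ((EuclideanSpace.proj (𝕜 := ℝ) (0 : Fin 3)).comp
          (ContinuousLinearMap.fst ℝ V3 V3)).hasFDerivAt
      rw [h1.fderiv]; rfl
    have h1 := fderiv_eq_zero_of_vanishing hJsm hx hk hJz (by simp [diagPt]) (by
        intro a b
        refine ⟨(b • basisVec 0, (a / κ) • basisVec 1), ?_, ?_⟩
        · rw [hdJ]; simp [basisVec_apply, hκ0]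
        · rw [hxd]; simp [basisVec_apply]) (by
        filter_upwards [hN.mem_nhds hpN, eventually_coord_pos hpos] with q h1 h2 h3 _
        rw [hπ₁, ← (fderiv_fst_genParam hg h2 _).2, ← hπdef, hvker q h1 h3]; rfl)
      (w := v (diagPt 0)) (by rw [hdJ, hvr]; simp [e, basisVec_apply])
      (by rw [hxd, hvr]; simp [e])
    rw [hprod hπ₁s, second_fderiv_line hπ₁s (hX 1) (Eventually.of_forall fun t => by
      rw [hπ₁]; exact hline _ t), h0.dYYX, hdπ₁] at h1
    linarith
  have hthird : dd dirY (dd dirY (genJac g)) (diagArg 0) ≠ 0 := by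
    intro h1
    apply hvd
    rw [hprod hJsm, hdJ, hvd1, second_fderiv_line hJsm hJs (z := diagArg 0) (w' := dirY) ?_, h1]
    · ring
    · have h2 : Tendsto (fun t : ℝ => diagPt 0 + t • e) (𝓝 0) (𝓝 (diagPt 0)) := by
        have : ContinuousAt (fun t : ℝ => diagPt 0 + t • e) 0 := by fun_prop
        simpa [ContinuousAt] using this
      filter_upwards [h2.eventually hJe] with t h3
      rw [h3, hline]
  rw [dd_dd_genJac hg h0.dYX h0.dYYX, m1, m2, m3, dd_comm (contDiff_dd (hX 0) dirY) dirY dirY,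
    dd_comm hg dirY (dirX 0), dd_comm hY dirY (dirX 0), dd_comm (contDiff_dd hY dirY) dirY (dirX 0),
    h0.dXYYY] at hthird
  have hT' : dd dirT (genJac g) (diagArg 0) = dd (dirX 0) (dd dirY (dd dirT g)) (diagArg 0) := by
    rw [hj, dd_comm (hX 0), dd_comm hg dirT (dirX 0), dd_comm hT dirY (dirX 0)]
  rw [hd0] at hκ hthird hT'
  refine ⟨hκ ▸ hκ0, fun h1 => hκ0 ?_, fun h1 => hthird ?_⟩
  · rw [hκ, hT']
    have := h0.dXYT
    rw [hd0, h1, neg_zero] at this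
    exact this
  · rw [h1]; ring

end CuspConditions

/-! ### The normal form of the generating function -/

section NormalForm

variable {g : GenArg → ℝ}

theorem tendsto_diagArg : Tendsto diagArg (𝓝 0) (𝓝 0) := by
  simpa using diagArg.continuous.tendsto 0

theorem iteratedDeriv_succ_sub_const (f : ℝ → ℝ) (r : ℝ) (n : ℕ) :
    iteratedDeriv (n + 1) (fun t => f t - r) = iteratedDeriv (n + 1) f := by
  rw [iteratedDeriv_succ', iteratedDeriv_succ']
  congr 1
  funext t
  exact deriv_sub_const r

/-- Taylor expansion of `g` in `τ` at `τ = 0`: the constant term is `x₃` up to fourth order in `y₁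
- x₁`, and the linear term is `x₂` up to second order. -/
theorem exists_normal_form (hg : ContDiff ℝ ∞ g)
    (hv : ∀ᶠ x in 𝓝 (0 : V3), DiagVanishing g x)
    (h2 : dd dirY (dd dirY (dd dirT g)) 0 ≠ 0)
    (h4 : dd dirY (dd dirY (dd dirY (dd dirY g))) 0 ≠ 0) :
    ∃ (a : GenArg → ℝ) (s₃ s₄ : V3 × ℝ → ℝ), ContDiff ℝ ∞ a ∧ ContDiff ℝ ∞ s₃ ∧
      ContDiff ℝ ∞ s₄ ∧ s₃ (0, 0) ≠ 0 ∧ s₄ (0, 0) ≠ 0 ∧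
      ∀ᶠ z in 𝓝 (0 : GenArg), g z = z.1 2 + z.2.2 * (z.1 1 + z.2.2 * a z +
        (z.1 0 - z.2.1) ^ 2 * s₄ (z.1, z.2.1)) + (z.1 0 - z.2.1) ^ 4 * s₃ (z.1, z.2.1) := by
  have hT := contDiff_dd hg dirT
  have hc : ∀ i : Fin 3, ContDiff ℝ ∞ fun p : V3 × ℝ => p.1 i := fun i =>
    (EuclideanSpace.proj (𝕜 := ℝ) i).contDiff.comp contDiff_fst
  let L : V3 × ℝ →L[ℝ] GenArg := diagArg.comp (ContinuousLinearMap.fst ℝ V3 ℝ) +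
    (ContinuousLinearMap.snd ℝ V3 ℝ).smulRight dirY
  have hL : ∀ p : V3 × ℝ, L p = diagArg p.1 + p.2 • dirY := fun p => rfl
  -- expansion in `y₁ - x₁` on `τ = 0`
  obtain ⟨k₃, hk₃, hk₃', hk₃0⟩ := exists_eq_pow_mul (f := fun p : V3 × ℝ => g (L p) - p.1 2)
    ((hg.comp L.contDiff).sub (hc 2)) 0 4 (by
      intro k hk
      filter_upwards [hv] with x hx
      simp only [hL]
      rcases k with - | k
      · simp [hx.val]
      · rw [iteratedDeriv_succ_sub_const, iteratedDeriv_line hg]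
        simp only [zero_smul, add_zero]
        have hk' : k < 3 := by omega
        interval_cases k
        · exact hx.dY
        · exact hx.dYY
        · exact hx.dYYY)
  obtain ⟨k₄, hk₄, hk₄', hk₄0⟩ := exists_eq_pow_mul
    (f := fun p : V3 × ℝ => dd dirT g (L p) - p.1 1)
    ((hT.comp L.contDiff).sub (hc 1)) 0 2 (by
      intro k hk
      filter_upwards [hv] with x hx
      simp only [hL]
      rcases k with - | k
      · simp [hx.dT]
      · rw [iteratedDeriv_succ_sub_const, iteratedDeriv_line hT]
        simp only [zero_smul, add_zero]
        obtain rfl : k = 0 := by omega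
        exact hx.dYT)
  -- expansion in `τ`
  let M : (V3 × ℝ) × ℝ →L[ℝ] GenArg :=
    ((ContinuousLinearMap.fst ℝ V3 ℝ).comp (ContinuousLinearMap.fst ℝ (V3 × ℝ) ℝ)).prod
      (((ContinuousLinearMap.snd ℝ V3 ℝ).comp (ContinuousLinearMap.fst ℝ (V3 × ℝ) ℝ)).prod
        (ContinuousLinearMap.snd ℝ (V3 × ℝ) ℝ))
  have hM : ∀ (p : V3 × ℝ) (t : ℝ), M (p, t) = (p.1, p.2, 0) + t • dirT := fun p t => by
    simp [M, dirT]
  let M₀ : (V3 × ℝ) × ℝ →L[ℝ] GenArg := M.comp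
    ((ContinuousLinearMap.fst ℝ (V3 × ℝ) ℝ).prod 0)
  have hM₀ : ∀ (p : V3 × ℝ) (t : ℝ), M₀ (p, t) = (p.1, p.2, 0) := fun p t => rfl
  obtain ⟨a, ha, ha', -⟩ := exists_eq_pow_mul
    (f := fun p : (V3 × ℝ) × ℝ => g (M p) - g (M₀ p) - p.2 * dd dirT g (M₀ p))
    (((hg.comp M.contDiff).sub (hg.comp M₀.contDiff)).sub
      (contDiff_snd.mul (hT.comp M₀.contDiff))) 0 2 (by
      intro k hk
      refine Eventually.of_forall fun p => ?_
      simp only [hM, hM₀]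
      interval_cases k
      · simp
      · rw [iteratedDeriv_one]
        have h5 := congrFun (iteratedDeriv_line hg (p.1, p.2, 0) dirT 1) 0
        rw [iteratedDeriv_one] at h5
        have h6 : DifferentiableAt ℝ (fun t : ℝ => g ((p.1, p.2, 0) + t • dirT)) 0 := by
          have := hg.differentiable (by simp)
          fun_prop
        have h7 := ((h6.hasDerivAt.sub_const (g (p.1, p.2, 0))).sub
          ((hasDerivAt_id (0 : ℝ)).mul_const (dd dirT g (p.1, p.2, 0)))).deriv
        refine h7.trans ?_
        rw [h5]
        simp)
  refine ⟨fun z => a ((z.1, z.2.1), z.2.2), fun p => k₃ (p.1, p.2 - p.1 0),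
    fun p => k₄ (p.1, p.2 - p.1 0), ha.comp (by fun_prop),
    hk₃.comp (contDiff_fst.prodMk (contDiff_snd.sub (hc 0))),
    hk₄.comp (contDiff_fst.prodMk (contDiff_snd.sub (hc 0))), ?_, ?_, ?_⟩
  · intro h0
    apply h4
    have h5 := hk₃0.self_of_nhds
    simp only [hL] at h5
    rw [iteratedDeriv_succ_sub_const, iteratedDeriv_line hg] at h5
    simp only [zero_smul, add_zero, map_zero] at h5
    refine h5.trans ?_
    have h6 : k₃ (0, 0) = 0 := by simpa using h0
    rw [h6, mul_zero]
  · intro h0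
    apply h2
    have h5 := hk₄0.self_of_nhds
    simp only [hL] at h5
    rw [iteratedDeriv_succ_sub_const, iteratedDeriv_line hT] at h5
    simp only [zero_smul, add_zero, map_zero] at h5
    refine h5.trans ?_
    have h6 : k₄ (0, 0) = 0 := by simpa using h0
    rw [h6, mul_zero]
  · have t1 : Tendsto (fun z : GenArg => z.1) (𝓝 0) (𝓝 0) := continuous_fst.tendsto 0
    have t2 : Tendsto (fun z : GenArg => (z.1, z.2.1)) (𝓝 0) (𝓝 0) :=
      (show Continuous fun z : GenArg => (z.1, z.2.1) by fun_prop).tendsto 0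
    filter_upwards [t1.eventually hk₃', t1.eventually hk₄', t2.eventually ha'] with z h5 h6 h7
    have e1 := h5 (z.2.1 - z.1 0)
    have e2 := h6 (z.2.1 - z.1 0)
    have e3 := h7 z.2.2
    have e4 : L (z.1, z.2.1 - z.1 0) = (z.1, z.2.1, 0) := by
      simp [hL, diagArg_apply, dirY]
    have e5 : M ((z.1, z.2.1), z.2.2) = z := rfl
    rw [e4] at e1 e2
    rw [hM₀, e5] at e3
    simp only at e1 e2 e3
    linear_combination e3 + e1 + z.2.2 * e2

/-- By the implicit function theorem the zero set of the Jacobian is a graph over `(x, y₁)`. -/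
theorem exists_singular_graph (hg : ContDiff ℝ ∞ g)
    (hv : ∀ᶠ x in 𝓝 (0 : V3), DiagVanishing g x) (h1 : dd dirT (genJac g) 0 ≠ 0) :
    ∃ f : V3 × ℝ → ℝ, SmoothNear f 0 ∧ (∀ᶠ x in 𝓝 (0 : V3), f (x, x 0) = 0) ∧
      ∀ᶠ z in 𝓝 (0 : GenArg), genJac g z = 0 ↔ z.2.2 = f (z.1, z.2.1) := by
  have hJ := contDiff_genJac hg
  let Φ : GenArg → GenArg := fun z => (z.1, z.2.1, genJac g z)
  have hΦ : ContDiff ℝ ∞ Φ := contDiff_fst.prodMk ((contDiff_fst.comp contDiff_snd).prodMk hJ)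
  have hd : HasFDerivAt Φ _ 0 := hasFDerivAt_fst.prodMk
    ((hasFDerivAt_fst.comp 0 hasFDerivAt_snd).prodMk
      (hJ.differentiable (by simp) 0).hasFDerivAt)
  obtain ⟨e, he0, heΦ, hes, hes'⟩ :=
    (ContDiff.smoothNear hΦ 0).exists_openPartialHomeomorph_of_injective rfl (by
      intro v hv0
      rw [hd.fderiv] at hv0
      have a1 : v.1 = 0 := congrArg (fun z : GenArg => z.1) hv0
      have a2 : v.2.1 = 0 := congrArg (fun z : GenArg => z.2.1) hv0
      have a3 : dd v (genJac g) 0 = 0 := congrArg (fun z : GenArg => z.2.2) hv0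
      have a4 : v = (0, 0, v.2.2) := Prod.ext a1 (Prod.ext a2 rfl)
      rw [a4, dd_vertical, zero_mul, zero_add, mul_eq_zero, or_iff_left h1] at a3
      rw [a4, a3]; rfl)
  have hdiag : ∀ᶠ x in 𝓝 (0 : V3), genJac g (diagArg x) = 0 := by
    filter_upwards [hv] with x hx
    simp only [genJac, hx.dYX]; ring
  have hΦ0 : e 0 = 0 := by
    have h3 := hdiag.self_of_nhds
    rw [map_zero] at h3
    rw [heΦ]
    simp only [Φ, h3]; rfl
  have ht0 : (0 : GenArg) ∈ e.target := hΦ0 ▸ e.map_source he0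
  let ι : V3 × ℝ → GenArg := fun p => (p.1, p.2, 0)
  have hι : ContDiff ℝ ∞ ι := contDiff_fst.prodMk (contDiff_snd.prodMk contDiff_const)
  have hf : SmoothNear (fun p => (e.symm (ι p)).2.2) 0 := by
    have h3 : SmoothNear (fun p => e.symm (ι p)) 0 :=
      SmoothNear.comp (g := e.symm) (ContDiffOn.smoothNear hes' e.open_target ht0)
        (ContDiff.smoothNear hι 0)
    filter_upwards [h3] with p h4 using h4.snd.snd
  have t2 : Tendsto (fun z : GenArg => ι (z.1, z.2.1)) (𝓝 0) (𝓝 0) :=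
    (show Continuous fun z : GenArg => ι (z.1, z.2.1) by fun_prop).tendsto 0
  have hiff : ∀ᶠ z in 𝓝 (0 : GenArg), genJac g z = 0 ↔ z.2.2 = (e.symm (ι (z.1, z.2.1))).2.2 := by
    filter_upwards [e.open_source.mem_nhds he0, t2.eventually (e.open_target.mem_nhds ht0)]
      with z h3 h4
    constructor
    · intro h5
      have h6 : ι (z.1, z.2.1) = e z := by
        rw [heΦ]
        simp only [ι, Φ, h5]
      rw [h6, e.left_inv h3]
    · intro h5
      have h6 : Φ (e.symm (ι (z.1, z.2.1))) = ι (z.1, z.2.1) := by rw [← heΦ, e.right_inv h4]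
      have h9 : (e.symm (ι (z.1, z.2.1))).1 = z.1 := by
        have := congrArg (fun z : GenArg => z.1) h6
        exact this
      have h8 : (e.symm (ι (z.1, z.2.1))).2.1 = z.2.1 := by
        have := congrArg (fun z : GenArg => z.2.1) h6
        exact this
      have h7 : e.symm (ι (z.1, z.2.1)) = z := Prod.ext h9 (Prod.ext h8 h5.symm)
      rw [h7] at h6
      exact congrArg (fun z : GenArg => z.2.2) h6
  refine ⟨_, hf, ?_, hiff⟩
  filter_upwards [hdiag, tendsto_diagArg.eventually hiff] with x h3 h4
  exact (h4.1 h3).symm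

end NormalForm

/-! ### The generating function of a straightened relation -/

section FromRelation

variable {C : Set (Phase × Phase)}

/-- The diagonal point `(x, dx₃; x, dx₃)`. -/
def diagCov (x : V3) : Phase × Phase := ((x, basisVec 2), (x, basisVec 2))

theorem tendsto_diagCov : Tendsto diagCov (𝓝 0) (𝓝 basePoint) := by
  have : Continuous diagCov := by unfold diagCov; fun_prop
  exact this.tendsto 0

theorem StraightRel.diagCov_mem (hC : StraightRel C) :
    ∀ᶠ x in 𝓝 (0 : V3), diagCov x ∈ cuspSet Prod.fst C := by
  filter_upwards [tendsto_diagCov.eventually hC.cusp_iff] with x hx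
  exact hx.2 ⟨by simp [diagCov, basisVec_apply], rfl⟩

theorem StraightRel.diag_tangent (hC : StraightRel C) :
    ∀ᶠ x in 𝓝 (0 : V3), ∀ (U : V3) (r : ℝ),
      (((U, r • basisVec 2), (U, r • basisVec 2)) : Phase × Phase) ∈
        tangentVecs C (diagCov x) := by
  filter_upwards [tendsto_diagCov.eventually hC.cusp_iff.eventually_nhds] with x hx U r
  let δ : ℝ → Phase × Phase := fun t =>
    ((x + t • U, (1 + t * r) • basisVec 2), (x + t • U, (1 + t * r) • basisVec 2))
  have hδ : ContDiff ℝ ∞ δ := by fun_prop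
  have hδ0 : δ 0 = diagCov x := by simp [δ, diagCov]
  refine ⟨δ, hδ.contDiffAt, hδ0, ?_, ?_⟩
  · have h1 : Tendsto δ (𝓝 0) (𝓝 (diagCov x)) := hδ0 ▸ hδ.continuous.tendsto 0
    filter_upwards [h1.eventually hx] with t ht
    exact cuspSet_subset (ht.2 ⟨by simp [δ, basisVec_apply], rfl⟩)
  · have h1 : HasDerivAt (fun t : ℝ => x + t • U) U 0 := by
      simpa using ((hasDerivAt_id (0 : ℝ)).smul_const U).const_add x
    have h2 : HasDerivAt (fun t : ℝ => (1 + t * r) • basisVec 2) (r • basisVec 2) 0 := by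
      simpa using ((((hasDerivAt_id (0 : ℝ)).mul_const r).const_add 1).smul_const (basisVec 2))
    exact ((h1.prodMk h2).prodMk (h1.prodMk h2)).deriv

/-- Isotropy improves the statement about the kernel direction: there is no fibre component. -/
theorem StraightRel.ker_eq (hC : StraightRel C) :
    ∀ᶠ x in 𝓝 (0 : V3), ∀ w ∈ tangentVecs C (diagCov x), w.1 = 0 →
      ∃ r : ℝ, w.2 = (r • basisVec 0, 0) := by
  filter_upwards [hC.ker, hC.diag_tangent, hC.diagCov_mem] with x h1 h2 h3 w hw hw0
  obtain ⟨r, hr⟩ := h1 w hw hw0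
  refine ⟨r, Prod.ext hr (covec_unique fun U => ?_)⟩
  have h4 := hC.flat.canonical.symp_tangentVecs (cuspSet_subset h3) hw (h2 U 0)
  rw [hw0] at h4
  simpa [symp_eq] using h4.symm

/-- The coordinates `(x, (y₁, η₂, η₃))`. -/
def mixedCoord : Phase × Phase →L[ℝ] Phase :=
  LinearMap.toContinuousLinearMap
    { toFun := fun d => (d.1.1, !₂[d.2.1 0, d.2.2 1, d.2.2 2])
      map_add' := fun a b => by
        refine Prod.ext rfl ?_
        ext i; fin_cases i <;> rfl
      map_smul' := fun r a => by
        refine Prod.ext rfl ?_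
        ext i; fin_cases i <;> rfl }

theorem mixedCoord_apply (d : Phase × Phase) :
    mixedCoord d = (d.1.1, !₂[d.2.1 0, d.2.2 1, d.2.2 2]) := rfl

theorem mixedCoord_basePoint : mixedCoord basePoint = diagPt 0 := by
  refine Prod.ext rfl ?_
  ext i
  fin_cases i <;> simp [mixedCoord_apply, basePoint, diagPt, basisVec_apply]

theorem mixedCoord_eq_zero {d : Phase × Phase} (h : mixedCoord d = 0) :
    d.1.1 = 0 ∧ d.2.1 0 = 0 ∧ d.2.2 1 = 0 ∧ d.2.2 2 = 0 :=
  ⟨congrArg (fun a : Phase => a.1) h, congrArg (fun a : Phase => a.2 0) h,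
    congrArg (fun a : Phase => a.2 1) h, congrArg (fun a : Phase => a.2 2) h⟩

theorem IsLocalParam.fderiv_mem_tangentVecs {c : Phase × Phase} {γ : Phase → Phase × Phase}
    {O : Set Phase} (h : IsLocalParam C c γ O) {q : Phase} (hq : q ∈ O) (u : Phase) :
    fderiv ℝ γ q u ∈ tangentVecs C (γ q) := by
  have hl : ContDiff ℝ ∞ fun t : ℝ => q + t • u := by fun_prop
  have hl0 : q + (0 : ℝ) • u = q := by simp
  have hs : ContDiffAt ℝ ∞ γ (q + (0 : ℝ) • u) := by
    rw [hl0]; exact (h.smoothNear hq).contDiffAt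
  refine ⟨fun t => γ (q + t • u), hs.comp 0 hl.contDiffAt, by simp, ?_,
    (hasDerivAt_line (h.smoothNear hq).differentiableAt u).deriv⟩
  have ht : Tendsto (fun t : ℝ => q + t • u) (𝓝 0) (𝓝 q) := by
    have := hl.continuous.tendsto 0
    rwa [hl0] at this
  filter_upwards [ht.eventually (h.isOpen.mem_nhds hq)] with t h1 using h.mem h1

/-- `(x, (y₁, η₂, η₃))` are local coordinates of a straightened relation. -/
theorem StraightRel.injective_mixedCoord (hC : StraightRel C) {γ : Phase → Phase × Phase}
    {O : Set Phase} (hγ : IsLocalParam C basePoint γ O) {u : Phase}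
    (hu : mixedCoord (fderiv ℝ γ 0 u) = 0) : u = 0 := by
  apply hγ.injective_fderiv hγ.zero_mem
  have hT := fun u => hγ.map_zero ▸ hγ.fderiv_mem_tangentVecs hγ.zero_mem u
  have hbase := hC.diagCov_mem.self_of_nhds
  have hker := hC.ker_eq.self_of_nhds
  have htan := hC.diag_tangent.self_of_nhds
  change basePoint ∈ _ at hbase
  change ∀ w ∈ tangentVecs C basePoint, _ at hker
  change ∀ U r, _ ∈ tangentVecs C basePoint at htan
  have hsymp := fun u {w} hw => hC.flat.canonical.symp_tangentVecs (cuspSet_subset hbase)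
    (w' := w) (hT u) hw
  obtain ⟨h1, h2, h3, h4⟩ := mixedCoord_eq_zero hu
  -- a kernel vector of the left projection
  have hcusp : IsCusp (Prod.fst ∘ γ) 0 :=
    (mem_cuspSet_iff contDiff_fst hγ hγ.zero_mem).1 (by rwa [hγ.map_zero])
  obtain ⟨k, hk, hk0⟩ : ∃ k, (fderiv ℝ γ 0 k).1 = 0 ∧ k ≠ 0 := by
    by_contra! h0
    refine (det_ne_zero_iff_injective (fderiv ℝ (Prod.fst ∘ γ) 0)).2 (fun v hv => h0 v ?_)
      (jac_eq_zero_of_rank hcusp.1)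
    rwa [fderiv_fst_comp (hγ.smoothNear hγ.zero_mem).differentiableAt] at hv
  obtain ⟨r, hr⟩ := hker _ (hT k) hk
  have hr0 : r ≠ 0 := by
    rintro rfl
    rw [zero_smul] at hr
    exact hk0 (hγ.injective_fderiv hγ.zero_mem (Prod.ext hk hr))
  set w := fderiv ℝ γ 0 u with hw
  have h5 : w.2.2 0 = 0 := by
    have h6 := hsymp u (hT k)
    rw [hk, hr, symp_eq, symp_eq] at h6
    simp only [← hw, Prod.snd_zero, Prod.fst_zero, inner_zero_right, sub_zero,
      real_inner_smul_right, inner_basisVec_right] at h6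
    exact (mul_eq_zero.1 h6.symm).resolve_left hr0
  have h22 : w.2.2 = 0 := by
    ext i; fin_cases i
    · exact h5
    · exact h3
    · exact h4
  have h12 : w.1.2 = 0 := covec_unique fun U => by
    have h6 := hsymp u (htan U 0)
    rw [symp_eq, symp_eq] at h6
    simpa [← hw, h22] using h6
  obtain ⟨s, hs⟩ := hker _ (hT u) (Prod.ext h1 h12)
  have h21 : w.2.1 = 0 := by
    have h6 := congrArg (fun a : Phase => a.1) hs
    simp only [← hw] at h6
    rw [h6, basisVec] at h2
    rw [h6]
    have h7 : s = 0 := by simpa using h2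
    rw [h7, zero_smul]
  exact Prod.ext (Prod.ext h1 h12) (Prod.ext h21 h22)

/-- A straightened relation has a generating function. Indeed the one-form `ξ dx - η dy` vanishes on
`C`, so that the restriction of `η₂ y₂ + η₃ y₃` to `η₃ = 1`, as a function of `(x, y₁, η₂)`, has the
differential `ξ dx - η₁ dy₁ + y₂ dη₂`. -/
theorem StraightRel.exists_generating (hC : StraightRel C) :
    ∃ g : GenArg → ℝ, ContDiff ℝ ∞ g ∧
      (∀ᶠ d in 𝓝 basePoint, d ∈ C → d.2.2 2 = 1 →
        d = genPoint g (d.1.1, d.2.1 0, d.2.2 1)) ∧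
      ∀ᶠ q in 𝓝 (diagPt 0), genParam g q ∈ C ∧
        (genParam g q ∈ singSet Prod.fst C ↔ jac (Prod.fst ∘ genParam g) q = 0) ∧
        (genParam g q ∈ cuspSet Prod.fst C → IsCusp (Prod.fst ∘ genParam g) q) := by
  have hbase : basePoint ∈ cuspSet Prod.fst C := hC.diagCov_mem.self_of_nhds
  obtain ⟨γ, O, hγ, -⟩ := hC.flat.canonical.lagrangian basePoint (cuspSet_subset hbase)
  have hs := hγ.smoothNear hγ.zero_mem
  have hF : SmoothNear (fun q => mixedCoord (γ q)) 0 :=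
    (ContDiff.smoothNear mixedCoord.contDiff _).comp hs
  have hFd : HasFDerivAt (fun q => mixedCoord (γ q)) _ 0 :=
    mixedCoord.hasFDerivAt.comp 0 hs.differentiableAt.hasFDerivAt
  obtain ⟨e, he0, heF, hes, hes'⟩ := hF.exists_openPartialHomeomorph_of_injective rfl
    (fun u hu => hC.injective_mixedCoord hγ (by rw [hFd.fderiv] at hu; exact hu))
  have heh : IsSmoothHomeo e := ⟨hes, hes'⟩
  have heb : e 0 = diagPt 0 := by rw [heF, hγ.map_zero, mixedCoord_basePoint]
  have hbt : diagPt 0 ∈ e.target := heb ▸ e.map_source he0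
  have hσ0 : e.symm (diagPt 0) = 0 := by rw [← heb, e.left_inv he0]
  have hσs := heh.symm.smoothNear hbt
  have hσt : Tendsto e.symm (𝓝 (diagPt 0)) (𝓝 0) := by
    have := hσs.continuousAt.tendsto
    rwa [hσ0] at this
  have htgt : ∀ᶠ q in 𝓝 (diagPt 0), q ∈ e.target := e.open_target.mem_nhds hbt
  have hO : ∀ᶠ q in 𝓝 (diagPt 0), e.symm q ∈ O :=
    hσt.eventually (hγ.isOpen.mem_nhds hγ.zero_mem)
  obtain ⟨Γ, hΓ⟩ : ∃ Γ : Phase → Phase × Phase, Γ = fun q => γ (e.symm q) := ⟨_, rfl⟩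
  have hΓs : SmoothNear Γ (diagPt 0) := by
    have h1 : SmoothNear γ (e.symm (diagPt 0)) := by rwa [hσ0]
    rw [hΓ]
    exact h1.comp hσs
  have hΓ0 : Γ (diagPt 0) = basePoint := by simp only [hΓ, hσ0, hγ.map_zero]
  have hΓm : ∀ᶠ q in 𝓝 (diagPt 0), mixedCoord (Γ q) = q := by
    filter_upwards [htgt] with q hq
    simp only [hΓ]
    rw [← heF, e.right_inv hq]
  have hΓd : ∀ᶠ q in 𝓝 (diagPt 0), ∀ u, mixedCoord (fderiv ℝ Γ q u) = u := by
    filter_upwards [hΓs, hΓm.eventually_nhds] with q h1 h2 u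
    have h3 := (mixedCoord.hasFDerivAt.comp q (h1.differentiableAt (by simp)).hasFDerivAt).unique
      ((hasFDerivAt_id q).congr_of_eventuallyEq h2)
    exact congrArg (fun A : Phase →L[ℝ] Phase => A u) h3
  have hΓi : ∀ᶠ q in 𝓝 (diagPt 0), ∀ u, inner ℝ (Γ q).1.2 (fderiv ℝ Γ q u).1.1 =
      inner ℝ (Γ q).2.2 (fderiv ℝ Γ q u).2.1 := by
    filter_upwards [hO, htgt] with q h1 h2 u
    have h3 : HasFDerivAt (fun q => γ (e.symm q)) _ q :=
      (hγ.smoothNear h1).differentiableAt.hasFDerivAt.comp q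
        (heh.symm.smoothNear h2).differentiableAt.hasFDerivAt
    simp only [hΓ]
    rw [h3.fderiv]
    exact hC.flat.canonical.inner_eq hγ h1 _
  -- the slice `η₃ = 1`
  let ι : GenArg → Phase := fun z => (z.1, !₂[z.2.1, z.2.2, 1])
  let ι' : GenArg →L[ℝ] Phase := LinearMap.toContinuousLinearMap
    { toFun := fun z => (z.1, !₂[z.2.1, z.2.2, 0])
      map_add' := fun a b => by
        refine Prod.ext rfl ?_
        ext i; fin_cases i <;> simp
      map_smul' := fun r a => by
        refine Prod.ext rfl ?_
        ext i; fin_cases i <;> simp }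
  have hι' : ∀ z, ι z = ι' z + (0, basisVec 2) := fun z => by
    refine Prod.ext (by simp [ι, ι']) ?_
    ext i; fin_cases i <;> simp [ι, ι', basisVec_apply]
  have hιd : ∀ z, HasFDerivAt ι ι' z := fun z => by
    rw [show ι = fun z => ι' z + (0, basisVec 2) from funext hι']
    exact ι'.hasFDerivAt.add_const _
  have hιs : ContDiff ℝ ∞ ι := by
    rw [show ι = fun z => ι' z + (0, basisVec 2) from funext hι']
    exact ι'.contDiff.add contDiff_const
  have hι0 : ι 0 = diagPt 0 := by simp [ι, diagPt]
  have hιt : Tendsto ι (𝓝 0) (𝓝 (diagPt 0)) := hι0 ▸ hιs.continuous.tendsto 0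
  have hg₀ : SmoothNear (fun z => z.2.2 * (Γ (ι z)).2.1 1 + (Γ (ι z)).2.1 2) 0 := by
    have h1 : SmoothNear (fun z => Γ (ι z)) 0 := by
      have h2 : SmoothNear Γ (ι 0) := by rwa [hι0]
      exact h2.comp (ContDiff.smoothNear hιs 0)
    filter_upwards [h1] with z h2
    have h3 : ∀ i : Fin 3, ContDiffAt ℝ ∞ (fun z => (Γ (ι z)).2.1 i) z := fun i =>
      (EuclideanSpace.proj (𝕜 := ℝ) i).contDiff.contDiffAt.comp z h2.snd.fst
    exact ((contDiffAt_snd.comp z contDiffAt_snd).mul (h3 1)).add (h3 2)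
  obtain ⟨g, hg, hgg⟩ := hg₀.exists_contDiff
  have hgen : ∀ᶠ z in 𝓝 (0 : GenArg), Γ (ι z) = genPoint g z := by
    filter_upwards [hgg.eventually_nhds, hιt.eventually hΓm, hιt.eventually hΓd,
      hιt.eventually hΓi, hιt.eventually hΓs] with z h1 h2 h3 h4 h5
    set c := Γ (ι z) with hc
    have hd : ∀ w, dd w g z = w.2.2 * c.2.1 1 + inner ℝ c.1.2 w.1 - c.2.2 0 * w.2.1 := by
      intro w
      have d1 : HasFDerivAt (fun z => Γ (ι z)) ((fderiv ℝ Γ (ι z)).comp ι') z :=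
        (h5.differentiableAt (by simp)).hasFDerivAt.comp z (hιd z)
      have d2 : ∀ i : Fin 3, HasFDerivAt (fun z => (Γ (ι z)).2.1 i) _ z := fun i =>
        (EuclideanSpace.proj (𝕜 := ℝ) i).hasFDerivAt.comp z d1.snd.fst
      have d3 : HasFDerivAt (fun z : GenArg => z.2.2) _ z :=
        ((ContinuousLinearMap.snd ℝ ℝ ℝ).comp (ContinuousLinearMap.snd ℝ V3 (ℝ × ℝ))).hasFDerivAt
      have d4 : HasFDerivAt g _ z := ((d3.mul (d2 1)).add (d2 2)).congr_of_eventuallyEq h1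
      have d5 : dd w g z = z.2.2 * (fderiv ℝ Γ (ι z) (ι' w)).2.1 1 + c.2.1 1 * w.2.2 +
          (fderiv ℝ Γ (ι z) (ι' w)).2.1 2 := by
        rw [dd, d4.fderiv]; rfl
      have h6 := h4 (ι' w)
      have h7 := h3 (ι' w)
      have e1 : (fderiv ℝ Γ (ι z) (ι' w)).1.1 = w.1 := congrArg (fun a : Phase => a.1) h7
      have e2 : (fderiv ℝ Γ (ι z) (ι' w)).2.1 0 = w.2.1 := congrArg (fun a : Phase => a.2 0) h7
      have e3 : c.2.2 1 = z.2.2 := congrArg (fun a : Phase => a.2 1) h2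
      have e4 : c.2.2 2 = 1 := congrArg (fun a : Phase => a.2 2) h2
      have e5 : ∀ a b : V3, inner ℝ a b = a 0 * b 0 + a 1 * b 1 + a 2 * b 2 := by
        intro a b
        simp [PiLp.inner_apply, Fin.sum_univ_three]
        ring
      rw [e1, e5 c.2.2, e2, e3, e4] at h6
      rw [d5, h6]; ring
    have e0 : c.1.1 = z.1 := congrArg (fun a : Phase => a.1) h2
    have e1 : c.2.1 0 = z.2.1 := congrArg (fun a : Phase => a.2 0) h2
    have e3 : c.2.2 1 = z.2.2 := congrArg (fun a : Phase => a.2 1) h2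
    have e4 : c.2.2 2 = 1 := congrArg (fun a : Phase => a.2 2) h2
    have hT : dd dirT g z = c.2.1 1 := by rw [hd]; simp [dirT]
    have hY : -dd dirY g z = c.2.2 0 := by rw [hd]; simp [dirY]
    have hz : g z = z.2.2 * c.2.1 1 + c.2.1 2 := h1.self_of_nhds
    refine Prod.ext (Prod.ext e0 ?_) (Prod.ext ?_ ?_)
    · ext i
      change c.1.2 i = dd (dirX i) g z
      rw [hd]
      simp [dirX, inner_basisVec_right]
    · ext i
      fin_cases i
      · exact e1
      · exact hT.symm
      · change c.2.1 2 = g z - z.2.2 * dd dirT g z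
        rw [hT, hz]; ring
    · ext i
      fin_cases i
      · exact hY.symm
      · exact e3
      · exact e4
  have hA : ∀ᶠ d in 𝓝 basePoint, d ∈ C → d.2.2 2 = 1 →
      d = genPoint g (d.1.1, d.2.1 0, d.2.2 1) := by
    obtain ⟨U, k, hU, hk, hkO, hkC⟩ := hγ.exists_lift
    have hbU : basePoint ∈ U := hγ.map_zero ▸ (hkO 0 hγ.zero_mem).2
    have hk0 : k basePoint = 0 := hγ.map_zero ▸ (hkO 0 hγ.zero_mem).1
    have hkt : Tendsto k (𝓝 basePoint) (𝓝 0) := by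
      have := (hk.continuousOn.continuousAt (hU.mem_nhds hbU)).tendsto
      rwa [hk0] at this
    have hlt : Tendsto (fun d : Phase × Phase => ((d.1.1, d.2.1 0, d.2.2 1) : GenArg))
        (𝓝 basePoint) (𝓝 0) := by
      have h1 : Continuous fun d : Phase × Phase => ((d.1.1, d.2.1 0, d.2.2 1) : GenArg) := by
        fun_prop
      have h2 := h1.tendsto basePoint
      have h3 : ((basePoint.1.1, basePoint.2.1 0, basePoint.2.2 1) : GenArg) = 0 := by
        simp [basePoint, basisVec_apply]
      rwa [h3] at h2
    filter_upwards [hU.mem_nhds hbU, hkt.eventually (e.open_source.mem_nhds he0),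
      hlt.eventually hgen] with d h1 h2 h3 hd hd1
    obtain ⟨-, h5⟩ := hkC d ⟨hd, h1⟩
    have h6 : e (k d) = ι (d.1.1, d.2.1 0, d.2.2 1) := by
      rw [heF, h5, mixedCoord_apply, hd1]
    rw [← h3, hΓ]
    simp only
    rw [← h6, e.left_inv h2, h5]
  have hB : ∀ᶠ q in 𝓝 (diagPt 0), genParam g q = Γ q := by
    have ht : Tendsto (fun q : Phase => dil₂ (q.2 2)⁻¹ (Γ q)) (𝓝 (diagPt 0)) (𝓝 basePoint) := by
      have h1 : ContinuousAt (fun q : Phase => (q.2 2)⁻¹) (diagPt 0) :=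
        (contDiff_coord 2).continuous.continuousAt.inv₀ (diagPt_two_pos 0).ne'
      have h2 := hΓs.continuousAt
      have h3 : ContinuousAt (fun q : Phase => dil₂ (q.2 2)⁻¹ (Γ q)) (diagPt 0) :=
        (h2.fst.fst.prodMk (h1.smul h2.fst.snd)).prodMk (h2.snd.fst.prodMk (h1.smul h2.snd.snd))
      have h4 := h3.tendsto
      rw [hΓ0] at h4
      have h5 : dil₂ ((diagPt 0).2 2)⁻¹ basePoint = basePoint := by
        simp [diagPt, dil₂_one]
      rwa [h5] at h4
    filter_upwards [ht.eventually hA, hO, hΓm, eventually_coord_pos (diagPt_two_pos 0)]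
      with q h1 h2 h3 h4
    have hm : Γ q ∈ C := by rw [hΓ]; exact hγ.mem h2
    have e0 : (Γ q).1.1 = q.1 := by
      have := congrArg (fun a : Phase => a.1) h3
      exact this
    have e1 : (Γ q).2.1 0 = q.2 0 := by
      have := congrArg (fun a : Phase => a.2 0) h3
      exact this
    have e3 : (Γ q).2.2 1 = q.2 1 := by
      have := congrArg (fun a : Phase => a.2 1) h3
      exact this
    have e4 : (Γ q).2.2 2 = q.2 2 := by
      have := congrArg (fun a : Phase => a.2 2) h3
      exact this
    have h5 := h1 (hC.flat.canonical.conic _ hm _ (inv_pos.2 h4)) (by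
      change (q.2 2)⁻¹ * (Γ q).2.2 2 = 1
      rw [e4, inv_mul_cancel₀ h4.ne'])
    have h6 : (((dil₂ (q.2 2)⁻¹ (Γ q)).1.1, (dil₂ (q.2 2)⁻¹ (Γ q)).2.1 0,
        (dil₂ (q.2 2)⁻¹ (Γ q)).2.2 1) : GenArg) = slice q := by
      refine Prod.ext e0 (Prod.ext e1 ?_)
      change (q.2 2)⁻¹ * (Γ q).2.2 1 = q.2 1 / q.2 2
      rw [e3]; ring
    rw [h6] at h5
    rw [genParam, ← h5, dil₂_dil₂, mul_inv_cancel₀ h4.ne', dil₂_one]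
  refine ⟨g, hg, hA, ?_⟩
  filter_upwards [hB.eventually_nhds, hO, htgt] with q h1 h2 h3
  have h4 := h1.self_of_nhds
  have h5 : (Prod.fst ∘ genParam g) =ᶠ[𝓝 q] (Prod.fst ∘ γ) ∘ e.symm := by
    filter_upwards [h1] with q' h6
    simp only [Function.comp_apply, h6, hΓ]
  have h6 : SmoothNear (Prod.fst ∘ γ) (e.symm q) :=
    (ContDiff.smoothNear contDiff_fst _).comp (hγ.smoothNear h2)
  have h7 := heh.symm.smoothNear h3
  have h8 := heh.symm.jac_ne_zero h3
  rw [h4, hΓ]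
  refine ⟨hγ.mem h2, ?_, fun h9 => ?_⟩
  · rw [mem_singSet_iff contDiff_fst hγ h2, jac_congr h5,
      jac_comp h7.differentiableAt h6.differentiableAt, mul_eq_zero, or_iff_left h8]
  · exact (isCusp_comp_right h7 h6 h8 ((mem_cuspSet_iff contDiff_fst hγ h2).1 h9)).congr h5

/-- The generating function satisfies the cusp conditions along the diagonal. -/
theorem StraightRel.exists_generating_diagVanishing (hC : StraightRel C) :
    ∃ g : GenArg → ℝ, ContDiff ℝ ∞ g ∧
      (∀ᶠ d in 𝓝 basePoint, d ∈ C → d.2.2 2 = 1 →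
        d = genPoint g (d.1.1, d.2.1 0, d.2.2 1)) ∧
      (∀ᶠ z in 𝓝 (0 : GenArg), genPoint g z ∈ C ∧
        (genPoint g z ∈ singSet Prod.fst C ↔ genJac g z = 0)) ∧
      (∀ᶠ x in 𝓝 (0 : V3), DiagVanishing g x) ∧ dd dirT (genJac g) 0 ≠ 0 ∧
      dd dirY (dd dirY (dd dirT g)) 0 ≠ 0 ∧
      dd dirY (dd dirY (dd dirY (dd dirY g))) 0 ≠ 0 := by
  obtain ⟨g, hg, hA, hB⟩ := hC.exists_generating
  have hdt : Tendsto diagPt (𝓝 0) (𝓝 (diagPt 0)) := continuous_diagPt.tendsto 0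
  have h1 : ∀ᶠ x in 𝓝 (0 : V3), genPoint g (diagArg x) = diagCov x := by
    filter_upwards [tendsto_diagCov.eventually hA, hC.diagCov_mem] with x h2 h3
    have h4 := h2 (cuspSet_subset h3) (by simp [diagCov, basisVec_apply])
    rw [h4]
    simp [diagCov, diagArg_apply, basisVec_apply]
  have h1' : ∀ᶠ x in 𝓝 (0 : V3), genParam g (diagPt x) = diagCov x := by
    filter_upwards [h1] with x h2
    rw [genParam, slice_diagPt, h2]
    simp [diagPt, dil₂_one]
  have h2 : ∀ᶠ x in 𝓝 (0 : V3), IsCusp (Prod.fst ∘ genParam g) (diagPt x) := by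
    filter_upwards [hdt.eventually hB, h1', hC.diagCov_mem] with x h3 h4 h5
    exact h3.2.2 (h4 ▸ h5)
  have h3 : ∀ᶠ x in 𝓝 (0 : V3), ∀ w, (fderiv ℝ (genParam g) (diagPt x) w).1 = 0 →
      ∃ r : ℝ, (fderiv ℝ (genParam g) (diagPt x) w).2 = (r • basisVec 0, 0) := by
    filter_upwards [hC.ker_eq, hdt.eventually hB.eventually_nhds, h1'] with x h4 h5 h6 w hw
    refine h4 _ ?_ hw
    have hs := smoothNear_genParam hg (diagPt_two_pos x)
    have hl : ContDiff ℝ ∞ fun t : ℝ => diagPt x + t • w := by fun_prop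
    have hl0 : diagPt x + (0 : ℝ) • w = diagPt x := by simp
    have ht : Tendsto (fun t : ℝ => diagPt x + t • w) (𝓝 0) (𝓝 (diagPt x)) := by
      have := hl.continuous.tendsto 0
      rwa [hl0] at this
    refine ⟨fun t => genParam g (diagPt x + t • w), ?_, by simp [h6],
      (ht.eventually h5).mono fun t h7 => h7.1, (hasDerivAt_line hs.differentiableAt w).deriv⟩
    have hs' : ContDiffAt ℝ ∞ (genParam g) (diagPt x + (0 : ℝ) • w) := by
      rw [hl0]; exact hs.contDiffAt
    exact hs'.comp 0 hl.contDiffAt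
  have hv := eventually_diagVanishing hg h1 h2 h3
  refine ⟨g, hg, hA, ?_, hv, IsCusp.genJac_ne_zero hg hv h2.self_of_nhds⟩
  have hc : Continuous fun z : GenArg => ((z.1, !₂[z.2.1, z.2.2, 1]) : Phase) := by
    refine continuous_fst.prodMk ?_
    refine (PiLp.continuous_toLp 2 _).comp (continuous_pi fun i => ?_)
    fin_cases i
    · exact continuous_fst.comp continuous_snd
    · exact continuous_snd.comp continuous_snd
    · exact continuous_const
  have ht : Tendsto (fun z : GenArg => ((z.1, !₂[z.2.1, z.2.2, 1]) : Phase)) (𝓝 0)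
      (𝓝 (diagPt 0)) := hc.tendsto 0
  filter_upwards [ht.eventually hB] with z h4
  have h5 : slice (z.1, !₂[z.2.1, z.2.2, 1]) = z := by simp [slice]
  have h6 : genParam g (z.1, !₂[z.2.1, z.2.2, 1]) = genPoint g z := by
    rw [genParam, h5]
    simp [dil₂_one]
  rw [h6] at h4
  refine ⟨h4.1, ?_⟩
  rw [h4.2.1, jac_genParam hg (by simp), homog, h5]
  simp

end FromRelation

/-! ### The two projections are singular at the same points -/

section Singular

variable {C : Set (Phase × Phase)} {c : Phase × Phase}

/-- A kernel vector of `B` is mapped by `A` to the symplectic orthogonal of the range of `A`. -/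
theorem injective_of_symp_eq {A B : Phase →L[ℝ] Phase}
    (h : ∀ u v, symp (A u) (A v) = symp (B u) (B v)) (hA : ∀ v, A v = 0 → v = 0)
    {v : Phase} (hv : B v = 0) : v = 0 := by
  have hs : Function.Surjective A :=
    LinearMap.injective_iff_surjective.1 ((injective_iff_map_eq_zero A).2 hA)
  refine hA v (eq_zero_of_symp_eq_zero fun b => ?_)
  obtain ⟨u, rfl⟩ := hs b
  rw [h, hv]
  simp [symp]

/-- The two symplectic forms agree on a canonical relation, so one projection is a local
diffeomorphism exactly where the other one is. -/
theorem IsCanonicalRelation.mem_singSet_snd_iff (hC : IsCanonicalRelation C) (hc : c ∈ C) :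
    c ∈ singSet Prod.snd C ↔ c ∈ singSet Prod.fst C := by
  obtain ⟨γ, O, hγ, hs⟩ := hC.lagrangian c hc
  have hd := (hγ.smoothNear hγ.zero_mem).differentiableAt
  have h : ∀ u v, symp (fderiv ℝ (Prod.fst ∘ γ) 0 u) (fderiv ℝ (Prod.fst ∘ γ) 0 v) =
      symp (fderiv ℝ (Prod.snd ∘ γ) 0 u) (fderiv ℝ (Prod.snd ∘ γ) 0 v) := fun u v => by
    simp only [fderiv_fst_comp hd, fderiv_snd_comp hd]
    exact hs 0 hγ.zero_mem u v
  rw [← hγ.map_zero, mem_singSet_iff contDiff_snd hγ hγ.zero_mem,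
    mem_singSet_iff contDiff_fst hγ hγ.zero_mem, ← not_iff_not]
  change (fderiv ℝ (Prod.snd ∘ γ) 0).det ≠ 0 ↔ (fderiv ℝ (Prod.fst ∘ γ) 0).det ≠ 0
  rw [det_ne_zero_iff_injective, det_ne_zero_iff_injective]
  exact ⟨fun h1 v => injective_of_symp_eq (fun u v => (h u v).symm) h1,
    fun h1 v => injective_of_symp_eq h h1⟩

end Singular

/-! ### Passage from the generating function to a homogeneous phase function -/

section Phase

variable {C U : Set (Phase × Phase)} {g : GenArg → ℝ} {B : Set GenArg}

/-- Near the base point, and for `η₃ = 1`, the relation `C` consists of the points `genPoint g z`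
with `z ∈ B`. -/
structure GeneratedBy (C : Set (Phase × Phase)) (g : GenArg → ℝ) (B : Set GenArg)
    (U : Set (Phase × Phase)) : Prop where
  smooth : ContDiff ℝ ∞ g
  isOpen_arg : IsOpen B
  zero_mem : (0 : GenArg) ∈ B
  isOpen : IsOpen U
  base_mem : basePoint ∈ U
  mem : ∀ z ∈ B, genPoint g z ∈ C ∩ U
  eq : ∀ d ∈ C ∩ U, d.2.2 2 = 1 → ∃ z ∈ B, d = genPoint g z

/-- `(x, y₁, θ) ↦ (x, y₁, θ₂ / θ₃)`. -/
def coeffSlice (w : CoeffArg) : GenArg := (w.1, w.2.1, w.2.2.1 / w.2.2.2)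

/-- The cone over `B` in the half space `θ₃ > 0`. -/
def coneOver (B : Set GenArg) : Set CoeffArg := {w | 0 < w.2.2.2 ∧ coeffSlice w ∈ B}

/-- The points `(x, y, θ)` for which `(x, y₁, θ)` lies in the cone over `B`. -/
def phaseCone (B : Set GenArg) : Set PhaseArg := coeffArg ⁻¹' coneOver B

/-- `(x, y, θ) ↦ (x, (y₁, θ₂, θ₃))`. -/
def toPhase : PhaseArg →L[ℝ] Phase :=
  LinearMap.toContinuousLinearMap
    { toFun := fun z => (z.1, !₂[z.2.1 0, z.2.2.1, z.2.2.2])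
      map_add' := fun a b => by
        refine Prod.ext rfl ?_
        ext i; fin_cases i <;> rfl
      map_smul' := fun r a => by
        refine Prod.ext rfl ?_
        ext i; fin_cases i <;> rfl }

/-- The phase function `θ₃ g(x, y₁, θ₂ / θ₃) - y₂ θ₂ - y₃ θ₃`. -/
def conicPhase (g : GenArg → ℝ) (z : PhaseArg) : ℝ :=
  homog g (toPhase z) - (z.2.1 1 * z.2.2.1 + z.2.1 2 * z.2.2.2)

theorem contDiffAt_coeffSlice {w : CoeffArg} (hw : 0 < w.2.2.2) :
    ContDiffAt ℝ ∞ coeffSlice w :=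
  contDiffAt_fst.prodMk (contDiffAt_snd.fst.prodMk
    (contDiffAt_snd.snd.fst.div contDiffAt_snd.snd.snd hw.ne'))

theorem isOpen_coneOver (hB : IsOpen B) : IsOpen (coneOver B) := by
  have h1 : IsOpen {w : CoeffArg | 0 < w.2.2.2} :=
    isOpen_lt continuous_const (continuous_snd.comp (continuous_snd.comp continuous_snd))
  exact ContinuousOn.isOpen_inter_preimage
    (fun w hw => (contDiffAt_coeffSlice hw).continuousAt.continuousWithinAt) h1 hB

theorem continuous_coeffArg : Continuous coeffArg := by unfold coeffArg; fun_prop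

theorem isOpen_phaseCone (hB : IsOpen B) : IsOpen (phaseCone B) :=
  (isOpen_coneOver hB).preimage continuous_coeffArg

theorem coeffSlice_smul (w : CoeffArg) {t : ℝ} (ht : 0 < t) :
    coeffSlice (w.1, w.2.1, t • w.2.2) = coeffSlice w :=
  Prod.ext rfl (Prod.ext rfl (mul_div_mul_left _ _ ht.ne'))

theorem coneOver_conic {w : CoeffArg} (hw : w ∈ coneOver B) {t : ℝ} (ht : 0 < t) :
    ((w.1, w.2.1, t • w.2.2) : CoeffArg) ∈ coneOver B :=
  ⟨mul_pos ht hw.1, by rw [coeffSlice_smul w ht]; exact hw.2⟩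

variable {z : PhaseArg}

theorem fderiv_conicPhase (hg : ContDiff ℝ ∞ g) (hz : 0 < z.2.2.2) (v : PhaseArg) :
    fderiv ℝ (conicPhase g) z v = v.2.2.2 * g (coeffSlice (coeffArg z)) +
      z.2.2.2 * dd (v.1, v.2.1 0, v.2.2.1 / z.2.2.2 - z.2.2.1 * v.2.2.2 / z.2.2.2 ^ 2) g
        (coeffSlice (coeffArg z)) -
      (z.2.1 1 * v.2.2.1 + z.2.2.1 * v.2.1 1 + (z.2.1 2 * v.2.2.2 + z.2.2.2 * v.2.1 2)) := by
  have hq : 0 < (toPhase z).2 2 := hz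
  have h1 : HasFDerivAt (fun z => homog g (toPhase z)) _ z :=
    (smoothNear_homog hg hq).differentiableAt.hasFDerivAt.comp z toPhase.hasFDerivAt
  have hy : ∀ i : Fin 3, HasFDerivAt (fun z : PhaseArg => z.2.1 i) _ z := fun i =>
    ((EuclideanSpace.proj (𝕜 := ℝ) i).comp ((ContinuousLinearMap.fst ℝ V3 (ℝ × ℝ)).comp
      (ContinuousLinearMap.snd ℝ V3 (V3 × ℝ × ℝ)))).hasFDerivAt
  have h2 : HasFDerivAt (fun z : PhaseArg => z.2.2.1) _ z :=
    ((ContinuousLinearMap.fst ℝ ℝ ℝ).comp ((ContinuousLinearMap.snd ℝ V3 (ℝ × ℝ)).comp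
      (ContinuousLinearMap.snd ℝ V3 (V3 × ℝ × ℝ)))).hasFDerivAt
  have h3 : HasFDerivAt (fun z : PhaseArg => z.2.2.2) _ z :=
    ((ContinuousLinearMap.snd ℝ ℝ ℝ).comp ((ContinuousLinearMap.snd ℝ V3 (ℝ × ℝ)).comp
      (ContinuousLinearMap.snd ℝ V3 (V3 × ℝ × ℝ)))).hasFDerivAt
  have h4 : HasFDerivAt (conicPhase g) _ z := h1.sub (((hy 1).mul h2).add ((hy 2).mul h3))
  rw [h4.fderiv]
  change fderiv ℝ (homog g) (toPhase z) (toPhase v) - _ = _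
  rw [fderiv_homog hg hq]
  rfl

theorem fderiv_conicPhase_theta₂ (hg : ContDiff ℝ ∞ g) (hz : 0 < z.2.2.2) :
    fderiv ℝ (conicPhase g) z (0, 0, (1, 0)) =
      dd dirT g (coeffSlice (coeffArg z)) - z.2.1 1 := by
  rw [fderiv_conicPhase hg hz]
  simp [dd_vertical]
  field_simp

theorem fderiv_conicPhase_theta₃ (hg : ContDiff ℝ ∞ g) (hz : 0 < z.2.2.2) :
    fderiv ℝ (conicPhase g) z (0, 0, (0, 1)) = (g (coeffSlice (coeffArg z)) -
      (coeffSlice (coeffArg z)).2.2 * dd dirT g (coeffSlice (coeffArg z))) - z.2.1 2 := by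
  have h : (coeffSlice (coeffArg z)).2.2 = z.2.2.1 / z.2.2.2 := rfl
  rw [fderiv_conicPhase hg hz, h]
  simp [dd_vertical]
  field_simp
  ring

/-- The critical equations recover `y₂`, `y₃` from `(x, y₁, θ)`. -/
theorem mem_critSet_conicPhase (hg : ContDiff ℝ ∞ g) :
    z ∈ critSet (conicPhase g) (phaseCone B) ↔ z ∈ phaseCone B ∧
      z.2.1 = (genPoint g (coeffSlice (coeffArg z))).2.1 := by
  refine and_congr_right fun hz => ?_
  rw [fderiv_conicPhase_theta₂ hg hz.1, fderiv_conicPhase_theta₃ hg hz.1, sub_eq_zero, sub_eq_zero]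
  constructor
  · rintro ⟨h1, h2⟩
    ext i; fin_cases i
    · rfl
    · exact h1.symm
    · exact h2.symm
  · intro h
    exact ⟨(congrArg (fun y : V3 => y 1) h).symm, (congrArg (fun y : V3 => y 2) h).symm⟩

theorem phaseMap_conicPhase (hg : ContDiff ℝ ∞ g)
    (hz : z ∈ critSet (conicPhase g) (phaseCone B)) :
    phaseMap (conicPhase g) z = dil₂ z.2.2.2 (genPoint g (coeffSlice (coeffArg z))) := by
  obtain ⟨h1, h2⟩ := (mem_critSet_conicPhase hg).1 hz
  have hz3 : 0 < z.2.2.2 := h1.1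
  refine Prod.ext (Prod.ext rfl ?_) (Prod.ext h2 ?_)
  · ext i
    change fderiv ℝ (conicPhase g) z (basisVec i, 0, 0) = z.2.2.2 * dd (dirX i) g _
    rw [fderiv_conicPhase hg hz3]
    simp [dirX]
  · ext i
    change -fderiv ℝ (conicPhase g) z (0, basisVec i, 0) = _
    rw [fderiv_conicPhase hg hz3]
    fin_cases i
    · simp [basisVec_apply, dd_vertical, dil₂, dil, genPoint]
    · simp [basisVec_apply, dd_vertical, dil₂, dil, genPoint, coeffSlice, coeffArg]
      field_simp
    · simp [basisVec_apply, dd_vertical, dil₂, dil, genPoint]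

/-- The derivatives `φ_θ` have the form `G(x, y₁, θ₂ / θ₃) - y_i`. -/
theorem fderiv_sub_coord {G : GenArg → ℝ} (hG : ContDiff ℝ ∞ G) (hz : 0 < z.2.2.2) (i : Fin 3)
    {j : Fin 3} (hj : j ≠ 0) :
    fderiv ℝ (fun w : PhaseArg => G (coeffSlice (coeffArg w)) - w.2.1 i) z (0, basisVec j, 0) =
      -basisVec j i := by
  have h1 : HasFDerivAt (fun w : PhaseArg => G (coeffSlice (coeffArg w))) _ z :=
    ((hG.differentiable (by simp) _).comp (toPhase z)
      (smoothNear_slice (q := toPhase z) hz).differentiableAt).hasFDerivAt.comp z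
        toPhase.hasFDerivAt
  have h2 : HasFDerivAt (fun z : PhaseArg => z.2.1 i) _ z :=
    ((EuclideanSpace.proj (𝕜 := ℝ) i).comp ((ContinuousLinearMap.fst ℝ V3 (ℝ × ℝ)).comp
      (ContinuousLinearMap.snd ℝ V3 (V3 × ℝ × ℝ)))).hasFDerivAt
  have h3 : toPhase (0, basisVec j, 0) = 0 := by
    refine Prod.ext rfl ?_
    ext k
    fin_cases k
    · change basisVec j 0 = 0
      rw [basisVec_apply, if_neg hj.symm]
    · rfl
    · rfl
  have h4 : HasFDerivAt (fun w : PhaseArg => G (coeffSlice (coeffArg w)) - w.2.1 i) _ z :=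
    h1.sub h2
  rw [h4.fderiv, _root_.sub_apply, ContinuousLinearMap.comp_apply, h3, map_zero,
    zero_sub]
  rfl

theorem isPhaseFunction_conicPhase (hg : ContDiff ℝ ∞ g) (hB : IsOpen B) :
    IsPhaseFunction (conicPhase g) (phaseCone B) where
  isOpen := isOpen_phaseCone hB
  ne_zero z hz h := hz.1.ne' (congrArg Prod.snd h)
  conic z hz t ht := coneOver_conic hz ht
  smooth z hz := by
    have h1 : ContDiffAt ℝ ∞ (fun z => homog g (toPhase z)) z :=
      (smoothNear_homog hg (q := toPhase z) hz.1).contDiffAt.comp z toPhase.contDiff.contDiffAt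
    have h2 : ContDiff ℝ ∞ fun z : PhaseArg => z.2.1 1 * z.2.2.1 + z.2.1 2 * z.2.2.2 := by
      fun_prop
    exact (h1.sub h2.contDiffAt).contDiffWithinAt
  homogeneous z hz t ht := by
    have h1 := coeffSlice_smul (coeffArg z) ht
    change t * z.2.2.2 * g (coeffSlice ((coeffArg z).1, (coeffArg z).2.1, t • (coeffArg z).2.2)) -
      (z.2.1 1 * (t * z.2.2.1) + z.2.1 2 * (t * z.2.2.2)) =
        t * (z.2.2.2 * g (coeffSlice (coeffArg z)) - (z.2.1 1 * z.2.2.1 + z.2.1 2 * z.2.2.2))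
    rw [h1]; ring
  nondegenerate z hz := by
    have hz3 : 0 < z.2.2.2 := hz.1.1
    have hT := contDiff_dd hg dirT
    have hn : ∀ᶠ w : PhaseArg in 𝓝 z, 0 < w.2.2.2 :=
      ((isOpen_phaseCone hB).eventually_mem hz.1).mono fun w hw => hw.1
    have e1 : (fun w => fderiv ℝ (conicPhase g) w (0, 0, (1, 0))) =ᶠ[𝓝 z]
        fun w => dd dirT g (coeffSlice (coeffArg w)) - w.2.1 1 :=
      hn.mono fun w hw => fderiv_conicPhase_theta₂ hg hw
    have hG : ContDiff ℝ ∞ fun p : GenArg => g p - p.2.2 * dd dirT g p :=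
      hg.sub ((contDiff_snd.comp contDiff_snd).mul hT)
    have e2 : (fun w => fderiv ℝ (conicPhase g) w (0, 0, (0, 1))) =ᶠ[𝓝 z]
        fun w => (fun p : GenArg => g p - p.2.2 * dd dirT g p) (coeffSlice (coeffArg w)) -
          w.2.1 2 :=
      hn.mono fun w hw => fderiv_conicPhase_theta₃ hg hw
    rw [e1.fderiv_eq, e2.fderiv_eq, LinearIndependent.pair_iff]
    intro r s h
    have h1 := congrArg (fun A : PhaseArg →L[ℝ] ℝ => A (0, basisVec 1, 0)) h
    have h2 := congrArg (fun A : PhaseArg →L[ℝ] ℝ => A (0, basisVec 2, 0)) h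
    simp only [_root_.add_apply, _root_.smul_apply, _root_.zero_apply,
      fderiv_sub_coord hT hz3 _ (show (1 : Fin 3) ≠ 0 by decide),
      fderiv_sub_coord hT hz3 _ (show (2 : Fin 3) ≠ 0 by decide),
      fderiv_sub_coord hG hz3 _ (show (1 : Fin 3) ≠ 0 by decide),
      fderiv_sub_coord hG hz3 _ (show (2 : Fin 3) ≠ 0 by decide)] at h1 h2
    simp [basisVec_apply] at h1 h2
    exact ⟨h1, h2⟩

theorem GeneratedBy.parametrizesNear (h : GeneratedBy C g B U) (hC : IsCanonicalRelation C) :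
    ParametrizesNear (conicPhase g) (phaseCone B) C basePoint := by
  have hcoord : Continuous fun c : Phase × Phase => c.2.2 2 := by fun_prop
  refine ⟨isPhaseFunction_conicPhase h.smooth h.isOpen_arg,
    {c | 0 < c.2.2 2 ∧ dil₂ (c.2.2 2)⁻¹ c ∈ U}, ?_, ?_, ?_, ?_⟩
  · refine ContinuousOn.isOpen_inter_preimage (s := {c : Phase × Phase | 0 < c.2.2 2})
      (f := fun c => dil₂ (c.2.2 2)⁻¹ c) (fun c hc => ContinuousAt.continuousWithinAt ?_)
      (isOpen_lt continuous_const hcoord) h.isOpen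
    have h1 : ContinuousAt (fun c : Phase × Phase => (c.2.2 2)⁻¹) c :=
      hcoord.continuousAt.inv₀ (ne_of_gt hc)
    exact (continuousAt_fst.fst.prodMk (h1.smul continuousAt_fst.snd)).prodMk
      (continuousAt_snd.fst.prodMk (h1.smul continuousAt_snd.snd))
  · have h1 : basePoint.2.2 2 = 1 := by simp [basePoint, basisVec_apply]
    refine ⟨by rw [h1]; exact one_pos, ?_⟩
    rw [h1, inv_one, dil₂_one]
    exact h.base_mem
  · rintro b ⟨h1, h2⟩ t ht
    refine ⟨mul_pos ht h1, ?_⟩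
    have h3 : (dil₂ t b).2.2 2 = t * b.2.2 2 := rfl
    rw [h3, dil₂_dil₂, mul_inv, mul_right_comm, inv_mul_cancel₀ ht.ne', one_mul]
    exact h2
  · ext c
    constructor
    · rintro ⟨hc, hs, hU⟩
      set s := c.2.2 2 with hsdef
      obtain ⟨p, hp, hd⟩ := h.eq _ ⟨hC.conic c hc _ (inv_pos.2 hs), hU⟩ (inv_mul_cancel₀ hs.ne')
      have hcp : c = dil₂ s (genPoint g p) := by
        rw [← hd, dil₂_dil₂, mul_inv_cancel₀ hs.ne', dil₂_one]
      have hsl : coeffSlice (coeffArg (c.1.1, c.2.1, (s * p.2.2, s))) = p := by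
        refine Prod.ext ?_ (Prod.ext ?_ ?_)
        · change c.1.1 = p.1
          rw [hcp]; rfl
        · change c.2.1 0 = p.2.1
          rw [hcp]; rfl
        · exact mul_div_cancel_left₀ _ hs.ne'
      have hz : ((c.1.1, c.2.1, (s * p.2.2, s)) : PhaseArg) ∈
          critSet (conicPhase g) (phaseCone B) := by
        refine (mem_critSet_conicPhase h.smooth).2 ⟨⟨hs, ?_⟩, ?_⟩
        · rw [hsl]; exact hp
        · rw [hsl]
          change c.2.1 = _
          rw [hcp]; rfl
      refine ⟨_, hz, ?_⟩
      rw [phaseMap_conicPhase h.smooth hz, hsl]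
      exact hcp.symm
    · rintro ⟨z, hz, rfl⟩
      have hm := h.mem _ hz.1.2
      have hz3 : 0 < z.2.2.2 := hz.1.1
      rw [phaseMap_conicPhase h.smooth hz]
      have h3 : (dil₂ z.2.2.2 (genPoint g (coeffSlice (coeffArg z)))).2.2 2 = z.2.2.2 :=
        mul_one _
      refine ⟨hC.conic _ hm.1 _ hz3, ?_⟩
      rw [mem_ofPred_eq, h3, dil₂_dil₂, inv_mul_cancel₀ hz3.ne', dil₂_one]
      exact ⟨hz3, hm.2⟩

variable {φ ψ : PhaseArg → ℝ} {Γ : Set PhaseArg}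

theorem critSet_congr (hΓ : IsOpen Γ) (h : EqOn φ ψ Γ) : critSet φ Γ = critSet ψ Γ := by
  ext z
  refine and_congr_right fun hz => ?_
  rw [(h.eventuallyEq_of_mem (hΓ.mem_nhds hz)).fderiv_eq]

theorem phaseMap_congr (hΓ : IsOpen Γ) (h : EqOn φ ψ Γ) (hz : z ∈ Γ) :
    phaseMap φ z = phaseMap ψ z := by
  rw [phaseMap, phaseMap, (h.eventuallyEq_of_mem (hΓ.mem_nhds hz)).fderiv_eq]

theorem ParametrizesNear.congr {c : Phase × Phase} (h : ParametrizesNear ψ Γ C c)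
    (hφ : EqOn φ ψ Γ) : ParametrizesNear φ Γ C c := by
  obtain ⟨hp, U, hU, hcU, hUd, hCU⟩ := h
  have hc := critSet_congr hp.isOpen hφ
  refine ⟨⟨hp.isOpen, hp.ne_zero, hp.conic, hp.smooth.congr hφ, fun z hz t ht => ?_,
    fun z hz => ?_⟩, U, hU, hcU, hUd, ?_⟩
  · rw [hφ hz, hφ (hp.conic z hz t ht), hp.homogeneous z hz t ht]
  · have hn : φ =ᶠ[𝓝 z] ψ := hφ.eventuallyEq_of_mem (hp.isOpen.mem_nhds hz.1)
    have hn' : ∀ v : PhaseArg, (fun w => fderiv ℝ φ w v) =ᶠ[𝓝 z] fun w => fderiv ℝ ψ w v :=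
      fun v => hn.fderiv.mono fun w hw => congrArg (fun A : PhaseArg →L[ℝ] ℝ => A v) hw
    rw [(hn' _).fderiv_eq, (hn' _).fderiv_eq]
    exact hp.nondegenerate z (hc ▸ hz)
  · rw [hCU, hc]
    exact image_congr fun z hz => (phaseMap_congr hp.isOpen hφ hz.1).symm

end Phase

/-! ### The normal form -/

section NormalForm

variable {C : Set (Phase × Phase)}

theorem DiagVanishing.genPoint_eq {g : GenArg → ℝ} {x : V3} (h : DiagVanishing g x) :
    genPoint g (diagArg x) = diagCov x := by
  refine Prod.ext (Prod.ext rfl ?_) (Prod.ext ?_ ?_)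
  · ext i
    exact h.dX i
  · ext i
    fin_cases i
    · rfl
    · exact h.dT
    · change g (diagArg x) - 0 * _ = x 2
      rw [zero_mul, sub_zero, h.val]
  · ext i
    fin_cases i
    · change -dd dirY g (diagArg x) = basisVec 2 0
      rw [h.dY]; simp [basisVec_apply]
    · change (0 : ℝ) = basisVec 2 1
      simp [basisVec_apply]
    · change (1 : ℝ) = basisVec 2 2
      simp [basisVec_apply]

/-- The normal form of the generating function, and the position of the singular and the cusp
set in terms of it. -/
structure NormalGen (C : Set (Phase × Phase)) (g : GenArg → ℝ) (B : Set GenArg)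
    (a : GenArg → ℝ) (s₃ s₄ f : V3 × ℝ → ℝ) : Prop where
  smooth_a : ContDiff ℝ ∞ a
  smooth₃ : ContDiff ℝ ∞ s₃
  smooth₄ : ContDiff ℝ ∞ s₄
  eq : ∀ z ∈ B, g z = z.1 2 + z.2.2 * (z.1 1 + z.2.2 * a z +
    (z.1 0 - z.2.1) ^ 2 * s₄ (z.1, z.2.1)) + (z.1 0 - z.2.1) ^ 4 * s₃ (z.1, z.2.1)
  ne₃ : ∀ z ∈ B, s₃ (z.1, z.2.1) ≠ 0
  ne₄ : ∀ z ∈ B, s₄ (z.1, z.2.1) ≠ 0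
  smooth_f : ∀ z ∈ B, ContDiffAt ℝ ∞ f (z.1, z.2.1)
  f_diag : ∀ z ∈ B, f (z.1, z.1 0) = 0
  sing_iff : ∀ z ∈ B, genPoint g z ∈ singSet Prod.fst C ↔ z.2.2 = f (z.1, z.2.1)
  cusp_iff : ∀ z ∈ B, genPoint g z ∈ cuspSet Prod.fst C ↔ z.2.2 = 0 ∧ z.2.1 = z.1 0

theorem StraightRel.exists_normalGen (hC : StraightRel C) :
    ∃ g B U a s₃ s₄ f, GeneratedBy C g B U ∧ NormalGen C g B a s₃ s₄ f := by
  obtain ⟨g, hg, hgen, hmem, hv, h1, h2, h4⟩ := hC.exists_generating_diagVanishing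
  obtain ⟨a, s₃, s₄, ha, hs₃, hs₄, hs₃0, hs₄0, hnf⟩ := exists_normal_form hg hv h2 h4
  obtain ⟨f, hf, hf0, hfJ⟩ := exists_singular_graph hg hv h1
  obtain ⟨U, hU, hUo, hbU⟩ := eventually_nhds_iff.1 (hgen.and hC.cusp_iff)
  have hg0 : genPoint g 0 = basePoint := by
    have := hv.self_of_nhds.genPoint_eq
    rwa [map_zero] at this
  have hp : Tendsto (fun z : GenArg => (z.1, z.2.1)) (𝓝 0) (𝓝 (0 : V3 × ℝ)) := by
    have : Continuous fun z : GenArg => (z.1, z.2.1) := by fun_prop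
    exact this.tendsto 0
  have hx : Tendsto (fun z : GenArg => z.1) (𝓝 0) (𝓝 0) := continuous_fst.tendsto 0
  have hgU : ∀ᶠ z in 𝓝 (0 : GenArg), genPoint g z ∈ U :=
    (contDiff_genPoint hg).continuous.continuousAt.eventually
      (hUo.mem_nhds (by rwa [hg0]))
  obtain ⟨B, hB, hBo, hB0⟩ := eventually_nhds_iff.1 (hgU.and (hmem.and (hfJ.and (hnf.and
    ((hp.eventually hf).and ((hx.eventually hf0).and ((hx.eventually hv).and
      ((hp.eventually (hs₃.continuous.continuousAt.eventually_ne hs₃0)).and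
        (hp.eventually (hs₄.continuous.continuousAt.eventually_ne hs₄0))))))))))
  have hl : Continuous fun d : Phase × Phase => ((d.1.1, d.2.1 0, d.2.2 1) : GenArg) := by
    fun_prop
  refine ⟨g, B, U ∩ (fun d : Phase × Phase => ((d.1.1, d.2.1 0, d.2.2 1) : GenArg)) ⁻¹' B,
    a, s₃, s₄, f, ⟨hg, hBo, hB0, hUo.inter (hBo.preimage hl), ⟨hbU, ?_⟩, ?_, ?_⟩, ?_⟩
  · have : ((basePoint.1.1, basePoint.2.1 0, basePoint.2.2 1) : GenArg) = 0 := by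
      simp [basePoint, basisVec_apply]
    rw [mem_preimage, this]
    exact hB0
  · intro z hz
    exact ⟨(hB z hz).2.1.1, (hB z hz).1, hz⟩
  · rintro d ⟨hd, hdU, hdB⟩ hd1
    exact ⟨_, hdB, (hU d hdU).1 hd hd1⟩
  refine ⟨ha, hs₃, hs₄, fun z hz => (hB z hz).2.2.2.1,
    fun z hz => (hB z hz).2.2.2.2.2.2.2.1, fun z hz => (hB z hz).2.2.2.2.2.2.2.2,
    fun z hz => (hB z hz).2.2.2.2.1, fun z hz => (hB z hz).2.2.2.2.2.1,
    fun z hz => (hB z hz).2.1.2.trans (hB z hz).2.2.1, fun z hz => ?_⟩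
  rw [(hU _ (hB z hz).1).2]
  constructor
  · rintro ⟨h5, h6⟩
    have h7 : z.2.2 = ((genPoint g z).1.2 2 • basisVec 2) 1 := by
      rw [← h5, ← h6]; rfl
    refine ⟨by rw [h7]; simp [basisVec_apply], ?_⟩
    exact congrArg (fun b : Phase => b.1 0) h6
  · rintro ⟨h5, h6⟩
    have h7 : z = diagArg z.1 := Prod.ext rfl (Prod.ext h6 h5)
    have h8 : genPoint g z = diagCov z.1 := by
      rw [h7]
      exact (hB z hz).2.2.2.2.2.2.1.genPoint_eq
    rw [h8]
    exact ⟨by simp [diagCov, basisVec_apply], rfl⟩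

/-- The phase function is `θ₃ g(x, y₁, θ₂ / θ₃) - y₂ θ₂ - y₃ θ₃`, with the expansion of `g`
inserted. -/
theorem StraightRel.exists_normalPhase (hC : StraightRel C) :
    ∃ (W : Set CoeffArg) (S₂ S₃ S₄ : CoeffArg → ℝ) (f : V3 × ℝ × ℝ → ℝ) (Γ : Set PhaseArg),
    IsOpen W ∧ ((0 : V3), (0 : ℝ), ((0 : ℝ), (1 : ℝ))) ∈ W ∧
    (∀ w ∈ W, 0 < w.2.2.2) ∧
    (∀ w ∈ W, ∀ t : ℝ, 0 < t → (w.1, w.2.1, t • w.2.2) ∈ W) ∧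
    IsSmoothHomog 0 S₂ W ∧ IsSmoothHomog 1 S₃ W ∧ IsSmoothHomog 0 S₄ W ∧
    ((0 : V3), (0 : V3), ((0 : ℝ), (1 : ℝ))) ∈ Γ ∧
    MapsTo coeffArg Γ W ∧
    ParametrizesNear (normalPhase S₂ S₃ S₄) Γ C ((0, basisVec 2), (0, basisVec 2)) ∧
    ContDiffOn ℝ ∞ f {u | ∃ θ₂ : ℝ, (u.1, u.2.1, (θ₂, u.2.2)) ∈ W} ∧
    (∀ w ∈ W, ∀ t : ℝ, 0 < t → f (w.1, w.2.1, t * w.2.2.2) = t * f (w.1, w.2.1, w.2.2.2)) ∧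
    (∀ z ∈ critSet (normalPhase S₂ S₃ S₄) Γ,
      (phaseMap (normalPhase S₂ S₃ S₄) z ∈ singSet Prod.fst C ↔
        z.2.2.1 = f (z.1, z.2.1 0, z.2.2.2)) ∧
      (phaseMap (normalPhase S₂ S₃ S₄) z ∈ singSet Prod.snd C ↔
        z.2.2.1 = f (z.1, z.2.1 0, z.2.2.2))) ∧
    (∀ w ∈ W, w.2.1 = w.1 0 → f (w.1, w.2.1, w.2.2.2) = 0) ∧
    (∀ z ∈ critSet (normalPhase S₂ S₃ S₄) Γ,
      (phaseMap (normalPhase S₂ S₃ S₄) z ∈ cuspSet Prod.fst C ↔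
        z.2.2.1 = 0 ∧ z.2.1 0 = z.1 0) ∧
      (phaseMap (normalPhase S₂ S₃ S₄) z ∈ cuspSet Prod.snd C ↔
        z.2.2.1 = 0 ∧ z.2.1 0 = z.1 0)) ∧
    (∀ w ∈ W, w.2.2.1 = 0 → w.2.1 = w.1 0 →
      fderiv ℝ S₂ w (basisVec 1, 0, (0, 0)) ≠ 0 ∧ S₃ w ≠ 0 ∧ S₄ w ≠ 0) ∧
    (∀ w ∈ W, ∀ w' ∈ W, w.2.2.1 = 0 → w'.2.2.1 = 0 → w.1 1 = w'.1 1 → w.1 2 = w'.1 2 →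
      S₂ w = S₂ w') := by
  obtain ⟨g, B, U, a, s₃, s₄, f, hG, hN⟩ := hC.exists_normalGen
  have hcan := hC.flat.canonical
  let S₂ : CoeffArg → ℝ := fun w => w.1 1 + w.2.2.1 / w.2.2.2 * a (coeffSlice w)
  let S₃ : CoeffArg → ℝ := fun w => w.2.2.2 * s₃ (w.1, w.2.1)
  let S₄ : CoeffArg → ℝ := fun w => s₄ (w.1, w.2.1)
  have hdiv : ∀ (w : CoeffArg) {t : ℝ}, 0 < t →
      t * w.2.2.1 / (t * w.2.2.2) = w.2.2.1 / w.2.2.2 := fun w t ht => mul_div_mul_left _ _ ht.ne'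
  have hS₂ : ∀ w ∈ coneOver B, ContDiffAt ℝ ∞ S₂ w := fun w hw => by
    have h1 : ContDiffAt ℝ ∞ (fun w : CoeffArg => w.1 1) w :=
      ((EuclideanSpace.proj (𝕜 := ℝ) (1 : Fin 3)).contDiff.comp contDiff_fst).contDiffAt
    have h2 := contDiffAt_coeffSlice hw.1
    exact h1.add (h2.snd.snd.mul (hN.smooth_a.contDiffAt.comp w h2))
  have hp : ContDiff ℝ ∞ fun w : CoeffArg => (w.1, w.2.1) :=
    contDiff_fst.prodMk (contDiff_fst.comp contDiff_snd)
  have hφ : EqOn (normalPhase S₂ S₃ S₄) (conicPhase g) (phaseCone B) := by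
    intro z hz
    have h3 : z.2.2.2 ≠ 0 := hz.1.ne'
    have h4 := hN.eq _ hz.2
    simp only [coeffSlice, coeffArg] at h4
    change _ = z.2.2.2 * g (z.1, z.2.1 0, z.2.2.1 / z.2.2.2) - _
    rw [h4]
    simp only [normalPhase, S₂, S₃, S₄, coeffSlice, coeffArg]
    field_simp
    ring
  have hpar := (hG.parametrizesNear hcan).congr hφ
  have hΓ := isOpen_phaseCone hG.isOpen_arg
  have hcrit : ∀ z ∈ critSet (normalPhase S₂ S₃ S₄) (phaseCone B),
      0 < z.2.2.2 ∧ coeffSlice (coeffArg z) ∈ B ∧ phaseMap (normalPhase S₂ S₃ S₄) z =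
        dil₂ z.2.2.2 (genPoint g (coeffSlice (coeffArg z))) := fun z hz =>
    ⟨hz.1.1, hz.1.2, (phaseMap_congr hΓ hφ hz.1).trans
      (phaseMap_conicPhase hG.smooth (critSet_congr hΓ hφ ▸ hz))⟩
  have hsing : ∀ z ∈ critSet (normalPhase S₂ S₃ S₄) (phaseCone B),
      phaseMap (normalPhase S₂ S₃ S₄) z ∈ singSet Prod.fst C ↔
        z.2.2.1 = z.2.2.2 * f (z.1, z.2.1 0) := fun z hz => by
    obtain ⟨h1, h2, h3⟩ := hcrit z hz
    rw [h3, dil_mem_singSet_iff hcan (hG.mem _ h2).1 h1 (Or.inl rfl), hN.sing_iff _ h2]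
    change z.2.2.1 / z.2.2.2 = f (z.1, z.2.1 0) ↔ _
    rw [div_eq_iff h1.ne', mul_comm]
  have hcusp : ∀ z ∈ critSet (normalPhase S₂ S₃ S₄) (phaseCone B),
      phaseMap (normalPhase S₂ S₃ S₄) z ∈ cuspSet Prod.fst C ↔
        z.2.2.1 = 0 ∧ z.2.1 0 = z.1 0 := fun z hz => by
    obtain ⟨h1, h2, h3⟩ := hcrit z hz
    rw [h3, dil_mem_cuspSet_iff hcan (hG.mem _ h2).1 h1, hN.cusp_iff _ h2]
    change z.2.2.1 / z.2.2.2 = 0 ∧ _ ↔ _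
    rw [div_eq_zero_iff, or_iff_left h1.ne']
    rfl
  have h0 : ((0 : V3), (0 : ℝ), ((0 : ℝ), (1 : ℝ))) ∈ coneOver B := by
    refine ⟨one_pos, ?_⟩
    have : coeffSlice ((0 : V3), (0 : ℝ), ((0 : ℝ), (1 : ℝ))) = 0 := by simp [coeffSlice]
    rw [this]
    exact hG.zero_mem
  refine ⟨coneOver B, S₂, S₃, S₄, fun u => u.2.2 * f (u.1, u.2.1), phaseCone B,
    isOpen_coneOver hG.isOpen_arg, h0, fun w hw => hw.1, fun w hw t ht => coneOver_conic hw ht,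
    ⟨fun w hw => (hS₂ w hw).contDiffWithinAt, fun w hw t ht => ?_⟩,
    ⟨?_, fun w hw t ht => ?_⟩, ⟨(hN.smooth₄.comp hp).contDiffOn, fun w hw t ht => ?_⟩,
    h0, fun z hz => hz, hpar, ?_, fun w hw t ht => mul_assoc _ _ _,
    fun z hz => ⟨hsing z hz, ?_⟩, fun w hw h1 => ?_, fun z hz => ⟨hcusp z hz, ?_⟩,
    fun w hw h1 h2 => ⟨?_, ?_, ?_⟩, fun w hw w' hw' h1 h2 h3 h4 => ?_⟩
  · simp only [S₂, coeffSlice_smul w ht, Prod.smul_fst, Prod.smul_snd, smul_eq_mul, hdiv w ht,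
      pow_zero, one_mul]
  · exact ((contDiff_snd.comp (contDiff_snd.comp contDiff_snd)).mul
      (hN.smooth₃.comp hp)).contDiffOn
  · simp only [S₃, Prod.smul_snd, smul_eq_mul, pow_one, mul_assoc]
  · simp only [S₄, pow_zero, one_mul]
  · rintro u ⟨θ, hu⟩
    have h1 : ContDiffAt ℝ ∞ (fun u : V3 × ℝ × ℝ => f (u.1, u.2.1)) u :=
      (hN.smooth_f _ hu.2).comp u (contDiffAt_fst.prodMk contDiffAt_snd.fst)
    exact (contDiffAt_snd.snd.mul h1).contDiffWithinAt
  · rw [hcan.mem_singSet_snd_iff, hsing z hz]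
    obtain ⟨h1, h2, h3⟩ := hcrit z hz
    rw [h3]
    exact hcan.conic _ (hG.mem _ h2).1 _ h1
  · change w.2.2.2 * f (w.1, w.2.1) = 0
    rw [h1]
    exact mul_eq_zero_of_right _ (hN.f_diag _ hw.2)
  · rw [← hC.flat.cuspSet_eq, hcusp z hz]
  · -- on the line `θ₂ = 0` in the direction `∂/∂x₂`, the function `S₂` is `x₂`
    have h3 := hasDerivAt_line ((hS₂ w hw).differentiableAt (by simp)) (basisVec 1, 0, (0, 0))
    have h4 : HasDerivAt (fun t : ℝ => w.1 1 + t) 1 0 := (hasDerivAt_id 0).const_add _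
    have h5 : (fun t : ℝ => S₂ (w + t • (basisVec 1, 0, (0, 0)))) = fun t => w.1 1 + t := by
      funext t
      simp [S₂, h1, basisVec_apply]
    rw [h3.unique (h5 ▸ h4)]
    exact one_ne_zero
  · exact mul_ne_zero hw.1.ne' (hN.ne₃ _ hw.2)
  · exact hN.ne₄ _ hw.2
  · simp only [S₂, h1, h2, zero_div, zero_mul, add_zero, h3]

end NormalForm

end FlatCusp

end

theorem mainTheorem3 {X Y : Type*}
    [TopologicalSpace X] [ChartedSpace FlatCusp.V3 X] [IsManifold (𝓡 3) ∞ X]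
    [TopologicalSpace Y] [ChartedSpace FlatCusp.V3 Y] [IsManifold (𝓡 3) ∞ Y]
    (C : Set (FlatCusp.Cotangent X × FlatCusp.Cotangent Y))
    (hC : FlatCusp.IsFlatTwoSidedCusp C)
    (c₀ : FlatCusp.Cotangent X × FlatCusp.Cotangent Y)
    (hc₀ : FlatCusp.IsCuspPoint C c₀) :
    ∃ e ∈ atlas FlatCusp.V3 X, ∃ e' ∈ atlas FlatCusp.V3 Y,
    c₀.1.1 ∈ e.source ∧ c₀.2.1 ∈ e'.source ∧
    -- homogeneous canonical transformations near the two components of `c₀`, which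
    -- move `c₀` to `(0, dx₃; 0, dy₃)`
    ∃ χL χR : OpenPartialHomeomorph FlatCusp.Phase FlatCusp.Phase,
    FlatCusp.IsHomogCanonical χL ∧ FlatCusp.IsHomogCanonical χR ∧
    χL.source ⊆ e.target ×ˢ Set.univ ∧ χR.source ⊆ e'.target ×ˢ Set.univ ∧
    FlatCusp.cotangentCoord e c₀.1 ∈ χL.source ∧
    FlatCusp.cotangentCoord e' c₀.2 ∈ χR.source ∧
    χL (FlatCusp.cotangentCoord e c₀.1) = (0, FlatCusp.basisVec 2) ∧
    χR (FlatCusp.cotangentCoord e' c₀.2) = (0, FlatCusp.basisVec 2) ∧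
    -- the coefficients `S₂, S₃, S₄` on an open conic neighbourhood `W` of the base point
    ∃ (W : Set FlatCusp.CoeffArg) (S₂ S₃ S₄ : FlatCusp.CoeffArg → ℝ)
      (f : FlatCusp.V3 × ℝ × ℝ → ℝ) (Γ : Set FlatCusp.PhaseArg),
    IsOpen W ∧ ((0 : FlatCusp.V3), (0 : ℝ), ((0 : ℝ), (1 : ℝ))) ∈ W ∧
    (∀ w ∈ W, 0 < w.2.2.2) ∧
    (∀ w ∈ W, ∀ t : ℝ, 0 < t → (w.1, w.2.1, t • w.2.2) ∈ W) ∧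
    FlatCusp.IsSmoothHomog 0 S₂ W ∧ FlatCusp.IsSmoothHomog 1 S₃ W ∧
    FlatCusp.IsSmoothHomog 0 S₄ W ∧
    -- the normal form
    ((0 : FlatCusp.V3), (0 : FlatCusp.V3), ((0 : ℝ), (1 : ℝ))) ∈ Γ ∧
    Set.MapsTo FlatCusp.coeffArg Γ W ∧
    FlatCusp.ParametrizesNear (FlatCusp.normalPhase S₂ S₃ S₄) Γ
      (FlatCusp.conjugate χL χR (FlatCusp.inCharts e e' C))
      ((0, FlatCusp.basisVec 2), (0, FlatCusp.basisVec 2)) ∧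
    -- `Σ₁ = {θ₂ = f}`, for both projections, with `f` smooth and homogeneous of degree one
    ContDiffOn ℝ ∞ f {u | ∃ θ₂ : ℝ, (u.1, u.2.1, (θ₂, u.2.2)) ∈ W} ∧
    (∀ w ∈ W, ∀ t : ℝ, 0 < t → f (w.1, w.2.1, t * w.2.2.2) = t * f (w.1, w.2.1, w.2.2.2)) ∧
    (∀ z ∈ FlatCusp.critSet (FlatCusp.normalPhase S₂ S₃ S₄) Γ,
      (FlatCusp.phaseMap (FlatCusp.normalPhase S₂ S₃ S₄) z ∈
          FlatCusp.singSet Prod.fst (FlatCusp.conjugate χL χR (FlatCusp.inCharts e e' C)) ↔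
        z.2.2.1 = f (z.1, z.2.1 0, z.2.2.2)) ∧
      (FlatCusp.phaseMap (FlatCusp.normalPhase S₂ S₃ S₄) z ∈
          FlatCusp.singSet Prod.snd (FlatCusp.conjugate χL χR (FlatCusp.inCharts e e' C)) ↔
        z.2.2.1 = f (z.1, z.2.1 0, z.2.2.2))) ∧
    -- `Σ₁,₁ = {θ₂ = f, y₁ = x₁} = {θ₂ = 0, y₁ = x₁}`, for both projections
    (∀ w ∈ W, w.2.1 = w.1 0 → f (w.1, w.2.1, w.2.2.2) = 0) ∧
    (∀ z ∈ FlatCusp.critSet (FlatCusp.normalPhase S₂ S₃ S₄) Γ,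
      (FlatCusp.phaseMap (FlatCusp.normalPhase S₂ S₃ S₄) z ∈
          FlatCusp.cuspSet Prod.fst (FlatCusp.conjugate χL χR (FlatCusp.inCharts e e' C)) ↔
        z.2.2.1 = 0 ∧ z.2.1 0 = z.1 0) ∧
      (FlatCusp.phaseMap (FlatCusp.normalPhase S₂ S₃ S₄) z ∈
          FlatCusp.cuspSet Prod.snd (FlatCusp.conjugate χL χR (FlatCusp.inCharts e e' C)) ↔
        z.2.2.1 = 0 ∧ z.2.1 0 = z.1 0)) ∧
    -- nonvanishing on `Σ₁,₁`
    (∀ w ∈ W, w.2.2.1 = 0 → w.2.1 = w.1 0 →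
      fderiv ℝ S₂ w (FlatCusp.basisVec 1, 0, (0, 0)) ≠ 0 ∧ S₃ w ≠ 0 ∧ S₄ w ≠ 0) ∧
    -- on `θ₂ = 0` the function `S₂` depends on `x₂, x₃` only, so no term `(x₁ - y₁)² h` can be
    -- moved between `S₂` and `S₄` there
    (∀ w ∈ W, ∀ w' ∈ W, w.2.2.1 = 0 → w'.2.2.1 = 0 → w.1 1 = w'.1 1 → w.1 2 = w'.1 2 →
      S₂ w = S₂ w') := by
  obtain ⟨e, he⟩ : ∃ e, e = chartAt FlatCusp.V3 c₀.1.1 := ⟨_, rfl⟩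
  obtain ⟨e', he'⟩ : ∃ e', e' = chartAt FlatCusp.V3 c₀.2.1 := ⟨_, rfl⟩
  have hat : e ∈ atlas FlatCusp.V3 X := he ▸ chart_mem_atlas _ _
  have hat' : e' ∈ atlas FlatCusp.V3 Y := he' ▸ chart_mem_atlas _ _
  have hs : c₀.1.1 ∈ e.source := he ▸ mem_chart_source _ _
  have hs' : c₀.2.1 ∈ e'.source := he' ▸ mem_chart_source _ _
  obtain ⟨χL, χR, hL, hR, hcL, hcR, hL0, hR0, hst⟩ :=
    (hC e hat e' hat').flatRel.exists_straight (hc₀.2 e hat e' hat' hs hs')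
  have ho : IsOpen (e.target ×ˢ (Set.univ : Set FlatCusp.V3)) := e.open_target.prod isOpen_univ
  have ho' : IsOpen (e'.target ×ˢ (Set.univ : Set FlatCusp.V3)) :=
    e'.open_target.prod isOpen_univ
  -- shrinking the transformations to the chart domains does not change the conjugated relation
  have hconj : FlatCusp.conjugate (χL.restrOpen _ ho) (χR.restrOpen _ ho')
      (FlatCusp.inCharts e e' C) = FlatCusp.conjugate χL χR (FlatCusp.inCharts e e' C) := by
    have hsub : ∀ c ∈ FlatCusp.inCharts e e' C, c.1.1 ∈ e.target ∧ c.2.1 ∈ e'.target := by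
      rintro _ ⟨d, ⟨-, h1, h2⟩, rfl⟩
      exact ⟨e.map_source h1, e'.map_source h2⟩
    refine congrArg (Set.image fun c : FlatCusp.Phase × FlatCusp.Phase => (χL c.1, χR c.2))
      (Set.ext fun c => and_congr_right fun hc => ?_)
    exact and_congr (and_iff_left ⟨(hsub c hc).1, trivial⟩) (and_iff_left ⟨(hsub c hc).2, trivial⟩)
  refine ⟨e, hat, e', hat', hs, hs', χL.restrOpen _ ho, χR.restrOpen _ ho',
    hL.restr ho fun a ha t _ => ⟨ha.1, trivial⟩, hR.restr ho' fun a ha t _ => ⟨ha.1, trivial⟩,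
    Set.inter_subset_right, Set.inter_subset_right, ⟨hcL, e.map_source hs, trivial⟩,
    ⟨hcR, e'.map_source hs', trivial⟩, hL0, hR0, ?_⟩
  rw [hconj]
  exact hst.exists_normalPhase
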